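/- Let $M$ and $U$ be connected smooth ($C^\infty$, Hausdorff, second countable, without boundary) manifolds of dimension two and one, and let $\dot q=f(q,u)$, $q\in M$, $u\in U$, be a smooth control system, $f(q,u)\in T_qM$, which is strongly convex (or concave): $$f\wedge\frac{\partial f}{\partial u}\neq 0,\qquad \frac{\partial f}{\partial u}\wedge\frac{\partial^2 f}{\partial u^2}\neq 0\qquad\text{for all }(q,u)\in M\times U .$$ *The feedback invariants.* There are a unique $\varepsilon\in\{1,-1\}$ and, for every $(q,u)$, a unique covector $\lambda_{(q,u)}\in T_q^*M$ such that $w\mapsto\langle\lambda_{(q,u)},f(q,w)\rangle$ has a local maximum at $w=u$, with value $\varepsilon$. These covectors form the level surface $\mathcal H=h^{-1}(\varepsilon)$ of the (locally) maximized Hamiltonian $h(\lambda)=\max_u\langle\lambda,f(q,u)\rangle$, which is thus parametrized by $M\times U$. On $\mathcal H$ let $\omega$ be the restriction of the Liouville one-form, and let $\vec h$ be the Hamiltonian vector field of $h$: $\vec h$ projects to $f(q,u)\in T_qM$, and $L_{\vec h}\langle\lambda,Y\rangle=\langle\lambda,[f(\cdot,u),Y]\rangle$ for every smooth vector field $Y$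 on $M$. Let $v$ be the smooth vertical vector field on $\mathcal H$, unique up to sign, such that $$L_v^2\omega=-\varepsilon\,\omega+b\,L_v\omega$$ for some function $b$ (the centro-affine curvature), and let the control curvature $\kappa$ be defined by $[\vec h,[v,\vec h]]=\kappa v$. *Trivializability.* The system is called trivializable if for every $q_0\in M$ and every compact set $K\subset U$ there are smooth local coordinates $\varphi:O\to\mathbb R^2$ on an open neighbourhood $O$ of $q_0$, an open set $V\supset K$ of controls, a smooth map $\psi:O\times V\to U$ such that each $\psi(q,\cdot)$ is a diffeomorphism of $V$ onto an open subset of $U$, and a smooth map $g:\psi(O\times V)\to\mathbb R^2$, with $$d\varphi_q\, f(q,u)=g(\psi(q,u))\qquad (q\in O,\ u\in V),$$ i.e. in the coordinates $\varphi$ and after the feedback $\psi$ the system reads $\dot q=g(u)$. (If $U$ is compact, one may take $K=V=U$, and then every $\psi(q,\cdot)$ is a diffeomorphism of $U$.) **Theorem.** The objects $\varepsilon,\lambda,\vec h,v,b,\kappa$ exist, and for any such choice the system is trivializable if and only if $\kappa$, $L_{\vec h}b$ and $L_{[v,\vec h]}b$ vanish identically on $\mathcal H$. -/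

import Mathlib

open scoped Manifold ContDiff
open VectorField

/-- The model plane `ℝ²`. -/
abbrev Plane : Type := EuclideanSpace ℝ (Fin 2)

/-- The model with corners of a smooth surface (without boundary). -/
noncomputable abbrev surfaceModel : ModelWithCorners ℝ Plane Plane := 𝓘(ℝ, Plane)

/-- The model with corners of a smooth curve (one-dimensional manifold without boundary). -/
noncomputable abbrev curveModel : ModelWithCorners ℝ ℝ ℝ := 𝓘(ℝ, ℝ)

/-- The model with corners of the product `M × U` of a surface and a curve. -/
noncomputable abbrev prodModel : ModelWithCorners ℝ (Plane × ℝ) (ModelProd Plane ℝ) :=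
  surfaceModel.prod curveModel

section

variable {M : Type*} [TopologicalSpace M] [ChartedSpace Plane M]
variable {U : Type*} [TopologicalSpace U] [ChartedSpace ℝ U]

/-- The control system `q̇ = f(q, u)` is smooth: `(q, u) ↦ f(q, u) ∈ T_q M` is a `C^∞` map
`M × U → TM`. -/
def IsSmoothSystem [IsManifold surfaceModel ∞ M]
    (f : (q : M) → U → TangentSpace surfaceModel q) : Prop :=
  ContMDiff prodModel surfaceModel.tangent ∞
    (fun p : M × U => (⟨p.1, f p.1 p.2⟩ : TangentBundle surfaceModel M))

/-- The curve of admissible velocities at `q`, near the control `u`, written in the preferred local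
coordinate of `U` at `u`, with the origin of the coordinate moved to `u`; it is a curve in the
vector space `T_q M`. -/
noncomputable def indicatrix (f : (q : M) → U → TangentSpace surfaceModel q) (q : M) (u : U) :
    ℝ → Plane :=
  fun s => f q ((extChartAt curveModel u).symm (extChartAt curveModel u u + s))

/-- Strong convexity (or concavity): `f ∧ ∂f/∂u ≠ 0` and `∂f/∂u ∧ ∂²f/∂u² ≠ 0` everywhere.
Neither condition depends on the local coordinate used on `U`. -/
def IsStronglyConvex (f : (q : M) → U → TangentSpace surfaceModel q) : Prop :=
  ∀ (q : M) (u : U),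
    LinearIndependent ℝ ![indicatrix f q u 0, deriv (indicatrix f q u) 0] ∧
    LinearIndependent ℝ ![deriv (indicatrix f q u) 0, iteratedDeriv 2 (indicatrix f q u) 0]

/-- The derivative `L_X a` of a function `a` on `M × U` along a vector field `X` on `M × U`. -/
noncomputable def lieDerivFun (X : (p : M × U) → TangentSpace prodModel p) (a : M × U → ℝ)
    (p : M × U) : ℝ :=
  mfderiv prodModel 𝓘(ℝ, ℝ) a p (X p)

/-- The Lie derivative, along a vertical vector field `v` on `M × U`, of the semibasic one-form
`(ξ, τ) ↦ η_{(q,u)}(ξ)` given by a family of covectors `η_{(q,u)} ∈ T_q^* M`. As the flow of `v`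
leaves `q` fixed, it is the derivative of the curve `u ↦ η_{(q,u)}` in the fixed vector space
`T_q^* M` along the component of `v` tangent to `U`. -/
noncomputable def lieDerivForm (v : (p : M × U) → TangentSpace prodModel p)
    (η : M × U → (Plane →L[ℝ] ℝ)) (p : M × U) : Plane →L[ℝ] ℝ :=
  mfderiv curveModel 𝓘(ℝ, Plane →L[ℝ] ℝ) (fun w : U => η (p.1, w)) p.2 (v p).2

/-- The level surface `𝓗 = h⁻¹(ε)` of the maximized Hamiltonian `h(λ) = max_u ⟨λ, f(q, u)⟩`, with
the fields and functions on it that give the feedback invariants of the system.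

A covector `λ` of `𝓗` over `q` is labelled by the control `u` at which the maximum is attained,
so that `𝓗` is parametrized by `M × U` through `(q, u) ↦ cov (q, u) ∈ T_q^* M`, and the fields and
functions on `𝓗` are fields and functions on `M × U`. The maximum is taken over the controls near
`u`, since the velocity curves are only assumed to be strongly convex, not to bound a convex set.
The laws below determine `ε`, `cov`, `ham` uniquely, `κ` as well, and `v`, `b` up to a common
sign. -/
structure FeedbackInvariants (f : (q : M) → U → TangentSpace surfaceModel q)
    [IsManifold surfaceModel ∞ M] [IsManifold curveModel ∞ U] where
  /-- The value of the Hamiltonian on the level surface. -/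
  ε : ℝ
  /-- The covector at which the control `u` is maximizing and the Hamiltonian takes the value `ε`;
  this family is the restriction `ω` of the Liouville form, `ω_{(q,u)}(ξ, τ) = cov (q, u) ξ`. -/
  cov : M × U → (Plane →L[ℝ] ℝ)
  /-- The Hamiltonian vector field on the level surface. -/
  ham : (p : M × U) → TangentSpace prodModel p
  /-- The vertical vector field tangent to the natural parameter of the fibres. -/
  v : (p : M × U) → TangentSpace prodModel p
  /-- The centro-affine curvature. -/
  b : M × U → ℝ
  /-- The control curvature. -/
  κ : M × U → ℝ
  ε_eq : ε = 1 ∨ ε = -1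
  cov_apply : ∀ p : M × U, cov p (f p.1 p.2) = ε
  cov_max : ∀ p : M × U, IsLocalMax (fun w : U => cov p (f p.1 w)) p.2
  /-- First half of Hamilton's equations: `q̇ = f(q, u)` for the maximizing control `u`. -/
  ham_fst : ∀ p : M × U, (ham p).1 = f p.1 p.2
  /-- Second half of Hamilton's equations, `ṗ = - ∂h/∂q = - ⟨p, ∂f/∂q (q, u)⟩` for the maximizing
  control `u`, in coordinate-free form: for every vector field `Y` on `M`, the derivative of the
  function `λ ↦ ⟨λ, Y⟩` along the Hamiltonian field is the Poisson bracket
  `{⟨λ, f(·, u)⟩, ⟨λ, Y⟩} = ⟨λ, [f(·, u), Y]⟩`. -/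
  ham_adjoint : ∀ (p : M × U) (Y : (q : M) → TangentSpace surfaceModel q),
    ContMDiffAt surfaceModel surfaceModel.tangent ∞
      (fun q => (⟨q, Y q⟩ : TangentBundle surfaceModel M)) p.1 →
    lieDerivFun ham (fun p' => cov p' (Y p'.1)) p =
      cov p (mlieBracket surfaceModel (fun q => f q p.2) Y p.1)
  v_smooth : ContMDiff prodModel prodModel.tangent ∞
    (fun p : M × U => (⟨p, v p⟩ : TangentBundle prodModel (M × U)))
  v_vertical : ∀ p : M × U, (v p).1 = 0
  /-- The equation `L_v² ω = - ε ω + b L_v ω`. -/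
  v_natural : ∀ p : M × U,
    lieDerivForm v (lieDerivForm v cov) p = -ε • cov p + b p • lieDerivForm v cov p
  /-- The equation `[ham, [v, ham]] = κ v`. -/
  curvature : ∀ p : M × U,
    mlieBracket prodModel ham (mlieBracket prodModel v ham) p = κ p • v p

/-- The system `q̇ = f(q, u)` is trivializable: near every point `q₀` of `M`, and for all controls in
a neighbourhood `V` of any prescribed compact set `K` of controls (all of `U`, if `U` is compact),
there are local coordinates `φ` of `M` and a smooth feedback `(q, u) ↦ ψ q u` such that each
`ψ q` is a diffeomorphism of `V` onto an open set of controls (an injective map with nowhere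
vanishing derivative), which transform the system into one of the form `q̇ = g(u)`. -/
def IsTrivializable [IsManifold surfaceModel ∞ M] [IsManifold curveModel ∞ U]
    (f : (q : M) → U → TangentSpace surfaceModel q) : Prop :=
  ∀ (q₀ : M) (K : Set U), IsCompact K →
    ∃ φ ∈ IsManifold.maximalAtlas surfaceModel ∞ M, q₀ ∈ φ.source ∧
    ∃ V : Set U, IsOpen V ∧ K ⊆ V ∧
    ∃ (ψ : M → U → U) (g : U → Plane),
      ContMDiffOn prodModel curveModel ∞ (fun p : M × U => ψ p.1 p.2) (φ.source ×ˢ V) ∧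
      (∀ q ∈ φ.source, Set.InjOn (ψ q) V ∧
        ∀ u ∈ V, mfderiv curveModel curveModel (ψ q) u ≠ 0) ∧
      ContMDiffOn curveModel 𝓘(ℝ, Plane) ∞ g
        ((fun p : M × U => ψ p.1 p.2) '' (φ.source ×ˢ V)) ∧
      ∀ q ∈ φ.source, ∀ u ∈ V, mfderiv surfaceModel 𝓘(ℝ, Plane) φ q (f q u) = g (ψ q u)

end

/-!
In coordinates `x` of the surface and `s` of the curve of controls the system is a map
`F : ℝ² × ℝ → ℝ²`, and the laws of the feedback invariants become those of `LocalInvariants`: `η` is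
the maximizing covector, `h = F ∂_x + c ∂_s` the Hamiltonian field, `v = a ∂_s` the natural vertical
field. They say that `F, vF` is a frame of the plane with dual frame `ε η, vη`, that
`v²F = -ε F - b vF`, and that `[h, [v, h]]` is vertical (`LocalInvariants.bracket_bracket_fst`).

*Existence* (`nonempty_feedbackInvariants`). By strong convexity the covector that annihilates
`∂f/∂u` and has the value `±1` on `f` is a nondegenerate local extremum along the velocity curve.
The sign for which it is a maximum is constant, because `M × U` is connected
(`exists_extremalSet_eq_univ`). Hamilton's equations are solved by Cramer's rule, and `v` is the
unit vector of the quadratic form `⟨∂cov/∂u, ∂f/∂u⟩` on the fibres, oriented by the sign of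
`f ∧ ∂f/∂u` over a fixed point of `M`.

*Necessity* (`FeedbackInvariants.isFlatAt_of_isTrivializable`). If `F = g ∘ ψ`, the covectors and
`(vψ)²` are functions of `ψ`; therefore `h` and `[v, h]` are tangent to the level surfaces of `ψ`,
which makes their bracket zero and `b` constant along both
(`LocalInvariants.flat_of_trivial`).

*Sufficiency* (`FeedbackInvariants.isTrivializable_of_isFlatAt`). If `κ`, `L_h b` and `L_{[v, h]} b`
vanish, the Jacobi identity gives `[v, [v, h]] = -ε h - b [v, h]`
(`FlatInvariants.bracket_vert_bracket`). The distribution spanned by `h` and `[v, h]` is then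
integrable, with leaves transverse to the fibres, and on a leaf the velocities `F` and `vF` are
commuting fields of the plane, that is, the coordinate fields of a map `φ`
(`FlatInvariants.exists_leaf_coordinates`). In these coordinates the derivatives of `F` and `vF`
along `h` and `[v, h]` vanish on the leaf. Along a fibre these derivatives satisfy a homogeneous
linear differential equation (`FlatInvariants.eventually_annihilated`), so that they vanish for all
controls, `U` being connected (`FeedbackInvariants.exists_adapted_chart`). Hence `F` has rank one as
a map of `(x, s)` and locally is `g ∘ ψ` (`exists_reparametrization`), with `g` the system at a base
point. Along a compact set of controls the local feedbacks `ψ` agree by uniqueness and define one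
feedback (`exists_feedback_near_compact`).
-/

/-! ### Directional derivatives along a vector field on a normed space -/

section LieD

variable {E G H : Type*} [NormedAddCommGroup E] [NormedSpace ℝ E]
  [NormedAddCommGroup G] [NormedSpace ℝ G] [NormedAddCommGroup H] [NormedSpace ℝ H]

/-- The derivative of a map `g` between normed spaces along a vector field `X`. -/
noncomputable def lieD (X : E → E) (g : E → G) (z : E) : G := fderiv ℝ g z (X z)

variable {Ω : Set E} {X Y : E → E} {g g' : E → G} {z : E}

theorem ContDiffOn.lieD (hΩ : IsOpen Ω) (hg : ContDiffOn ℝ ∞ g Ω) (hX : ContDiffOn ℝ ∞ X Ω) :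
    ContDiffOn ℝ ∞ (lieD X g) Ω :=
  (hg.fderiv_of_isOpen hΩ (by simp)).clm_apply hX

theorem ContDiffOn.lieBracket_vectorField_of_isOpen (hΩ : IsOpen Ω) (hX : ContDiffOn ℝ ∞ X Ω)
    (hY : ContDiffOn ℝ ∞ Y Ω) : ContDiffOn ℝ ∞ (lieBracket ℝ X Y) Ω :=
  (hY.lieD hΩ hX).sub (hX.lieD hΩ hY)

theorem ContDiffOn.differentiableAt_of_isOpen (hg : ContDiffOn ℝ ∞ g Ω) (hΩ : IsOpen Ω)
    (hz : z ∈ Ω) : DifferentiableAt ℝ g z :=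
  (hg.contDiffAt (hΩ.mem_nhds hz)).differentiableAt (by simp)

theorem lieD_congr (hΩ : IsOpen Ω) (h : ∀ y ∈ Ω, g y = g' y) (hz : z ∈ Ω) :
    lieD X g z = lieD X g' z := by
  have : g =ᶠ[nhds z] g' := Filter.eventuallyEq_of_mem (hΩ.mem_nhds hz) h
  rw [lieD, lieD, this.fderiv_eq]

theorem lieD_const (hΩ : IsOpen Ω) {k : G} (h : ∀ y ∈ Ω, g y = k) (hz : z ∈ Ω) :
    lieD X g z = 0 := by
  rw [lieD_congr hΩ (g' := fun _ => k) h hz]; simp [lieD]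

theorem lieD_clm_apply {η : E → G →L[ℝ] H} (hη : DifferentiableAt ℝ η z)
    (hg : DifferentiableAt ℝ g z) :
    lieD X (fun y => η y (g y)) z = lieD X η z (g z) + η z (lieD X g z) := by
  simp [lieD, fderiv_clm_apply hη hg, add_comm]

theorem lieD_clm_apply_const {η : E → G →L[ℝ] H} (hη : DifferentiableAt ℝ η z) (y : G) :
    lieD X (fun x => η x y) z = lieD X η z y := by
  rw [lieD_clm_apply hη (differentiableAt_const y)]; simp [lieD]

theorem lieD_const_clm_apply (A : G →L[ℝ] H) (hg : DifferentiableAt ℝ g z) :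
    lieD X (fun y => A (g y)) z = A (lieD X g z) := by
  rw [lieD_clm_apply (differentiableAt_const A) hg]; simp [lieD]

theorem lieD_add (hg : DifferentiableAt ℝ g z) (hg' : DifferentiableAt ℝ g' z) :
    lieD X (fun y => g y + g' y) z = lieD X g z + lieD X g' z := by
  simp [lieD, fderiv_fun_add hg hg']

theorem lieD_smul {k : E → ℝ} (hk : DifferentiableAt ℝ k z) (hg : DifferentiableAt ℝ g z) :
    lieD X (fun y => k y • g y) z = lieD X k z • g z + k z • lieD X g z := by
  simp [lieD, fderiv_fun_smul hk hg, add_comm]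

theorem lieD_mul {k l : E → ℝ} (hk : DifferentiableAt ℝ k z) (hl : DifferentiableAt ℝ l z) :
    lieD X (fun y => k y * l y) z = lieD X k z * l z + k z * lieD X l z := by
  simpa using lieD_smul (X := X) hk hl

theorem lieD_const_smul (k : ℝ) (hg : DifferentiableAt ℝ g z) :
    lieD X (fun y => k • g y) z = k • lieD X g z := by
  simp [lieD, fderiv_fun_const_smul hg]

theorem two_le_infty : minSmoothness ℝ 2 ≤ (∞ : WithTop ℕ∞) := by
  rw [minSmoothness_of_isRCLikeNormedField]; exact ENat.LEInfty.out

theorem lieD_lieBracket (hΩ : IsOpen Ω) (hg : ContDiffOn ℝ ∞ g Ω) (hX : ContDiffOn ℝ ∞ X Ω)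
    (hY : ContDiffOn ℝ ∞ Y Ω) (hz : z ∈ Ω) :
    lieD (lieBracket ℝ X Y) g z = lieD X (lieD Y g) z - lieD Y (lieD X g) z :=
  fderiv_apply_lieBracket (n := ∞) (hg.contDiffAt (hΩ.mem_nhds hz)) two_le_infty
    (hY.differentiableAt_of_isOpen hΩ hz) (hX.differentiableAt_of_isOpen hΩ hz)

end LieD

/-! ### The determinant of two plane vectors -/

/-- The linear form `y ↦ det (y, w)` on the plane. -/
noncomputable def detForm (w : Plane) : Plane →L[ℝ] ℝ :=
  w 1 • EuclideanSpace.proj 0 - w 0 • EuclideanSpace.proj 1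

theorem detForm_apply (w y : Plane) : detForm w y = y 0 * w 1 - y 1 * w 0 := by
  simp [detForm, mul_comm]

theorem contDiff_detForm : ContDiff ℝ ∞ detForm := by
  have h (i : Fin 2) : ContDiff ℝ ∞ fun w : Plane => w i :=
    (EuclideanSpace.proj (𝕜 := ℝ) i : Plane →L[ℝ] ℝ).contDiff
  exact ((h 1).smul contDiff_const).sub ((h 0).smul contDiff_const)

theorem detForm_self (w : Plane) : detForm w w = 0 := by
  rw [detForm_apply]; ring

theorem detForm_cramer (u w y : Plane) :
    detForm w u • y = detForm w y • u + detForm y u • w := by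
  ext i; fin_cases i <;> simp [detForm_apply] <;> ring

theorem linearIndependent_pair_iff_detForm (u w : Plane) :
    LinearIndependent ℝ ![u, w] ↔ detForm w u ≠ 0 := by
  rw [LinearIndependent.pair_iff]
  constructor
  · intro h h0
    have h1 := h (w 1) (-u 1) (by
      rw [detForm_apply] at h0
      ext i; fin_cases i <;> simp <;> linarith)
    have h2 := h (w 0) (-u 0) (by
      rw [detForm_apply] at h0
      ext i; fin_cases i <;> simp <;> linarith)
    have h3 := h 1 0 (by
      ext i; fin_cases i
      · simpa using h2.2
      · simpa using h1.2)
    exact one_ne_zero h3.1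
  · intro h s t hst
    have h0 := congrArg (fun y : Plane => y 0) hst
    have h1 := congrArg (fun y : Plane => y 1) hst
    simp at h0 h1
    rw [detForm_apply] at h
    refine ⟨(mul_eq_zero.1 (?_ : s * (u 0 * w 1 - u 1 * w 0) = 0)).resolve_right h,
      (mul_eq_zero.1 (?_ : t * (u 0 * w 1 - u 1 * w 0) = 0)).resolve_right h⟩
    · linear_combination w 1 * h0 - w 0 * h1
    · linear_combination u 0 * h1 - u 1 * h0

/-- Two linear forms on the plane which agree on two independent vectors are equal. -/
theorem clm_ext_of_detForm_ne_zero {H : Type*} [NormedAddCommGroup H] [NormedSpace ℝ H]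
    {u w : Plane} (h : detForm w u ≠ 0) {α β : Plane →L[ℝ] H} (hu : α u = β u) (hw : α w = β w) :
    α = β := by
  ext1 y
  have key : ∀ γ : Plane →L[ℝ] H,
      detForm w u • γ y = detForm w y • γ u + detForm y u • γ w := fun γ => by
    rw [← map_smul, detForm_cramer, map_add, map_smul, map_smul]
  have := (key α).trans ((by rw [hu, hw] : _ = _).trans (key β).symm)
  exact smul_right_injective H h this

theorem detForm_smul_left (w : Plane) (k : ℝ) : detForm (k • w) = k • detForm w := by
  ext y; simp [detForm_apply]; ring

/-! ### The feedback invariants in local coordinates -/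

section LocalTheory

/-- The vertical vector field `a ∂_s` on `ℝ² × ℝ`. -/
def vertField (a : Plane × ℝ → ℝ) : Plane × ℝ → Plane × ℝ := fun z => (0, a z)

/-- The vector field `F ∂_x + c ∂_s` on `ℝ² × ℝ`. -/
def hamField (F : Plane × ℝ → Plane) (c : Plane × ℝ → ℝ) : Plane × ℝ → Plane × ℝ :=
  fun z => (F z, c z)

/-- The laws of the feedback invariants, on an open set `Ω` of the coordinate space `ℝ² × ℝ`, except
the one that defines the control curvature: `F` is the control system, `η` the family of covectors,
`a ∂_s` the natural vertical field, `F ∂_x + c ∂_s` the Hamiltonian field and `b` the centro-affine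
curvature. -/
structure LocalInvariants (Ω : Set (Plane × ℝ)) (ε : ℝ) (F : Plane × ℝ → Plane)
    (η : Plane × ℝ → Plane →L[ℝ] ℝ) (a c b : Plane × ℝ → ℝ) : Prop where
  isOpen : IsOpen Ω
  contDiffOn_F : ContDiffOn ℝ ∞ F Ω
  contDiffOn_a : ContDiffOn ℝ ∞ a Ω
  regular : ∀ z ∈ Ω, detForm (fderiv ℝ F z (0, 1)) (F z) ≠ 0
  ε_mul_self : ε * ε = 1
  η_F : ∀ z ∈ Ω, η z (F z) = ε
  η_deriv : ∀ z ∈ Ω, η z (fderiv ℝ F z (0, 1)) = 0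
  natural : ∀ z ∈ Ω, lieD (vertField a) (lieD (vertField a) η) z =
    -ε • η z + b z • lieD (vertField a) η z
  hamilton : ∀ z ∈ Ω, ∀ y, lieD (hamField F c) η z y = -η z (fderiv ℝ F z (y, 0))

theorem fderiv_vert {G : Type*} [NormedAddCommGroup G] [NormedSpace ℝ G] (g : Plane × ℝ → G)
    (z : Plane × ℝ) (t : ℝ) : fderiv ℝ g z (0, t) = t • fderiv ℝ g z (0, 1) := by
  rw [← map_smul]; simp

theorem fderiv_split {G : Type*} [NormedAddCommGroup G] [NormedSpace ℝ G] (g : Plane × ℝ → G)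
    (z w : Plane × ℝ) :
    fderiv ℝ g z w = fderiv ℝ g z (w.1, 0) + w.2 • fderiv ℝ g z (0, 1) := by
  rw [← fderiv_vert, ← map_add]; simp

theorem lieD_vertField {G : Type*} [NormedAddCommGroup G] [NormedSpace ℝ G] (g : Plane × ℝ → G)
    (a : Plane × ℝ → ℝ) (z : Plane × ℝ) :
    lieD (vertField a) g z = a z • fderiv ℝ g z (0, 1) := by
  rw [lieD, vertField, fderiv_vert]

theorem lieD_fst {V W : Plane × ℝ → Plane × ℝ} {z : Plane × ℝ} (hW : DifferentiableAt ℝ W z) :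
    (lieD V W z).1 = lieD V (fun y => (W y).1) z := by
  simp [lieD, fderiv.fst hW]

theorem lieD_snd {V W : Plane × ℝ → Plane × ℝ} {z : Plane × ℝ} (hW : DifferentiableAt ℝ W z) :
    (lieD V W z).2 = lieD V (fun y => (W y).2) z := by
  simp [lieD, fderiv.snd hW]

section Cramer

variable {Ω : Set (Plane × ℝ)} {ε : ℝ} {F : Plane × ℝ → Plane}
    {η : Plane × ℝ → Plane →L[ℝ] ℝ} {z : Plane × ℝ}

/-- A covector with prescribed values on `F` and `∂F/∂s` is given by Cramer's rule. -/
theorem eq_smul_detForm (h : detForm (fderiv ℝ F z (0, 1)) (F z) ≠ 0) (hηF : η z (F z) = ε)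
    (hηd : η z (fderiv ℝ F z (0, 1)) = 0) :
    η z = (ε * (detForm (fderiv ℝ F z (0, 1)) (F z))⁻¹) • detForm (fderiv ℝ F z (0, 1)) := by
  refine clm_ext_of_detForm_ne_zero h ?_ ?_
  · simp [hηF, h]
  · simp [hηd, detForm_self]

theorem contDiffOn_covector (hΩ : IsOpen Ω) (hF : ContDiffOn ℝ ∞ F Ω)
    (h : ∀ z ∈ Ω, detForm (fderiv ℝ F z (0, 1)) (F z) ≠ 0) (hηF : ∀ z ∈ Ω, η z (F z) = ε)
    (hηd : ∀ z ∈ Ω, η z (fderiv ℝ F z (0, 1)) = 0) : ContDiffOn ℝ ∞ η Ω := by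
  have h0 : ContDiffOn ℝ ∞ (fun z => fderiv ℝ F z (0, 1)) Ω :=
    hF.lieD hΩ (X := fun _ => (0, 1)) contDiffOn_const
  have h1 := contDiff_detForm.comp_contDiffOn h0
  have h2 := (h1.clm_apply hF).inv h
  exact ((contDiffOn_const.mul h2).smul h1).congr fun z hz =>
    eq_smul_detForm (h z hz) (hηF z hz) (hηd z hz)

end Cramer

namespace LocalInvariants

variable {Ω : Set (Plane × ℝ)} {ε : ℝ} {F : Plane × ℝ → Plane}
    {η : Plane × ℝ → Plane →L[ℝ] ℝ} {a c b : Plane × ℝ → ℝ}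
    (D : LocalInvariants Ω ε F η a c b) {z : Plane × ℝ}

include D

theorem ε_ne_zero : ε ≠ 0 := fun h => by simpa [h] using D.ε_mul_self

theorem contDiffOn_η : ContDiffOn ℝ ∞ η Ω :=
  contDiffOn_covector D.isOpen D.contDiffOn_F D.regular D.η_F D.η_deriv

theorem contDiffOn_vert : ContDiffOn ℝ ∞ (vertField a) Ω := contDiffOn_const.prodMk D.contDiffOn_a

theorem contDiffOn_vF : ContDiffOn ℝ ∞ (lieD (vertField a) F) Ω :=
  D.contDiffOn_F.lieD D.isOpen D.contDiffOn_vert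

theorem contDiffOn_vvF : ContDiffOn ℝ ∞ (lieD (vertField a) (lieD (vertField a) F)) Ω :=
  D.contDiffOn_vF.lieD D.isOpen D.contDiffOn_vert

theorem contDiffOn_vη : ContDiffOn ℝ ∞ (lieD (vertField a) η) Ω :=
  D.contDiffOn_η.lieD D.isOpen D.contDiffOn_vert

theorem diff {G : Type*} [NormedAddCommGroup G] [NormedSpace ℝ G] {g : Plane × ℝ → G}
    (hg : ContDiffOn ℝ ∞ g Ω) (hz : z ∈ Ω) : DifferentiableAt ℝ g z :=
  hg.differentiableAt_of_isOpen D.isOpen hz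

theorem η_vF (hz : z ∈ Ω) : η z (lieD (vertField a) F z) = 0 := by
  rw [lieD_vertField, map_smul, D.η_deriv z hz, smul_zero]

/-- Differentiating an identity `η(g) = k` along a vector field. -/
theorem leibniz {ζ : Plane × ℝ → Plane →L[ℝ] ℝ} {g : Plane × ℝ → Plane}
    {X : Plane × ℝ → Plane × ℝ} {k : ℝ} (hζ : ContDiffOn ℝ ∞ ζ Ω) (hg : ContDiffOn ℝ ∞ g Ω)
    (h : ∀ y ∈ Ω, ζ y (g y) = k) (hz : z ∈ Ω) : ζ z (lieD X g z) = -lieD X ζ z (g z) := by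
  have := lieD_clm_apply (X := X) (D.diff hζ hz) (D.diff hg hz)
  rw [lieD_const D.isOpen h hz] at this
  linarith

theorem vη_F (hz : z ∈ Ω) : lieD (vertField a) η z (F z) = 0 := by
  have := D.leibniz (X := vertField a) D.contDiffOn_η D.contDiffOn_F D.η_F hz
  rw [D.η_vF hz] at this
  linarith

theorem vη_vF (hz : z ∈ Ω) : lieD (vertField a) η z (lieD (vertField a) F z) = 1 := by
  rw [D.leibniz D.contDiffOn_vη D.contDiffOn_F (k := 0) (fun y hy => D.vη_F hy) hz,
    D.natural z hz]
  simp [D.vη_F hz, D.η_F z hz, D.ε_mul_self]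

theorem η_vvF (hz : z ∈ Ω) :
    η z (lieD (vertField a) (lieD (vertField a) F) z) = -1 := by
  rw [D.leibniz D.contDiffOn_η D.contDiffOn_vF (k := 0) (fun y hy => D.η_vF hy) hz, D.vη_vF hz]

theorem vη_vvF (hz : z ∈ Ω) :
    lieD (vertField a) η z (lieD (vertField a) (lieD (vertField a) F) z) = -b z := by
  rw [D.leibniz D.contDiffOn_vη D.contDiffOn_vF (k := 1) (fun y hy => D.vη_vF hy) hz,
    D.natural z hz]
  simp [D.η_vF hz, D.vη_vF hz]

theorem a_ne_zero (hz : z ∈ Ω) : a z ≠ 0 := fun h => by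
  have := D.vη_vF hz
  rw [lieD_vertField F, h] at this
  simp at this

/-- The frame `F, vF` of the plane has the dual frame `ε η, vη`. -/
theorem frame (hz : z ∈ Ω) (y : Plane) :
    y = (ε * η z y) • F z + lieD (vertField a) η z y • lieD (vertField a) F z := by
  have h : detForm (lieD (vertField a) F z) (F z) ≠ 0 := by
    rw [lieD_vertField, detForm_smul_left]
    simpa [D.a_ne_zero hz] using D.regular z hz
  have := clm_ext_of_detForm_ne_zero h (α := .id ℝ Plane) (β :=
    (ε • η z).smulRight (F z) + (lieD (vertField a) η z).smulRight (lieD (vertField a) F z))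
    (by simp [D.vη_F hz, D.η_F z hz, D.ε_mul_self]) (by simp [D.η_vF hz, D.vη_vF hz])
  simpa using congrArg (fun L : Plane →L[ℝ] Plane => L y) this

theorem eq_of_pairing (hz : z ∈ Ω) {y y' : Plane} (h : η z y = η z y')
    (h' : lieD (vertField a) η z y = lieD (vertField a) η z y') : y = y' := by
  rw [D.frame hz y, D.frame hz y', h, h']

theorem vvF_eq (hz : z ∈ Ω) : lieD (vertField a) (lieD (vertField a) F) z =
    -ε • F z - b z • lieD (vertField a) F z := by
  refine D.eq_of_pairing hz ?_ ?_
  · simp [D.η_vvF hz, D.η_F z hz, D.η_vF hz, D.ε_mul_self]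
  · simp [D.vη_vvF hz, D.vη_F hz, D.vη_vF hz]

theorem contDiffOn_b : ContDiffOn ℝ ∞ b Ω :=
  (D.contDiffOn_vη.clm_apply D.contDiffOn_vvF).neg.congr fun z hz => by
    simp [D.vη_vvF hz]

theorem deriv_η_vF (hz : z ∈ Ω) :
    fderiv ℝ η z (0, 1) (lieD (vertField a) F z) = (a z)⁻¹ := by
  have := D.vη_vF hz
  rw [lieD_vertField η] at this
  exact eq_inv_of_mul_eq_one_right (by simpa using this)

theorem c_eq (hz : z ∈ Ω) : c z = a z * (-η z (fderiv ℝ F z (lieD (vertField a) F z, 0)) -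
    fderiv ℝ η z (F z, 0) (lieD (vertField a) F z)) := by
  have h := D.hamilton z hz (lieD (vertField a) F z)
  rw [lieD, fderiv_split] at h
  simp [hamField, D.deriv_η_vF hz] at h
  have := D.a_ne_zero hz
  field_simp at h
  linear_combination h

theorem contDiffOn_c : ContDiffOn ℝ ∞ c Ω := by
  have h1 : ContDiffOn ℝ ∞ (fun z => fderiv ℝ F z (lieD (vertField a) F z, 0)) Ω :=
    D.contDiffOn_F.lieD D.isOpen (D.contDiffOn_vF.prodMk contDiffOn_const)
  have h2 : ContDiffOn ℝ ∞ (fun z => fderiv ℝ η z (F z, 0)) Ω :=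
    D.contDiffOn_η.lieD D.isOpen (D.contDiffOn_F.prodMk contDiffOn_const)
  exact (D.contDiffOn_a.mul ((D.contDiffOn_η.clm_apply h1).neg.sub
    (h2.clm_apply D.contDiffOn_vF))).congr fun z hz => D.c_eq hz

theorem contDiffOn_ham : ContDiffOn ℝ ∞ (hamField F c) Ω :=
  D.contDiffOn_F.prodMk D.contDiffOn_c

theorem contDiffOn_bracket : ContDiffOn ℝ ∞ (lieBracket ℝ (vertField a) (hamField F c)) Ω :=
  D.contDiffOn_vert.lieBracket_vectorField_of_isOpen D.isOpen D.contDiffOn_ham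

theorem bracket_fst (hz : z ∈ Ω) :
    (lieBracket ℝ (vertField a) (hamField F c) z).1 = lieD (vertField a) F z := by
  have h1 : lieBracket ℝ (vertField a) (hamField F c) z =
    lieD (vertField a) (hamField F c) z - lieD (hamField F c) (vertField a) z := rfl
  rw [h1, Prod.fst_sub, lieD_fst (D.diff D.contDiffOn_ham hz),
    lieD_fst (D.diff D.contDiffOn_vert hz)]
  simp [hamField, vertField, lieD]

theorem bracket_bracket_fst_eq (hz : z ∈ Ω) :
    (lieBracket ℝ (hamField F c) (lieBracket ℝ (vertField a) (hamField F c)) z).1 =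
      lieD (hamField F c) (lieD (vertField a) F) z -
        lieD (lieBracket ℝ (vertField a) (hamField F c)) F z := by
  have h1 : lieBracket ℝ (hamField F c) (lieBracket ℝ (vertField a) (hamField F c)) z =
    lieD (hamField F c) (lieBracket ℝ (vertField a) (hamField F c)) z -
    lieD (lieBracket ℝ (vertField a) (hamField F c)) (hamField F c) z := rfl
  rw [h1, Prod.fst_sub, lieD_fst (D.diff D.contDiffOn_bracket hz),
    lieD_fst (D.diff D.contDiffOn_ham hz),
    lieD_congr D.isOpen (g' := lieD (vertField a) F) (fun y hy => D.bracket_fst hy) hz]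
  rfl

/-- The bracket `[h, [v, h]]` is vertical. Its horizontal part is killed by `η`, because the
Hamiltonian field preserves the contact form, and by `vη`. -/
theorem bracket_bracket_fst (hz : z ∈ Ω) :
    (lieBracket ℝ (hamField F c) (lieBracket ℝ (vertField a) (hamField F c)) z).1 = 0 := by
  set V := vertField a with hV
  set X := hamField F c with hX
  set Y := lieBracket ℝ V X with hY
  set N := lieD V F with hN
  rw [D.bracket_bracket_fst_eq hz, sub_eq_zero]
  have hYF : lieD Y F z = fderiv ℝ F z (N z, 0) + (Y z).2 • fderiv ℝ F z (0, 1) := by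
    rw [lieD, fderiv_split, D.bracket_fst hz]
  have ha := D.a_ne_zero hz
  have hvηs : lieD V η z (fderiv ℝ F z (0, 1)) = (a z)⁻¹ := by
    have := D.vη_vF hz
    rw [lieD_vertField F, map_smul, smul_eq_mul] at this
    exact eq_inv_of_mul_eq_one_right this
  refine D.eq_of_pairing hz ?_ ?_
  · rw [D.leibniz D.contDiffOn_η D.contDiffOn_vF (k := 0) (fun y hy => D.η_vF hy) hz,
      D.hamilton z hz, hYF]
    simp [D.η_deriv z hz, hN, hV]
  · -- The derivative of Hamilton's equation along `v` gives `X(vη) = v(Xη) - Yη`.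
    have hcomm : lieD X (lieD V η) z = lieD V (lieD X η) z - lieD Y η z := by
      rw [hY, lieD_lieBracket D.isOpen D.contDiffOn_η D.contDiffOn_vert D.contDiffOn_ham hz]
      abel
    have hXη : ContDiffOn ℝ ∞ (lieD X η) Ω := D.contDiffOn_η.lieD D.isOpen D.contDiffOn_ham
    have hconst : ∀ y : Plane, ContDiffOn ℝ ∞ (fun z => fderiv ℝ F z (y, 0)) Ω := fun y =>
      D.contDiffOn_F.lieD D.isOpen (X := fun _ => (y, 0)) contDiffOn_const
    have hVX : ∀ y : Plane, lieD V (lieD X η) z y = -lieD V η z (fderiv ℝ F z (y, 0)) -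
        η z (lieD V (fun z => fderiv ℝ F z (y, 0)) z) := by
      intro y
      rw [← lieD_clm_apply_const (D.diff hXη hz)]
      rw [lieD_congr D.isOpen (g' := fun z => -η z (fderiv ℝ F z (y, 0)))
        (fun w hw => D.hamilton w hw y) hz]
      have : lieD V (fun z => -η z (fderiv ℝ F z (y, 0))) z =
          -lieD V (fun z => η z (fderiv ℝ F z (y, 0))) z := by
        simp [lieD]
      rw [this, lieD_clm_apply (D.diff D.contDiffOn_η hz) (D.diff (hconst y) hz)]
      ring
    -- Modulo `∂F/∂s`, differentiation along `v` commutes with differentiation in the plane.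
    have hswap : ∀ y : Plane, η z (lieD V (fun z => fderiv ℝ F z (y, 0)) z) =
        -fderiv ℝ η z (y, 0) (N z) := by
      intro y
      set W : Plane × ℝ → Plane × ℝ := fun _ => (y, 0) with hW
      have hWs : ContDiffOn ℝ ∞ W Ω := contDiffOn_const
      have h1 := lieD_lieBracket D.isOpen D.contDiffOn_F D.contDiffOn_vert hWs hz
      have h2 : lieBracket ℝ (vertField a) W z = (0, -lieD W a z) := by
        have h3 : lieBracket ℝ (vertField a) W z = lieD V W z - lieD W V z := rfl
        rw [h3]
        refine Prod.ext ?_ ?_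
        · rw [Prod.fst_sub, lieD_fst (D.diff hWs hz), lieD_fst (D.diff D.contDiffOn_vert hz)]
          simp [hW, hV, vertField, lieD]
        · rw [Prod.snd_sub, lieD_snd (D.diff hWs hz), lieD_snd (D.diff D.contDiffOn_vert hz)]
          simp [hW, hV, vertField, lieD]
      rw [lieD, h2, fderiv_vert] at h1
      have h4 : lieD V (fun z => fderiv ℝ F z (y, 0)) z =
          -lieD W a z • fderiv ℝ F z (0, 1) + lieD W N z := by
        rw [h1]; simp only [hN, hV, sub_add_cancel]; rfl
      rw [h4, map_add, map_smul, D.η_deriv z hz, smul_zero, zero_add,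
        D.leibniz D.contDiffOn_η D.contDiffOn_vF (k := 0) (fun y hy => D.η_vF hy) hz]
      rfl
    have hYη : lieD Y η z (N z) = fderiv ℝ η z (N z, 0) (N z) + (Y z).2 * (a z)⁻¹ := by
      rw [lieD, fderiv_split, D.bracket_fst hz, ← D.deriv_η_vF hz]
      simp [hN, hV]
    rw [D.leibniz D.contDiffOn_vη D.contDiffOn_vF (k := 1) (fun y hy => D.vη_vF hy) hz, hcomm]
    rw [sub_apply, hVX, hswap, hYη, hYF, map_add, map_smul, hvηs]
    simp [hN, hV]
    ring

end LocalInvariants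

end LocalTheory

/-! ### Inverse functions, primitives of closed forms and linear equations -/

section Calculus

variable {E G : Type*} [NormedAddCommGroup E] [NormedSpace ℝ E]
  [NormedAddCommGroup G] [NormedSpace ℝ G]

theorem isInvertible_of_injective [FiniteDimensional ℝ E] {L : E →L[ℝ] E}
    (h : Function.Injective L) : L.IsInvertible :=
  ⟨(LinearEquiv.ofInjectiveEndo (L : E →ₗ[ℝ] E) h).toContinuousLinearEquiv, by ext; rfl⟩

/-- The inverse function theorem, with the inverse smooth on the whole target. -/
theorem ContDiffOn.exists_openPartialHomeomorph [CompleteSpace E] {Ω : Set E} {g : E → G} {z : E}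
    (hΩ : IsOpen Ω) (hg : ContDiffOn ℝ ∞ g Ω) (hinv : ∀ y ∈ Ω, (fderiv ℝ g y).IsInvertible)
    (hz : z ∈ Ω) : ∃ Φ : OpenPartialHomeomorph E G, (Φ : E → G) = g ∧ z ∈ Φ.source ∧
      Φ.source ⊆ Ω ∧ ContDiffOn ℝ ∞ Φ.symm Φ.target := by
  have hder : ∀ y ∈ Ω, HasFDerivAt g (fderiv ℝ g y) y := fun y hy =>
    (hg.differentiableAt_of_isOpen hΩ hy).hasFDerivAt
  obtain ⟨e, he⟩ := hinv z hz
  have hz' := hder z hz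
  rw [← he] at hz'
  have hgz := hg.contDiffAt (hΩ.mem_nhds hz)
  have hn : (∞ : WithTop ℕ∞) ≠ 0 := by simp
  let Φ := (hgz.toOpenPartialHomeomorph g hz' hn).restrOpen Ω hΩ
  refine ⟨Φ, rfl, ⟨hgz.mem_toOpenPartialHomeomorph_source hz' hn, hz⟩, fun y hy => hy.2, ?_⟩
  intro w hw
  have hsrc : Φ.symm w ∈ Ω := (Φ.map_target hw).2
  obtain ⟨e', he'⟩ := hinv _ hsrc
  have h1 := hder _ hsrc
  rw [← he'] at h1
  exact (Φ.contDiffAt_symm hw h1 (hg.contDiffAt (hΩ.mem_nhds hsrc))).contDiffWithinAt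

/-- A closed smooth one-form has a smooth primitive near every point. -/
theorem exists_primitive {Ω : Set E} {τ : E → E →L[ℝ] G} [CompleteSpace G] {z : E}
    (hΩ : IsOpen Ω) (hτ : ContDiffOn ℝ ∞ τ Ω)
    (hsymm : ∀ y ∈ Ω, ∀ u w, fderiv ℝ τ y u w = fderiv ℝ τ y w u) (hz : z ∈ Ω) :
    ∃ (t : E → G) (O : Set E), IsOpen O ∧ z ∈ O ∧ O ⊆ Ω ∧ ContDiffOn ℝ ∞ t O ∧
      ∀ y ∈ O, HasFDerivAt t (τ y) y := by
  obtain ⟨r, hr, hball⟩ := Metric.isOpen_iff.1 hΩ z hz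
  obtain ⟨t, ht⟩ := (convex_ball z r).exists_forall_hasFDerivAt_of_fderiv_symmetric
    Metric.isOpen_ball
    (fun y hy => (hτ.differentiableAt_of_isOpen hΩ (hball hy)).differentiableWithinAt)
    (fun y hy => hsymm y (hball hy))
  refine ⟨t, Metric.ball z r, Metric.isOpen_ball, Metric.mem_ball_self hr, hball, ?_, ht⟩
  rw [contDiffOn_infty_iff_fderiv_of_isOpen Metric.isOpen_ball]
  exact ⟨fun y hy => (ht y hy).differentiableAt.differentiableWithinAt,
    (hτ.mono hball).congr fun y hy => (ht y hy).fderiv⟩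

/-- Solving the equation `g (x, s) = r` for `s`, where `∂g/∂s ≠ 0`. -/
theorem exists_solution [FiniteDimensional ℝ E] {Ω : Set (E × ℝ)} {g : E × ℝ → ℝ} {z : E × ℝ}
    (hΩ : IsOpen Ω) (hg : ContDiffOn ℝ ∞ g Ω) (hne : ∀ y ∈ Ω, fderiv ℝ g y (0, 1) ≠ 0)
    (hz : z ∈ Ω) : ∃ (ρ : E × ℝ → ℝ) (W : Set (E × ℝ)) (O : Set (E × ℝ)),
      IsOpen W ∧ ContDiffOn ℝ ∞ ρ W ∧ (∀ w ∈ W, (w.1, ρ w) ∈ Ω ∧ g (w.1, ρ w) = w.2) ∧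
      IsOpen O ∧ z ∈ O ∧ O ⊆ Ω ∧ ∀ y ∈ O, (y.1, g y) ∈ W ∧ ρ (y.1, g y) = y.2 := by
  have : CompleteSpace E := FiniteDimensional.complete ℝ E
  have hsm : ContDiffOn ℝ ∞ (fun y : E × ℝ => (y.1, g y)) Ω := contDiffOn_fst.prodMk hg
  obtain ⟨Φ, hΦ, hzΦ, hsub, hsymm⟩ := hsm.exists_openPartialHomeomorph hΩ (fun y hy => by
    have hd := hg.differentiableAt_of_isOpen hΩ hy
    have : fderiv ℝ (fun y : E × ℝ => (y.1, g y)) y =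
        (ContinuousLinearMap.fst ℝ E ℝ).prod (fderiv ℝ g y) :=
      (hasFDerivAt_fst.prodMk hd.hasFDerivAt).fderiv
    rw [this]
    refine isInvertible_of_injective ((injective_iff_map_eq_zero _).2 ?_)
    rintro ⟨u, t⟩ h
    simp only [ContinuousLinearMap.prod_apply, ContinuousLinearMap.coe_fst', Prod.mk_eq_zero] at h
    obtain ⟨rfl, h⟩ := h
    have : fderiv ℝ g y (0, t) = t * fderiv ℝ g y (0, 1) := by
      rw [← smul_eq_mul, ← map_smul]; simp
    rw [this] at h
    simpa [hne y hy] using h) hz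
  have hmap : ∀ w ∈ Φ.target, ((Φ.symm w).1, g (Φ.symm w)) = w := fun w hw => by
    have := Φ.right_inv hw
    rwa [hΦ] at this
  refine ⟨fun w => (Φ.symm w).2, Φ.target, Φ.source, Φ.open_target,
    contDiff_snd.comp_contDiffOn hsymm,
    fun w hw => ?_, Φ.open_source, hzΦ, hsub, fun y hy => ?_⟩
  · have h1 := hmap w hw
    have h2 : (w.1, (Φ.symm w).2) = Φ.symm w := Prod.ext (congrArg Prod.fst h1).symm rfl
    rw [h2]
    exact ⟨hsub (Φ.map_target hw), congrArg Prod.snd h1⟩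
  · have h1 := Φ.map_source hy
    have h2 := Φ.left_inv hy
    rw [hΦ] at h1 h2
    exact ⟨h1, by simp only [h2]⟩

/-- A solution of a linear differential equation which vanishes at a time vanishes near it. -/
theorem eventually_eq_zero_of_hasDerivAt_linear {A : ℝ → E →L[ℝ] E} {y : ℝ → E} {s : ℝ}
    (hA : ContinuousAt A s) (hy : ∀ᶠ t in nhds s, HasDerivAt y (A t (y t)) t) (h0 : y s = 0) :
    ∀ᶠ t in nhds s, y t = 0 := by
  have hK : ∀ᶠ t in nhds s, ‖A t‖₊ < ‖A s‖₊ + 1 :=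
    hA.nnnorm.eventually_lt_const (by simp)
  exact ODE_solution_unique_of_eventually (v := fun t => A t) (s := fun _ => Set.univ)
    (K := ‖A s‖₊ + 1) (g := fun _ => 0)
    (hK.mono fun t ht => ((A t).lipschitz.weaken ht.le).lipschitzOnWith)
    (hy.mono fun t ht => ⟨ht, Set.mem_univ _⟩)
    (Filter.Eventually.of_forall fun t => ⟨by simpa using hasDerivAt_const t (0 : E),
      Set.mem_univ _⟩)
    h0

/-- If a one-form `τ` is constant on two vector fields and kills their bracket, then its exterior
derivative vanishes on them. -/
theorem fderiv_form_symm {Ω : Set E} {τ : E → E →L[ℝ] G} {X Y : E → E} {k l : G} {z : E}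
    (hΩ : IsOpen Ω) (hτ : DifferentiableAt ℝ τ z) (hX : DifferentiableAt ℝ X z)
    (hY : DifferentiableAt ℝ Y z) (hz : z ∈ Ω) (hτX : ∀ y ∈ Ω, τ y (X y) = k)
    (hτY : ∀ y ∈ Ω, τ y (Y y) = l) (hXY : τ z (lieBracket ℝ X Y z) = 0) :
    fderiv ℝ τ z (X z) (Y z) = fderiv ℝ τ z (Y z) (X z) := by
  have h1 := lieD_clm_apply (X := X) hτ hY
  rw [lieD_const hΩ hτY hz] at h1
  have h2 := lieD_clm_apply (X := Y) hτ hX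
  rw [lieD_const hΩ hτX hz] at h2
  have h3 : lieBracket ℝ X Y z = lieD X Y z - lieD Y X z := rfl
  rw [h3, map_sub] at hXY
  simp only [lieD] at h1 h2 hXY
  have := h1.symm.trans h2
  rw [sub_eq_zero.1 hXY] at this
  exact add_right_cancel this

end Calculus

/-! ### Flat systems in local coordinates -/

section Flat

/-- Local feedback invariants such that `κ`, `L_h b` and `L_{[v, h]} b` vanish. -/
structure FlatInvariants (Ω : Set (Plane × ℝ)) (ε : ℝ) (F : Plane × ℝ → Plane)
    (η : Plane × ℝ → Plane →L[ℝ] ℝ) (a c b : Plane × ℝ → ℝ) : Prop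
    extends LocalInvariants Ω ε F η a c b where
  bracket_eq_zero : ∀ z ∈ Ω,
    lieBracket ℝ (hamField F c) (lieBracket ℝ (vertField a) (hamField F c)) z = 0
  ham_b : ∀ z ∈ Ω, lieD (hamField F c) b z = 0
  bracket_b : ∀ z ∈ Ω, lieD (lieBracket ℝ (vertField a) (hamField F c)) b z = 0

namespace LocalInvariants

variable {Ω : Set (Plane × ℝ)} {ε : ℝ} {F : Plane × ℝ → Plane}
    {η : Plane × ℝ → Plane →L[ℝ] ℝ} {a c b : Plane × ℝ → ℝ}
    (D : LocalInvariants Ω ε F η a c b) {z : Plane × ℝ}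

include D

/-- The fields `h`, `[v, h]`, `v` form a frame of the coordinate space. -/
theorem frame_space (hz : z ∈ Ω) (w : Plane × ℝ) :
    w = (ε * η z w.1) • hamField F c z +
      lieD (vertField a) η z w.1 • lieBracket ℝ (vertField a) (hamField F c) z +
      ((w.2 - ε * η z w.1 * c z - lieD (vertField a) η z w.1 *
        (lieBracket ℝ (vertField a) (hamField F c) z).2) / a z) • vertField a z := by
  have ha := D.a_ne_zero hz
  refine Prod.ext ?_ ?_
  · rw [Prod.fst_add, Prod.fst_add, Prod.smul_fst, Prod.smul_fst, Prod.smul_fst, D.bracket_fst hz]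
    simpa [hamField, vertField] using D.frame hz w.1
  · simp only [hamField, vertField, Prod.snd_add, Prod.smul_snd, smul_eq_mul]
    field_simp
    ring

end LocalInvariants

namespace FlatInvariants

variable {Ω : Set (Plane × ℝ)} {ε : ℝ} {F : Plane × ℝ → Plane}
    {η : Plane × ℝ → Plane →L[ℝ] ℝ} {a c b : Plane × ℝ → ℝ}
    (D : FlatInvariants Ω ε F η a c b) {z : Plane × ℝ}

include D

/-- In a flat system `[v, [v, h]]` is a combination of `h` and `[v, h]`. A priori it also has a
component `γ` along `v`; as `h` commutes with `[v, h]`, the Jacobi identity shows that it commutes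
with `[v, [v, h]]`, and this forces `γ = 0`. -/
theorem bracket_vert_bracket (hz : z ∈ Ω) :
    lieBracket ℝ (vertField a) (lieBracket ℝ (vertField a) (hamField F c)) z =
      -ε • hamField F c z - b z • lieBracket ℝ (vertField a) (hamField F c) z := by
  have L := D.toLocalInvariants
  have hΩ := L.isOpen
  have sV := L.contDiffOn_vert
  have sX := L.contDiffOn_ham
  have sY := L.contDiffOn_bracket
  have sb := L.contDiffOn_b
  have hXY := D.bracket_eq_zero
  have hN : ∀ z ∈ Ω, lieD (vertField a) F z ≠ 0 := fun z hz h0 => by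
    have := L.vη_vF hz
    rw [h0] at this
    simp at this
  have hYfst := fun z (hz : z ∈ Ω) => L.bracket_fst hz
  have hham := D.ham_b
  set V := vertField a with hV
  set X := hamField F c with hX
  set Y := lieBracket ℝ V X with hY
  have sW : ContDiffOn ℝ ∞ (lieBracket ℝ V Y) Ω := sV.lieBracket_vectorField_of_isOpen hΩ sY
  let γ : Plane × ℝ → ℝ := fun z => ((lieBracket ℝ V Y z).2 + ε * (X z).2 + b z * (Y z).2) / a z
  have sγ : ContDiffOn ℝ ∞ γ Ω :=
    (((contDiff_snd.comp_contDiffOn sW).add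
      (contDiffOn_const.mul (contDiff_snd.comp_contDiffOn sX))).add
      (sb.mul (contDiff_snd.comp_contDiffOn sY))).div L.contDiffOn_a fun z hz => L.a_ne_zero hz
  have hW : ∀ z ∈ Ω, lieBracket ℝ V Y z = (-ε) • X z + ((fun y => (-b y) • Y y) +
      fun y => γ y • V y) z := by
    intro z hz
    refine Prod.ext ?_ ?_
    · have h1 : lieBracket ℝ V Y z = lieD V Y z - lieD Y V z := rfl
      have h2 : (lieBracket ℝ V Y z).1 = lieD V (lieD V F) z := by
        rw [h1, Prod.fst_sub, lieD_fst (L.diff sY hz), lieD_fst (L.diff sV hz),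
          lieD_congr hΩ (g' := lieD V F) hYfst hz]
        simp [hV, vertField, lieD]
      rw [h2, L.vvF_eq hz]
      have h3 : (Y z).1 = lieD V F z := hYfst z hz
      simp [hV, hX, hamField, vertField, h3]
      abel
    · have := L.a_ne_zero hz
      simp [γ, hV, vertField]
      field_simp
      ring
  -- The horizontal part of `[h, -ε h - b [v, h] + γ v] = 0` reads `γ vF = 0`, because `L_h b = 0`.
  have hγ : ∀ z ∈ Ω, γ z = 0 := by
    intro z hz
    have hev : lieBracket ℝ V Y =ᶠ[nhds z] ((-ε) • X) + ((fun y => (-b y) • Y y) +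
      fun y => γ y • V y) := Filter.eventuallyEq_of_mem (hΩ.mem_nhds hz) hW
    have d := fun {g : Plane × ℝ → Plane × ℝ} (hg : ContDiffOn ℝ ∞ g Ω) => L.diff hg hz
    have s1 : ContDiffOn ℝ ∞ (fun y => (-b y) • Y y) Ω := sb.neg.smul sY
    have s2 : ContDiffOn ℝ ∞ (fun y => γ y • V y) Ω := sγ.smul sV
    have j := leibniz_identity_lieBracket (n := ∞) two_le_infty (U := X) (V := V) (W := Y) (x := z)
      (sX.contDiffAt (hΩ.mem_nhds hz)) (sV.contDiffAt (hΩ.mem_nhds hz))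
      (sY.contDiffAt (hΩ.mem_nhds hz))
    have e1 : lieBracket ℝ X V =ᶠ[nhds z] (-1 : ℝ) • Y :=
      Filter.Eventually.of_forall fun y => by simp [hY, lieBracket_swap (V := X) (W := V)]
    have e2 : lieBracket ℝ X Y =ᶠ[nhds z] 0 :=
      Filter.eventuallyEq_of_mem (hΩ.mem_nhds hz) hXY
    have hYY : lieBracket ℝ Y Y z = 0 := by simp [lieBracket]
    rw [e1.lieBracket_vectorField_eq Filter.EventuallyEq.rfl,
      Filter.EventuallyEq.rfl.lieBracket_vectorField_eq e2, lieBracket_const_smul_left (d sY), hYY,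
      Filter.EventuallyEq.rfl.lieBracket_vectorField_eq hev,
      lieBracket_add_right ((d sX).const_smul _) ((d s1).add (d s2)),
      lieBracket_add_right (d s1) (d s2), lieBracket_const_smul_right (d sX),
      lieBracket_smul_right (L.diff sb.neg hz) (d sY), lieBracket_smul_right (L.diff sγ hz) (d sV),
      hXY z hz] at j
    have hXX : lieBracket ℝ X X z = 0 := by simp [lieBracket]
    have hb : fderiv ℝ (fun y => -b y) z (X z) = 0 := by
      have := hham z hz
      rw [lieD] at this
      simp [this]
    have hXV : lieBracket ℝ X V z = -Y z := by rw [hY, lieBracket_swap]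
    rw [hXX, hb, hXV] at j
    have j1 := congrArg Prod.fst j
    have h3 : (Y z).1 = lieD V F z := hYfst z hz
    simp [hV, vertField] at j1
    rw [h3] at j1
    exact j1.resolve_right (hN z hz)
  rw [hW z hz]
  simp [hγ z hz]
  abel

/-- The one-form dual to `v` in the frame `h`, `[v, h]`, `v` is closed; it has a local primitive
`t`, whose level surfaces are the leaves of the distribution spanned by `h` and `[v, h]`. -/
theorem exists_leaf_function (hz : z ∈ Ω) : ∃ (t : Plane × ℝ → ℝ) (O : Set (Plane × ℝ)),
    IsOpen O ∧ z ∈ O ∧ O ⊆ Ω ∧ ContDiffOn ℝ ∞ t O ∧ ∀ y ∈ O, ∀ w : Plane × ℝ,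
      fderiv ℝ t y w = (w.2 - ε * η y w.1 * c y - lieD (vertField a) η y w.1 *
        (lieBracket ℝ (vertField a) (hamField F c) y).2) / a y := by
  have L := D.toLocalInvariants
  have hΩ := L.isOpen
  have sV := L.contDiffOn_vert
  have sX := L.contDiffOn_ham
  have sY := L.contDiffOn_bracket
  have hXY := D.bracket_eq_zero
  have hVY := fun z (hz : z ∈ Ω) => D.bracket_vert_bracket hz
  have hfr := fun z (hz : z ∈ Ω) w => L.frame_space hz w
  have hYfst := fun z (hz : z ∈ Ω) => L.bracket_fst hz
  set V := vertField a with hV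
  set X := hamField F c with hX
  set Y := lieBracket ℝ V X with hY
  let τ : Plane × ℝ → Plane × ℝ →L[ℝ] ℝ := fun y => (a y)⁻¹ • (ContinuousLinearMap.snd ℝ Plane ℝ -
    ((ε * c y) • η y + (Y y).2 • lieD V η y).comp (ContinuousLinearMap.fst ℝ Plane ℝ))
  have hτ : ∀ y w, τ y w =
      (w.2 - ε * η y w.1 * c y - lieD V η y w.1 * (Y y).2) / a y := by
    intro y w; simp [τ]; ring
  have sτ : ContDiffOn ℝ ∞ τ Ω :=
    (L.contDiffOn_a.inv fun z hz => L.a_ne_zero hz).smul (contDiffOn_const.sub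
      ((((contDiffOn_const.mul L.contDiffOn_c).smul L.contDiffOn_η).add
        ((contDiff_snd.comp_contDiffOn sY).smul L.contDiffOn_vη)).clm_comp contDiffOn_const))
  have τV : ∀ y ∈ Ω, τ y (V y) = 1 := fun y hy => by
    have := L.a_ne_zero hy
    simp [hτ, hV, vertField, this]
  have τX : ∀ y ∈ Ω, τ y (X y) = 0 := fun y hy => by
    have := L.vη_F hy
    simp [hτ, hX, hV, hamField, L.η_F y hy, L.ε_mul_self, this]
  have τY : ∀ y ∈ Ω, τ y (Y y) = 0 := fun y hy => by
    have h1 : (Y y).1 = lieD V F y := hYfst y hy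
    have h2 := L.η_vF hy
    have h3 := L.vη_vF hy
    rw [hτ, h1, hV, h2, h3]
    simp
  -- As `τ` is constant on the fields of the frame and kills their brackets, `dτ = 0`.
  have hsymm : ∀ y ∈ Ω, ∀ u w, fderiv ℝ τ y u w = fderiv ℝ τ y w u := by
    intro y hy u w
    have d := fun {g : Plane × ℝ → Plane × ℝ} (hg : ContDiffOn ℝ ∞ g Ω) => L.diff hg hy
    have dτ := L.diff sτ hy
    have hvx := fderiv_form_symm hΩ dτ (d sV) (d sX) hy τV τX (τY y hy)
    have hvy := fderiv_form_symm hΩ dτ (d sV) (d sY) hy τV τY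
      (by rw [hVY y hy]; simp [τX y hy, τY y hy])
    have hxy := fderiv_form_symm hΩ dτ (d sX) (d sY) hy τX τY (by rw [hXY y hy]; simp)
    rw [hfr y hy u, hfr y hy w]
    simp only [map_add, map_smul, add_apply, smul_apply, hvx, hvy, hxy]
    simp only [smul_eq_mul]
    ring
  obtain ⟨t, O, hO, hzO, hsub, ht, hder⟩ := exists_primitive hΩ sτ hsymm hz
  exact ⟨t, O, hO, hzO, hsub, ht, fun y hy w => by rw [(hder y hy).fderiv, hτ]⟩

/-- The graph `s = σ x` of a local leaf of the distribution spanned by `h` and `[v, h]`. -/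
theorem exists_leaf (hz : z ∈ Ω) : ∃ (σ : Plane → ℝ) (O : Set Plane), IsOpen O ∧ z.1 ∈ O ∧
    ContDiffOn ℝ ∞ σ O ∧ ∀ x ∈ O, (x, σ x) ∈ Ω ∧ ∀ y, (y, fderiv ℝ σ x y) =
      (ε * η (x, σ x) y) • hamField F c (x, σ x) + lieD (vertField a) η (x, σ x) y •
        lieBracket ℝ (vertField a) (hamField F c) (x, σ x) := by
  have L := D.toLocalInvariants
  obtain ⟨t, O, hO, hzO, hsub, ht, hder⟩ := D.exists_leaf_function hz
  obtain ⟨ρ, W, O', hW, hρ, hρt, hO', hzO', -, hρ'⟩ := exists_solution hO ht (fun y hy => by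
    rw [hder y hy]; simpa using L.a_ne_zero (hsub hy)) hzO
  let k : Plane → Plane × ℝ := fun x => (x, t z)
  have hk : ContDiff ℝ ∞ k := contDiff_id.prodMk contDiff_const
  have hkW : IsOpen (k ⁻¹' W) := hW.preimage hk.continuous
  have sσ : ContDiffOn ℝ ∞ (fun x => ρ (k x)) (k ⁻¹' W) :=
    hρ.comp hk.contDiffOn (fun x hx => hx)
  refine ⟨fun x => ρ (k x), k ⁻¹' W, hkW, (hρ' z hzO').1, sσ, fun x hx => ?_⟩
  have hxO : (x, ρ (k x)) ∈ O := (hρt _ hx).1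
  refine ⟨hsub hxO, fun y => ?_⟩
  have hσd := (sσ.differentiableAt_of_isOpen hkW hx).hasFDerivAt
  have hι : HasFDerivAt (fun x => (x, ρ (k x)))
      ((ContinuousLinearMap.id ℝ Plane).prod (fderiv ℝ (fun x => ρ (k x)) x)) x :=
    (hasFDerivAt_id x).prodMk hσd
  have htd := (ht.differentiableAt_of_isOpen hO hxO).hasFDerivAt
  have hcomp := htd.comp x hι
  have hconst : (t ∘ fun x => (x, ρ (k x))) =ᶠ[nhds x] fun _ => t z :=
    Filter.eventuallyEq_of_mem (hkW.mem_nhds hx) fun x' hx' => (hρt _ hx').2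
  have h0 := hcomp.unique ((hasFDerivAt_const (t z) x).congr_of_eventuallyEq hconst)
  have h1 := congrArg (fun A : Plane →L[ℝ] ℝ => A y) h0
  have h2 : fderiv ℝ t (x, ρ (k x)) (y, fderiv ℝ (fun x => ρ (k x)) x y) = 0 := h1
  have h3 := L.frame_space (hsub hxO) (y, fderiv ℝ (fun x => ρ (k x)) x y)
  rw [← hder _ hxO, h2, zero_smul, add_zero] at h3
  exact h3

end FlatInvariants

end Flat

section Flat

theorem lieD_vertField_clm_fst_apply {a : Plane × ℝ → ℝ} {A : Plane → Plane →L[ℝ] Plane}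
    {g : Plane × ℝ → Plane} {z : Plane × ℝ} (hA : DifferentiableAt ℝ A z.1)
    (hg : DifferentiableAt ℝ g z) :
    lieD (vertField a) (fun y => A y.1 (g y)) z = A z.1 (lieD (vertField a) g z) := by
  have h : HasFDerivAt (fun y : Plane × ℝ => A y.1) _ z :=
    hA.hasFDerivAt.comp z hasFDerivAt_fst
  rw [lieD_clm_apply h.differentiableAt hg, lieD, h.fderiv]
  simp [vertField]

namespace FlatInvariants

variable {Ω : Set (Plane × ℝ)} {ε : ℝ} {F : Plane × ℝ → Plane}
    {η : Plane × ℝ → Plane →L[ℝ] ℝ} {a c b : Plane × ℝ → ℝ}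
    (D : FlatInvariants Ω ε F η a c b) {z : Plane × ℝ}

include D

/-- In a flat system the velocities `F` and `vF` along a leaf are commuting fields on the plane, so
that they are the coordinate fields of a local coordinate map `φ`. -/
theorem exists_leaf_coordinates (hz : z ∈ Ω) : ∃ (σ : Plane → ℝ) (φ : Plane → Plane) (O : Set Plane)
    (e₁ e₂ : Plane), IsOpen O ∧ z.1 ∈ O ∧ ContDiffOn ℝ ∞ σ O ∧ ContDiffOn ℝ ∞ φ O ∧
    (∀ x ∈ O, (fderiv ℝ φ x).IsInvertible) ∧ ∀ x ∈ O, (x, σ x) ∈ Ω ∧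
      fderiv ℝ φ x (F (x, σ x)) = e₁ ∧
      fderiv ℝ φ x (lieD (vertField a) F (x, σ x)) = e₂ ∧
      (F (x, σ x), fderiv ℝ σ x (F (x, σ x))) = hamField F c (x, σ x) ∧
      (lieD (vertField a) F (x, σ x), fderiv ℝ σ x (lieD (vertField a) F (x, σ x))) =
        lieBracket ℝ (vertField a) (hamField F c) (x, σ x) := by
  have L := D.toLocalInvariants
  have hΩ := L.isOpen
  obtain ⟨σ, O, hO, hzO, sσ, hσ⟩ := D.exists_leaf hz
  let ι : Plane → Plane × ℝ := fun x => (x, σ x)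
  have sι : ContDiffOn ℝ ∞ ι O := contDiffOn_id.prodMk sσ
  have hιΩ : ∀ x ∈ O, ι x ∈ Ω := fun x hx => (hσ x hx).1
  have hι : ∀ x ∈ O, HasFDerivAt ι ((ContinuousLinearMap.id ℝ Plane).prod (fderiv ℝ σ x)) x :=
    fun x hx => (hasFDerivAt_id x).prodMk (sσ.differentiableAt_of_isOpen hO hx).hasFDerivAt
  have hcomp : ∀ {H : Type} [NormedAddCommGroup H] [NormedSpace ℝ H] {g : Plane × ℝ → H},
      ContDiffOn ℝ ∞ g Ω → ContDiffOn ℝ ∞ (fun x => g (ι x)) O := fun hg => hg.comp sι hιΩ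
  set V := vertField a with hV
  set X := hamField F c with hX
  set Y := lieBracket ℝ V X with hY
  set N := lieD V F with hN
  have sN : ContDiffOn ℝ ∞ N Ω := L.contDiffOn_vF
  -- The fields `h` and `[v, h]` are tangent to the leaf.
  have tX : ∀ x ∈ O, (F (ι x), fderiv ℝ σ x (F (ι x))) = X (ι x) := by
    intro x hx
    have h2 := (hσ x hx).2 (F (ι x))
    rwa [show (x, σ x) = ι x from rfl, L.η_F _ (hιΩ x hx), L.vη_F (hιΩ x hx), L.ε_mul_self,
      one_smul, zero_smul, add_zero] at h2
  have tY : ∀ x ∈ O, (N (ι x), fderiv ℝ σ x (N (ι x))) = Y (ι x) := by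
    intro x hx
    have h2 := (hσ x hx).2 (N (ι x))
    rwa [show (x, σ x) = ι x from rfl, L.η_vF (hιΩ x hx), L.vη_vF (hιΩ x hx), mul_zero,
      one_smul, zero_smul, zero_add] at h2
  have hιd : ∀ x ∈ O, ∀ {g : Plane × ℝ → Plane}, ContDiffOn ℝ ∞ g Ω → ∀ y,
      fderiv ℝ (fun x => g (ι x)) x y = fderiv ℝ g (ι x) (y, fderiv ℝ σ x y) := by
    intro x hx g hg y
    have h1 := (L.diff hg (hιΩ x hx)).hasFDerivAt.comp x (hι x hx)
    have h3 : fderiv ℝ (fun x => g (ι x)) x = _ := h1.fderiv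
    rw [h3]
    rfl
  obtain ⟨e₁, he₁⟩ : ∃ e : Plane, e 0 = 1 ∧ e 1 = 0 := ⟨!₂[1, 0], by simp⟩
  obtain ⟨e₂, he₂⟩ : ∃ e : Plane, e 0 = 0 ∧ e 1 = 1 := ⟨!₂[0, 1], by simp⟩
  -- The plane-valued one-form which sends the frame `F, vF` along the leaf to the standard basis.
  -- It is closed because the frame commutes, and `φ` is its primitive.
  let J : Plane → Plane →L[ℝ] Plane := fun x =>
    (ε • η (ι x)).smulRight e₁ + (lieD V η (ι x)).smulRight e₂
  have hJ : ∀ x y, J x y = (ε * η (ι x) y) • e₁ + (lieD V η (ι x) y) • e₂ := fun x y => by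
    simp [J]
  have sη : ContDiffOn ℝ ∞ (fun x => ε • η (ι x)) O :=
    ContDiffOn.fun_smul (f := fun _ => ε) (g := fun x => η (ι x)) contDiffOn_const
      (L.contDiffOn_η.comp sι hιΩ)
  have sνη : ContDiffOn ℝ ∞ (fun x => lieD V η (ι x)) O := L.contDiffOn_vη.comp sι hιΩ
  have sJ : ContDiffOn ℝ ∞ J O := by
    have s1 : ContDiffOn ℝ ∞ (fun x => (ε • η (ι x)).smulRight e₁) O :=
      sη.smulRight contDiffOn_const
    have s2 : ContDiffOn ℝ ∞ (fun x => (lieD V η (ι x)).smulRight e₂) O :=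
      sνη.smulRight contDiffOn_const
    exact s1.add s2
  have hJF : ∀ x ∈ O, J x (F (ι x)) = e₁ := fun x hx => by
    rw [hJ, L.η_F _ (hιΩ x hx), L.vη_F (hιΩ x hx), L.ε_mul_self]; simp
  have hJN : ∀ x ∈ O, J x (N (ι x)) = e₂ := fun x hx => by
    rw [hJ, L.η_vF (hιΩ x hx), L.vη_vF (hιΩ x hx)]; simp
  have hJinv : ∀ x ∈ O, (J x).IsInvertible := fun x hx => by
    refine isInvertible_of_injective ((injective_iff_map_eq_zero _).2 fun y hy => ?_)
    rw [hJ] at hy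
    have h0 := congrArg (fun y : Plane => y 0) hy
    have h1 := congrArg (fun y : Plane => y 1) hy
    simp [he₁, he₂] at h0 h1
    refine L.eq_of_pairing (hιΩ x hx) ?_ ?_
    · simpa [L.ε_ne_zero] using h0
    · simpa using h1
  have hsymm : ∀ x ∈ O, ∀ u w, fderiv ℝ J x u w = fderiv ℝ J x w u := by
    intro x hx u w
    have key := fderiv_form_symm hO (sJ.differentiableAt_of_isOpen hO hx)
      ((hcomp L.contDiffOn_F).differentiableAt_of_isOpen hO hx)
      ((hcomp sN).differentiableAt_of_isOpen hO hx) hx hJF hJN (by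
        have : lieBracket ℝ (fun x => F (ι x)) (fun x => N (ι x)) x = 0 := by
          rw [lieBracket, hιd x hx sN, hιd x hx L.contDiffOn_F, tX x hx, tY x hx]
          exact (L.bracket_bracket_fst_eq (hιΩ x hx)).symm.trans
            (L.bracket_bracket_fst (hιΩ x hx))
        rw [this, map_zero])
    rw [L.frame (hιΩ x hx) u, L.frame (hιΩ x hx) w]
    simp only [map_add, map_smul, add_apply, smul_apply]
    rw [show lieD (vertField a) F = N from rfl, key]
    simp only [smul_add, smul_smul, mul_comm]
    abel
  obtain ⟨φ, O', hO', hzO', hsub, sφ, hφ⟩ := exists_primitive hO sJ hsymm hzO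
  refine ⟨σ, φ, O', e₁, e₂, hO', hzO', sσ.mono hsub, sφ,
    fun x hx => by rw [(hφ x hx).fderiv]; exact hJinv x (hsub hx),
    fun x hx => ⟨hιΩ x (hsub hx), ?_, ?_, tX x (hsub hx), tY x (hsub hx)⟩⟩
  · rw [(hφ x hx).fderiv]; exact hJF x (hsub hx)
  · rw [(hφ x hx).fderiv]; exact hJN x (hsub hx)

/-- In the coordinates given by a leaf, the system and its derivative along `v` are constant along
this leaf. -/
theorem exists_adapted_map (hz : z ∈ Ω) : ∃ (φ : Plane → Plane) (O : Set Plane), IsOpen O ∧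
    z.1 ∈ O ∧ ContDiffOn ℝ ∞ φ O ∧ (∀ x ∈ O, (fderiv ℝ φ x).IsInvertible) ∧
    ∀ x ∈ O, ∃ s, (x, s) ∈ Ω ∧ ∀ X : Plane × ℝ → Plane × ℝ,
      X = hamField F c ∨ X = lieBracket ℝ (vertField a) (hamField F c) →
      lieD X (fun y => fderiv ℝ φ y.1 (F y)) (x, s) = 0 ∧
      lieD X (lieD (vertField a) (fun y => fderiv ℝ φ y.1 (F y))) (x, s) = 0 := by
  have L := D.toLocalInvariants
  have hΩ := L.isOpen
  obtain ⟨σ, φ, O, e₁, e₂, hO, hzO, sσ, sφ, hinv, hσ⟩ := D.exists_leaf_coordinates hz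
  have sN : ContDiffOn ℝ ∞ (lieD (vertField a) F) Ω := L.contDiffOn_vF
  refine ⟨φ, O, hO, hzO, sφ, hinv, fun x hx => ⟨σ x, (hσ x hx).1, ?_⟩⟩
  let Ω' : Set (Plane × ℝ) := Ω ∩ Prod.fst ⁻¹' O
  have hΩ' : IsOpen Ω' := hΩ.inter (hO.preimage continuous_fst)
  have sA : ContDiffOn ℝ ∞ (fderiv ℝ φ) O := sφ.fderiv_of_isOpen hO (by simp)
  have sA' : ContDiffOn ℝ ∞ (fun y : Plane × ℝ => fderiv ℝ φ y.1) Ω' :=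
    sA.comp contDiffOn_fst fun y hy => hy.2
  have sG : ContDiffOn ℝ ∞ (fun y : Plane × ℝ => fderiv ℝ φ y.1 (F y)) Ω' :=
    sA'.clm_apply (L.contDiffOn_F.mono Set.inter_subset_left)
  have sG' : ContDiffOn ℝ ∞ (fun y : Plane × ℝ => fderiv ℝ φ y.1 (lieD (vertField a) F y)) Ω' :=
    sA'.clm_apply (sN.mono Set.inter_subset_left)
  have hVG : ∀ y ∈ Ω', lieD (vertField a) (fun y => fderiv ℝ φ y.1 (F y)) y =
      fderiv ℝ φ y.1 (lieD (vertField a) F y) := fun y hy =>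
    lieD_vertField_clm_fst_apply (sA.differentiableAt_of_isOpen hO hy.2)
      (L.diff L.contDiffOn_F hy.1)
  have hxΩ' : (x, σ x) ∈ Ω' := ⟨(hσ x hx).1, hx⟩
  have hι : HasFDerivAt (fun x => (x, σ x))
      ((ContinuousLinearMap.id ℝ Plane).prod (fderiv ℝ σ x)) x :=
    (hasFDerivAt_id x).prodMk (sσ.differentiableAt_of_isOpen hO hx).hasFDerivAt
  have hzero : ∀ {g : Plane × ℝ → Plane} {k : Plane}, ContDiffOn ℝ ∞ g Ω' →
      (∀ x ∈ O, g (x, σ x) = k) → ∀ y, fderiv ℝ g (x, σ x) (y, fderiv ℝ σ x y) = 0 := by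
    intro g k hg hk y
    have h1 := (hg.differentiableAt_of_isOpen hΩ' hxΩ').hasFDerivAt.comp x hι
    have h2 : (g ∘ fun x => (x, σ x)) =ᶠ[nhds x] fun _ => k :=
      Filter.eventuallyEq_of_mem (hO.mem_nhds hx) hk
    exact congrArg (fun A : Plane →L[ℝ] Plane => A y)
      (h1.unique ((hasFDerivAt_const k x).congr_of_eventuallyEq h2))
  obtain ⟨-, -, -, tX, tY⟩ := hσ x hx
  have hmain : ∀ W : Plane × ℝ → Plane × ℝ,
      W = hamField F c ∨ W = lieBracket ℝ (vertField a) (hamField F c) →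
      ∀ {g : Plane × ℝ → Plane} {k : Plane},
      ContDiffOn ℝ ∞ g Ω' → (∀ x ∈ O, g (x, σ x) = k) → lieD W g (x, σ x) = 0 := by
    intro W hW g k hg hk
    rcases hW with hW | hW
    · rw [lieD, hW, ← tX]
      exact hzero hg hk _
    · rw [lieD, hW, ← tY]
      exact hzero hg hk _
  intro W hW
  refine ⟨hmain W hW sG fun x hx => (hσ x hx).2.1, ?_⟩
  rw [lieD_congr hΩ' hVG hxΩ']
  exact hmain W hW sG' fun x hx => (hσ x hx).2.2.1

/-- If a solution `G` of `v²G = -ε G - b vG` is annihilated, together with `vG`, by `h` and `[v, h]`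
at a point, then so it is along the vertical line through this point: the derivatives in question
solve a linear differential equation. -/
theorem eventually_annihilated {G : Plane × ℝ → Plane} (hG : ContDiffOn ℝ ∞ G Ω)
    (hVVG : ∀ y ∈ Ω, lieD (vertField a) (lieD (vertField a) G) y =
      -ε • G y - b y • lieD (vertField a) G y) (hz : z ∈ Ω)
    (h0 : ∀ X : Plane × ℝ → Plane × ℝ,
      X = hamField F c ∨ X = lieBracket ℝ (vertField a) (hamField F c) →
      lieD X G z = 0 ∧ lieD X (lieD (vertField a) G) z = 0) :
    ∀ᶠ s in nhds z.2, ∀ X : Plane × ℝ → Plane × ℝ,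
      X = hamField F c ∨ X = lieBracket ℝ (vertField a) (hamField F c) →
      lieD X G (z.1, s) = 0 ∧ lieD X (lieD (vertField a) G) (z.1, s) = 0 := by
  have L := D.toLocalInvariants
  have hΩ := L.isOpen
  have hXb := D.ham_b
  have hYb := D.bracket_b
  have sV := L.contDiffOn_vert
  have sX := L.contDiffOn_ham
  have sY := L.contDiffOn_bracket
  have hVY := fun z (hz : z ∈ Ω) => D.bracket_vert_bracket hz
  have sVG : ContDiffOn ℝ ∞ (lieD (vertField a) G) Ω := hG.lieD hΩ L.contDiffOn_vert
  set V := vertField a with hV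
  set X := hamField F c with hX
  set Y := lieBracket ℝ V X with hY
  have hcommX : ∀ {g : Plane × ℝ → Plane}, ContDiffOn ℝ ∞ g Ω → ∀ y ∈ Ω,
      lieD V (lieD X g) y = lieD Y g y + lieD X (lieD V g) y := fun hg y hy => by
    rw [hY, lieD_lieBracket hΩ hg sV sX hy]; abel
  have hcommY : ∀ {g : Plane × ℝ → Plane}, ContDiffOn ℝ ∞ g Ω → ∀ y ∈ Ω,
      lieD V (lieD Y g) y = -ε • lieD X g y - b y • lieD Y g y + lieD Y (lieD V g) y := by
    intro g hg y hy
    have h1 := lieD_lieBracket hΩ hg sV sY hy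
    have h2 : lieD (lieBracket ℝ V Y) g y = -ε • lieD X g y - b y • lieD Y g y := by
      rw [lieD, hVY y hy]; simp [lieD]
    rw [← h2, h1]; abel
  have hWVV : ∀ W : Plane × ℝ → Plane × ℝ, ∀ y ∈ Ω, lieD W b y = 0 →
      lieD W (lieD V (lieD V G)) y = -ε • lieD W G y - b y • lieD W (lieD V G) y := by
    intro W y hy hb
    have h1 : lieD W (lieD V (lieD V G)) y =
        lieD W (fun y => -ε • G y + (-1 : ℝ) • (b y • lieD V G y)) y :=
      lieD_congr hΩ (fun y hy => by rw [hVVG y hy]; simp [sub_eq_add_neg]) hy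
    have d := fun {g : Plane × ℝ → Plane} (hg : ContDiffOn ℝ ∞ g Ω) => L.diff hg hy
    have db := L.diff L.contDiffOn_b hy
    have d1 : DifferentiableAt ℝ (fun y => -ε • G y) y := (d hG).fun_const_smul _
    have d2 : DifferentiableAt ℝ (fun y => b y • lieD V G y) y := db.smul (d sVG)
    have d3 : DifferentiableAt ℝ (fun y => (-1 : ℝ) • (b y • lieD V G y)) y := d2.fun_const_smul _
    rw [h1, lieD_add d1 d3, lieD_const_smul _ (d hG), lieD_const_smul _ d2,
      lieD_smul db (d sVG), hb]
    simp [sub_eq_add_neg]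
  have sXG := hG.lieD hΩ sX
  have sYG := hG.lieD hΩ sY
  have sXVG := sVG.lieD hΩ sX
  have sYVG := sVG.lieD hΩ sY
  -- The unknown `y` collects the derivatives of `G` and `vG` along `h` and `[v, h]`; by the
  -- commutation rules above, its derivative along `v` is `(L₁ + b L₂) y`, and `∂_s = a⁻¹ v`.
  let y : ℝ → (Plane × Plane) × (Plane × Plane) := fun s =>
    ((lieD X G (z.1, s), lieD Y G (z.1, s)),
      (lieD X (lieD V G) (z.1, s), lieD Y (lieD V G) (z.1, s)))
  let p₁ : ((Plane × Plane) × (Plane × Plane)) →L[ℝ] Plane :=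
    (ContinuousLinearMap.fst ℝ _ _).comp (ContinuousLinearMap.fst ℝ _ _)
  let p₂ : ((Plane × Plane) × (Plane × Plane)) →L[ℝ] Plane :=
    (ContinuousLinearMap.snd ℝ _ _).comp (ContinuousLinearMap.fst ℝ _ _)
  let p₃ : ((Plane × Plane) × (Plane × Plane)) →L[ℝ] Plane :=
    (ContinuousLinearMap.fst ℝ _ _).comp (ContinuousLinearMap.snd ℝ _ _)
  let p₄ : ((Plane × Plane) × (Plane × Plane)) →L[ℝ] Plane :=
    (ContinuousLinearMap.snd ℝ _ _).comp (ContinuousLinearMap.snd ℝ _ _)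
  let L₁ : ((Plane × Plane) × (Plane × Plane)) →L[ℝ]
      ((Plane × Plane) × (Plane × Plane)) := ((p₂ + p₃).prod (-ε • p₁ + p₄)).prod
    ((p₄ - ε • p₁).prod (-ε • p₃ - ε • p₂))
  let L₂ : ((Plane × Plane) × (Plane × Plane)) →L[ℝ]
      ((Plane × Plane) × (Plane × Plane)) := 
    ((0 : ((Plane × Plane) × (Plane × Plane)) →L[ℝ] Plane).prod (-p₂)).prod
      ((-p₃).prod (-p₄ - p₄))
  let A : ℝ → ((Plane × Plane) × (Plane × Plane)) →L[ℝ]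
      ((Plane × Plane) × (Plane × Plane)) := fun s => (a (z.1, s))⁻¹ • (L₁ + b (z.1, s) • L₂)
  have hline : Continuous fun s : ℝ => (z.1, s) := by fun_prop
  have hev : ∀ᶠ s in nhds z.2, (z.1, s) ∈ Ω :=
    hline.continuousAt.preimage_mem_nhds (hΩ.mem_nhds hz)
  have hA : ContinuousAt A z.2 := by
    have ca : ContinuousAt (fun s : ℝ => a (z.1, s)) z.2 :=
      ContinuousAt.comp (f := fun s : ℝ => (z.1, s)) (L.diff L.contDiffOn_a hz).continuousAt
        hline.continuousAt
    have cb : ContinuousAt (fun s : ℝ => b (z.1, s)) z.2 :=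
      ContinuousAt.comp (f := fun s : ℝ => (z.1, s)) (L.diff L.contDiffOn_b hz).continuousAt
        hline.continuousAt
    exact (ca.inv₀ (L.a_ne_zero hz)).smul (continuousAt_const.add (cb.smul continuousAt_const))
  have hder : ∀ {g : Plane × ℝ → Plane}, ContDiffOn ℝ ∞ g Ω → ∀ s, (z.1, s) ∈ Ω →
      HasDerivAt (fun s => g (z.1, s)) ((a (z.1, s))⁻¹ • lieD V g (z.1, s)) s := by
    intro g hg s hs
    have h1 : HasDerivAt (fun s : ℝ => (z.1, s)) ((0 : Plane), (1 : ℝ)) s :=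
      (hasDerivAt_const s z.1).prodMk (hasDerivAt_id s)
    have h2 := (L.diff hg hs).hasFDerivAt.comp_hasDerivAt s h1
    rw [hV, lieD_vertField, smul_smul, inv_mul_cancel₀ (L.a_ne_zero hs), one_smul]
    exact h2
  have hy : ∀ᶠ s in nhds z.2, HasDerivAt y (A s (y s)) s := by
    filter_upwards [hev] with s hs
    have h1 := ((hder sXG s hs).prodMk (hder sYG s hs)).prodMk
      ((hder sXVG s hs).prodMk (hder sYVG s hs))
    convert! h1 using 1
    rw [hcommX hG _ hs, hcommY hG _ hs, hcommX sVG _ hs, hcommY sVG _ hs,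
      hWVV X _ hs (hXb _ hs), hWVV Y _ hs (hYb _ hs)]
    simp only [A, L₁, L₂, p₁, p₂, p₃, p₄, y, smul_apply, add_apply, sub_apply, neg_apply,
      ContinuousLinearMap.prod_apply, ContinuousLinearMap.comp_apply,
      ContinuousLinearMap.coe_fst', ContinuousLinearMap.coe_snd', zero_apply,
      Prod.smul_mk, Prod.mk_add_mk]
    refine Prod.ext (Prod.ext ?_ ?_) (Prod.ext ?_ ?_) <;> simp only <;> congr 1 <;> module
  have hy0 : y z.2 = 0 := by
    have hx := h0 X (Or.inl rfl)
    have hyy := h0 Y (Or.inr rfl)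
    simp [y, hx, hyy]
  filter_upwards [eventually_eq_zero_of_hasDerivAt_linear hA hy hy0] with s hs
  simp only [y, Prod.mk_eq_zero] at hs
  rintro W (rfl | rfl)
  · exact ⟨hs.1.1, hs.2.1⟩
  · exact ⟨hs.1.2, hs.2.2⟩

end FlatInvariants

/-- A map `G` of rank one on `ℝ² × ℝ`, with `∂G/∂s ≠ 0`, is near `(x₀, s₀)` of the form
`G (x, s) = G (x₀, ψ (x, s))`. -/
theorem exists_reparametrization {Ω : Set (Plane × ℝ)} {G : Plane × ℝ → Plane} {z₀ : Plane × ℝ}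
    (hΩ : IsOpen Ω) (hG : ContDiffOn ℝ ∞ G Ω) (hz₀ : z₀ ∈ Ω)
    (hrank : ∀ z ∈ Ω, ∀ y : Plane, ∃ r : ℝ, fderiv ℝ G z (y, r) = 0)
    (hne : fderiv ℝ G z₀ (0, 1) ≠ 0) :
    ∃ (ψ : Plane × ℝ → ℝ) (O : Set (Plane × ℝ)), IsOpen O ∧ z₀ ∈ O ∧ O ⊆ Ω ∧
      ContDiffOn ℝ ∞ ψ O ∧ (∀ z ∈ O, (z₀.1, ψ z) ∈ Ω ∧ G z = G (z₀.1, ψ z)) ∧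
      ∀ s, (z₀.1, s) ∈ O → ψ (z₀.1, s) = s := by
  -- The component of `G` along `∂G/∂s` at `z₀` serves as a coordinate on the control line.
  let l : Plane →L[ℝ] ℝ := innerSL ℝ (fderiv ℝ G z₀ (0, 1))
  have sG₁ : ContDiffOn ℝ ∞ (fun z => fderiv ℝ G z (0, 1)) Ω :=
    hG.lieD hΩ (X := fun _ => (0, 1)) contDiffOn_const
  let Ω₁ : Set (Plane × ℝ) := Ω ∩ {z | l (fderiv ℝ G z (0, 1)) ≠ 0}
  have hΩ₁ : IsOpen Ω₁ :=
    (l.continuous.comp_continuousOn sG₁.continuousOn).isOpen_inter_preimage hΩ isOpen_ne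
  have hz₁ : z₀ ∈ Ω₁ := ⟨hz₀, by simpa [l] using hne⟩
  have slG : ContDiffOn ℝ ∞ (fun z => l (G z)) Ω₁ :=
    l.contDiff.comp_contDiffOn (hG.mono Set.inter_subset_left)
  have hlG : ∀ z ∈ Ω, ∀ w, fderiv ℝ (fun z => l (G z)) z w = l (fderiv ℝ G z w) := fun z hz w =>
    lieD_const_clm_apply (X := fun _ => w) l (hG.differentiableAt_of_isOpen hΩ hz)
  obtain ⟨ρ, W, O, hW, sρ, hρ, hO, hzO, hOsub, hρ'⟩ := exists_solution hΩ₁ slG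
    (fun y hy => by rw [hlG y hy.1]; exact hy.2) hz₁
  have hw₀ := (hρ' z₀ hzO).1
  obtain ⟨r, hr, hball⟩ := Metric.isOpen_iff.1 hW _ hw₀
  -- In the coordinates `(x, l (G (x, s)))` the map `G` does not depend on `x`.
  have hconst : ∀ w ∈ Metric.ball (z₀.1, l (G z₀)) r, G (w.1, ρ w) = G (z₀.1, ρ (z₀.1, w.2)) := by
    intro w hw
    rw [← ball_prod_same, Set.mem_prod] at hw
    let k : Plane → Plane × ℝ := fun x => (x, w.2)
    have hkW : ∀ x ∈ Metric.ball z₀.1 r, k x ∈ W := fun x hx =>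
      hball (by rw [← ball_prod_same]; exact ⟨hx, hw.2⟩)
    have hρd : ∀ x ∈ Metric.ball z₀.1 r, HasFDerivAt (fun x => (x, ρ (k x)))
        ((ContinuousLinearMap.id ℝ Plane).prod (fderiv ℝ (fun x => ρ (k x)) x)) x := by
      intro x hx
      have h1 : DifferentiableAt ℝ (fun x => ρ (k x)) x :=
        DifferentiableAt.comp x (sρ.differentiableAt_of_isOpen hW (hkW x hx))
          (differentiableAt_id.prodMk (differentiableAt_const _))
      exact (hasFDerivAt_id x).prodMk h1.hasFDerivAt
    have hd : ∀ x ∈ Metric.ball z₀.1 r, HasFDerivAt (fun x => G (x, ρ (k x)))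
        (0 : Plane →L[ℝ] Plane) x := by
      intro x hx
      have hmem := (hρ _ (hkW x hx)).1
      have h1 := (hG.differentiableAt_of_isOpen hΩ hmem.1).hasFDerivAt.comp x (hρd x hx)
      have h2 := (slG.differentiableAt_of_isOpen hΩ₁ hmem).hasFDerivAt.comp x (hρd x hx)
      have h3 : ((fun z => l (G z)) ∘ fun x => (x, ρ (k x))) =ᶠ[nhds x] fun _ => w.2 :=
        Filter.eventuallyEq_of_mem (Metric.isOpen_ball.mem_nhds hx) fun x' hx' =>
          (hρ _ (hkW x' hx')).2
      have h4 := h2.unique ((hasFDerivAt_const w.2 x).congr_of_eventuallyEq h3)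
      convert! h1 using 1
      ext1 y
      obtain ⟨t, ht⟩ := hrank _ hmem.1 y
      have h5 : fderiv ℝ (fun z => l (G z)) (x, ρ (k x)) (y, fderiv ℝ (fun x => ρ (k x)) x y) = 0 :=
        congrArg (fun A : Plane →L[ℝ] ℝ => A y) h4
      rw [hlG _ hmem.1] at h5
      have h6 : fderiv ℝ G (x, ρ (k x)) (y, fderiv ℝ (fun x => ρ (k x)) x y) =
          (fderiv ℝ (fun x => ρ (k x)) x y - t) • fderiv ℝ G (x, ρ (k x)) (0, 1) := by
        have h8 : ((0 : Plane), fderiv ℝ (fun x => ρ (k x)) x y - t) =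
            (y, fderiv ℝ (fun x => ρ (k x)) x y) - (y, t) := by simp
        rw [← fderiv_vert, h8, map_sub, ht, sub_zero]
      rw [h6, map_smul, smul_eq_mul, mul_eq_zero] at h5
      have h7 : fderiv ℝ G (x, ρ (k x)) (y, fderiv ℝ (fun x => ρ (k x)) x y) = 0 := by
        rw [h6, h5.resolve_right hmem.2, zero_smul]
      exact h7.symm
    have h8 := (convex_ball z₀.1 r).isPreconnected
    exact Metric.isOpen_ball.is_const_of_fderiv_eq_zero h8
      (fun x hx => (hd x hx).differentiableAt.differentiableWithinAt)
      (fun x hx => (hd x hx).fderiv) hw.1 (Metric.mem_ball_self hr)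
  let q : Plane × ℝ → Plane × ℝ := fun z => (z.1, l (G z))
  have cq : ContinuousOn q O := continuous_fst.continuousOn.prodMk
    (slG.continuousOn.mono hOsub)
  let O' : Set (Plane × ℝ) := O ∩ q ⁻¹' Metric.ball (z₀.1, l (G z₀)) r
  have hq' : ∀ z ∈ O', (z₀.1, l (G z)) ∈ Metric.ball (z₀.1, l (G z₀)) r := by
    intro z hz
    have := hz.2
    rw [Set.mem_preimage, ← ball_prod_same, Set.mem_prod] at this
    rw [← ball_prod_same]
    exact ⟨Metric.mem_ball_self hr, this.2⟩
  refine ⟨fun z => ρ (z₀.1, l (G z)), O', cq.isOpen_inter_preimage hO Metric.isOpen_ball,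
    ⟨hzO, Metric.mem_ball_self hr⟩, fun z hz => (hOsub hz.1).1, ?_, fun z hz => ?_, fun s hs => ?_⟩
  · exact sρ.comp (contDiffOn_const.prodMk (slG.mono fun z hz => hOsub hz.1))
      fun z hz => hball (hq' z hz)
  · refine ⟨(hρ _ (hball (hq' z hz))).1.1, ?_⟩
    have h1 := hconst (q z) hz.2
    have h2 := (hρ' z hz.1).2
    simp only [q] at h1
    rw [h2] at h1
    exact h1
  · exact (hρ' _ hs.1).2

end Flat

/-! ### Trivial systems in local coordinates -/

theorem fderiv_curve_comp_apply {E G : Type*} [NormedAddCommGroup E] [NormedSpace ℝ E]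
    [NormedAddCommGroup G] [NormedSpace ℝ G] {k : ℝ → G} {ψ : E → ℝ} {z : E}
    (hk : DifferentiableAt ℝ k (ψ z)) (hψ : DifferentiableAt ℝ ψ z) (w : E) :
    fderiv ℝ (fun z => k (ψ z)) z w = fderiv ℝ ψ z w • deriv k (ψ z) := by
  have h : fderiv ℝ (fun z => k (ψ z)) z = _ := (hk.hasFDerivAt.comp z hψ.hasFDerivAt).fderiv
  rw [h, ContinuousLinearMap.comp_apply, ← fderiv_apply_one_eq_deriv, ← map_smul]
  simp

namespace LocalInvariants

variable {Ω : Set (Plane × ℝ)} {ε : ℝ} {F : Plane × ℝ → Plane}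
    {η : Plane × ℝ → Plane →L[ℝ] ℝ} {a c b : Plane × ℝ → ℝ}
    (D : LocalInvariants Ω ε F η a c b) {z : Plane × ℝ}
    {g : ℝ → Plane} {I : Set ℝ} {ψ : Plane × ℝ → ℝ}

include D

section Trivial

variable (hI : IsOpen I) (hg : ContDiffOn ℝ ∞ g I) (hψ : ContDiffOn ℝ ∞ ψ Ω)
    (hψI : ∀ z ∈ Ω, ψ z ∈ I) (hF : ∀ z ∈ Ω, F z = g (ψ z))

include hI hg hψ hψI hF

theorem fderiv_of_trivial (hz : z ∈ Ω) (w : Plane × ℝ) :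
    fderiv ℝ F z w = fderiv ℝ ψ z w • deriv g (ψ z) := by
  have h1 : F =ᶠ[nhds z] fun z => g (ψ z) :=
    Filter.eventuallyEq_of_mem (D.isOpen.mem_nhds hz) hF
  rw [h1.fderiv_eq, fderiv_curve_comp_apply (hg.differentiableAt_of_isOpen hI (hψI z hz))
    (D.diff hψ hz)]

theorem deriv_ne_zero_of_trivial (hz : z ∈ Ω) : fderiv ℝ ψ z (0, 1) ≠ 0 := fun h => by
  have := D.regular z hz
  rw [D.fderiv_of_trivial hI hg hψ hψI hF hz, h, zero_smul] at this
  simp [detForm_apply] at this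

theorem η_deriv_of_trivial (hz : z ∈ Ω) : η z (deriv g (ψ z)) = 0 := by
  have h1 := D.η_deriv z hz
  rw [D.fderiv_of_trivial hI hg hψ hψI hF hz, map_smul, smul_eq_mul, mul_eq_zero] at h1
  exact h1.resolve_left (D.deriv_ne_zero_of_trivial hI hg hψ hψI hF hz)

omit D hψI hF in
theorem contDiffOn_deriv_comp (hψI : ∀ z ∈ Ω, ψ z ∈ I) :
    ContDiffOn ℝ ∞ (fun z => deriv g (ψ z)) Ω :=
  (hg.deriv_of_isOpen (m := ∞) hI (by simp)).comp hψ hψI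

/-- The covectors of a system `F = g ∘ ψ` are functions of `ψ`. -/
theorem fderiv_η_of_trivial (hz : z ∈ Ω) {w : Plane × ℝ} (hw : fderiv ℝ ψ z w = 0) :
    fderiv ℝ η z w = 0 := by
  have hreg := D.regular z hz
  rw [D.fderiv_of_trivial hI hg hψ hψI hF hz, detForm_smul_left] at hreg
  have hreg' : detForm (deriv g (ψ z)) (F z) ≠ 0 := fun h => hreg (by simp [h])
  refine clm_ext_of_detForm_ne_zero hreg' ?_ ?_
  · have h1 := D.leibniz (X := fun _ => w) D.contDiffOn_η D.contDiffOn_F D.η_F hz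
    simp only [lieD] at h1
    rw [D.fderiv_of_trivial hI hg hψ hψI hF hz, hw, zero_smul, map_zero] at h1
    rw [zero_apply]
    linarith
  · have sg := contDiffOn_deriv_comp hI hg hψ hψI
    have h1 := D.leibniz (X := fun _ => w) D.contDiffOn_η sg
      (fun y hy => D.η_deriv_of_trivial hI hg hψ hψI hF hy) hz
    simp only [lieD] at h1
    rw [fderiv_curve_comp_apply ((hg.deriv_of_isOpen (m := ∞) hI
      (by simp)).differentiableAt_of_isOpen hI (hψI z hz)) (D.diff hψ hz)] at h1
    simp [hw] at h1
    simpa using h1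

/-- The Hamiltonian field of a system `F = g ∘ ψ` is tangent to the level surfaces of `ψ`. -/
theorem ham_ψ (hz : z ∈ Ω) : lieD (hamField F c) ψ z = 0 := by
  have hψs := D.deriv_ne_zero_of_trivial hI hg hψ hψI hF hz
  have h1 : lieD (hamField F c) η z = 0 := by
    ext1 y
    rw [D.hamilton z hz, D.fderiv_of_trivial hI hg hψ hψI hF hz, map_smul,
      D.η_deriv_of_trivial hI hg hψ hψI hF hz]
    simp
  -- Both `h` and its projection to `ker dψ` along the vertical direction annihilate `η`.
  set r := lieD (hamField F c) ψ z / fderiv ℝ ψ z (0, 1) with hr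
  have h2 : fderiv ℝ η z (hamField F c z - (0, r)) = 0 := by
    refine D.fderiv_η_of_trivial hI hg hψ hψI hF hz ?_
    rw [map_sub, fderiv_vert, smul_eq_mul, hr, div_mul_cancel₀ _ hψs, sub_eq_zero]
    rfl
  rw [map_sub, fderiv_vert, show fderiv ℝ η z (hamField F c z) = 0 from h1, zero_sub,
    neg_eq_zero] at h2
  have h3 := congrArg (fun L : Plane →L[ℝ] ℝ => L (lieD (vertField a) F z)) h2
  simp [D.deriv_η_vF hz, D.a_ne_zero hz] at h3
  rw [hr, div_eq_zero_iff] at h3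
  exact h3.resolve_right hψs

theorem vψ_ne_zero (hz : z ∈ Ω) : lieD (vertField a) ψ z ≠ 0 := by
  rw [lieD_vertField]
  exact mul_ne_zero (D.a_ne_zero hz) (D.deriv_ne_zero_of_trivial hI hg hψ hψI hF hz)

/-- For a system `F = g ∘ ψ` the function `vψ` is, up to sign, a function of `ψ`. -/
theorem lieD_vψ {Z : Plane × ℝ → Plane × ℝ} (hZ : ∀ z ∈ Ω, lieD Z ψ z = 0) (hz : z ∈ Ω) :
    lieD Z (lieD (vertField a) ψ) z = 0 := by
  have sV := D.contDiffOn_vert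
  have sA : ContDiffOn ℝ ∞ (lieD (vertField a) ψ) Ω := hψ.lieD D.isOpen sV
  have sg' := contDiffOn_deriv_comp hI hg hψ hψI
  have sdg : ContDiffOn ℝ ∞ (deriv g) I := hg.deriv_of_isOpen (m := ∞) hI (by simp)
  have sg'' := contDiffOn_deriv_comp hI sdg hψ hψI
  have hder : ∀ (k : ℝ → Plane), ContDiffOn ℝ ∞ k I → ∀ y ∈ Ω, ∀ W : Plane × ℝ → Plane × ℝ,
      lieD W (fun z => k (ψ z)) y = lieD W ψ y • deriv k (ψ y) := fun k hk y hy W =>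
    fderiv_curve_comp_apply (hk.differentiableAt_of_isOpen hI (hψI y hy)) (D.diff hψ hy) _
  set A := lieD (vertField a) ψ with hA
  let m : Plane × ℝ → ℝ := fun z => η z (deriv (deriv g) (ψ z))
  have sm : ContDiffOn ℝ ∞ m Ω := D.contDiffOn_η.clm_apply sg''
  have hvF : ∀ y ∈ Ω, lieD (vertField a) F y = A y • deriv g (ψ y) := fun y hy =>
    D.fderiv_of_trivial hI hg hψ hψI hF hy _
  -- This is `η(v²F) = -1`; the factor `m` is a function of `ψ`.
  have key : ∀ y ∈ Ω, A y * A y * m y = -1 := by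
    intro y hy
    have h1 := D.η_vvF hy
    rw [lieD_congr D.isOpen hvF hy, lieD_smul (D.diff sA hy) (D.diff sg' hy),
      hder _ sdg y hy] at h1
    simp [D.η_deriv_of_trivial hI hg hψ hψI hF hy] at h1
    rw [← h1]
    simp only [m]
    ring
  have hm : lieD Z m z = 0 := by
    have h1 := lieD_clm_apply (X := Z) (D.diff D.contDiffOn_η hz) (D.diff sg'' hz)
    rw [hder _ (sdg.deriv_of_isOpen (m := ∞) hI (by simp)) z hz, hZ z hz] at h1
    rw [show lieD Z m z = _ from h1, lieD,
      D.fderiv_η_of_trivial hI hg hψ hψI hF hz (hZ z hz)]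
    simp
  have h2 := lieD_const (X := Z) D.isOpen key hz
  have dA := D.diff sA hz
  have dAA : DifferentiableAt ℝ (fun y => A y * A y) z := dA.mul dA
  rw [lieD_mul dAA (D.diff sm hz), lieD_mul dA dA, hm] at h2
  have hA0 := D.vψ_ne_zero hI hg hψ hψI hF hz
  have hm0 : m z ≠ 0 := fun h => by simpa [h] using key z hz
  have h3 : lieD Z A z * (2 * A z * m z) = 0 := by linear_combination h2
  exact (mul_eq_zero.1 h3).resolve_right (mul_ne_zero (mul_ne_zero two_ne_zero hA0) hm0)

/-- If a function is annihilated by every field tangent to the level surfaces of `ψ`, then so is its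
derivative along `v`. -/
theorem lieD_lieD_vert_eq_zero {G : Type*} [NormedAddCommGroup G] [NormedSpace ℝ G]
    {k : Plane × ℝ → G} (hk : ContDiffOn ℝ ∞ k Ω)
    (h : ∀ Z : Plane × ℝ → Plane × ℝ, ContDiffOn ℝ ∞ Z Ω → (∀ z ∈ Ω, lieD Z ψ z = 0) →
      ∀ z ∈ Ω, lieD Z k z = 0) :
    ∀ Z : Plane × ℝ → Plane × ℝ, ContDiffOn ℝ ∞ Z Ω → (∀ z ∈ Ω, lieD Z ψ z = 0) →
      ∀ z ∈ Ω, lieD Z (lieD (vertField a) k) z = 0 := by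
  intro Z sZ hZ z hz
  have sV := D.contDiffOn_vert
  have hbr : ∀ z ∈ Ω, lieD (lieBracket ℝ (vertField a) Z) ψ z = 0 := fun z hz => by
    rw [lieD_lieBracket D.isOpen hψ sV sZ hz, lieD_const D.isOpen hZ hz,
      D.lieD_vψ hI hg hψ hψI hF hZ hz, sub_zero]
  have h1 := lieD_lieBracket D.isOpen hk sV sZ hz
  rw [h _ (sV.lieBracket_vectorField_of_isOpen D.isOpen sZ) hbr z hz,
    lieD_const D.isOpen (h Z sZ hZ) hz, zero_sub, eq_comm, neg_eq_zero] at h1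
  exact h1

/-- A system `F = g ∘ ψ`, which a feedback transforms into one that does not depend on the point of
the plane, is flat: the fields `h` and `[v, h]` are tangent to the level surfaces of `ψ`, and so is
their bracket, which is vertical and therefore zero; the function `b = -(vη)(v²F)` is built from `η`
and `F` by derivation along `v`, so that it is constant in these directions. -/
theorem flat_of_trivial : FlatInvariants Ω ε F η a c b := by
  have sV := D.contDiffOn_vert
  have sX := D.contDiffOn_ham
  have sY := D.contDiffOn_bracket
  have hXψ : ∀ z ∈ Ω, lieD (hamField F c) ψ z = 0 := fun z hz => D.ham_ψ hI hg hψ hψI hF hz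
  have hYψ : ∀ z ∈ Ω, lieD (lieBracket ℝ (vertField a) (hamField F c)) ψ z = 0 := fun z hz => by
    rw [lieD_lieBracket D.isOpen hψ sV sX hz, lieD_const D.isOpen hXψ hz,
      D.lieD_vψ hI hg hψ hψI hF hXψ hz, sub_zero]
  have hη : ∀ Z : Plane × ℝ → Plane × ℝ, ContDiffOn ℝ ∞ Z Ω → (∀ z ∈ Ω, lieD Z ψ z = 0) →
      ∀ z ∈ Ω, lieD Z η z = 0 := fun Z _ hZ z hz =>
    D.fderiv_η_of_trivial hI hg hψ hψI hF hz (hZ z hz)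
  have hF' : ∀ Z : Plane × ℝ → Plane × ℝ, ContDiffOn ℝ ∞ Z Ω → (∀ z ∈ Ω, lieD Z ψ z = 0) →
      ∀ z ∈ Ω, lieD Z F z = 0 := fun Z _ hZ z hz => by
    rw [lieD, D.fderiv_of_trivial hI hg hψ hψI hF hz, show fderiv ℝ ψ z (Z z) = 0 from hZ z hz,
      zero_smul]
  have hvη := D.lieD_lieD_vert_eq_zero hI hg hψ hψI hF D.contDiffOn_η hη
  have hvvF := D.lieD_lieD_vert_eq_zero hI hg hψ hψI hF D.contDiffOn_vF
    (D.lieD_lieD_vert_eq_zero hI hg hψ hψI hF D.contDiffOn_F hF')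
  have hb : ∀ Z : Plane × ℝ → Plane × ℝ, ContDiffOn ℝ ∞ Z Ω → (∀ z ∈ Ω, lieD Z ψ z = 0) →
      ∀ z ∈ Ω, lieD Z b z = 0 := fun Z sZ hZ z hz => by
    have h1 := lieD_clm_apply (X := Z) (D.diff D.contDiffOn_vη hz) (D.diff D.contDiffOn_vvF hz)
    rw [hvη Z sZ hZ z hz, hvvF Z sZ hZ z hz, lieD_congr D.isOpen (fun y hy => D.vη_vvF hy) hz] at h1
    simpa [lieD] using h1
  refine ⟨D, fun z hz => ?_, fun z hz => hb _ sX hXψ z hz, fun z hz => hb _ sY hYψ z hz⟩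
  have h1 := lieD_lieBracket D.isOpen hψ sX sY hz
  rw [lieD_const D.isOpen hXψ hz, lieD_const D.isOpen hYψ hz, sub_zero, lieD, fderiv_split,
    D.bracket_bracket_fst hz] at h1
  have h2 : fderiv ℝ ψ z ((0 : Plane), (0 : ℝ)) = 0 := map_zero _
  rw [h2, zero_add, smul_eq_mul, mul_eq_zero] at h1
  exact Prod.ext (D.bracket_bracket_fst hz)
    (h1.resolve_right (D.deriv_ne_zero_of_trivial hI hg hψ hψI hF hz))

end Trivial

end LocalInvariants

/-! ### Vector fields and functions on a manifold in a chart -/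

section Charts

variable {E H N : Type*} [NormedAddCommGroup E] [NormedSpace ℝ E]
  [TopologicalSpace H] {I : ModelWithCorners ℝ E H} [TopologicalSpace N] [ChartedSpace H N]

variable (I) in
/-- A smooth chart of a manifold with model `I`, with values in the model vector space. -/
structure IsSmoothChart (P : OpenPartialHomeomorph N E) : Prop where
  contMDiffOn : ContMDiffOn I 𝓘(ℝ, E) ∞ P P.source
  contMDiffOn_symm : ContMDiffOn 𝓘(ℝ, E) I ∞ P.symm P.target

variable (I) in
/-- The representation of a vector field on a manifold in a chart. -/
noncomputable def coordField (P : OpenPartialHomeomorph N E) (X : (p : N) → TangentSpace I p) :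
    E → E := fun z => mfderiv I 𝓘(ℝ, E) P (P.symm z) (X (P.symm z))

namespace IsSmoothChart

variable {P : OpenPartialHomeomorph N E} (hP : IsSmoothChart I P) {z : E} {p : N}

include hP

theorem mdifferentiable : P.MDifferentiable I 𝓘(ℝ, E) :=
  ⟨hP.contMDiffOn.mdifferentiableOn (by simp), hP.contMDiffOn_symm.mdifferentiableOn (by simp)⟩

theorem contMDiffAt (hp : p ∈ P.source) : ContMDiffAt I 𝓘(ℝ, E) ∞ P p :=
  hP.contMDiffOn.contMDiffAt (P.open_source.mem_nhds hp)

theorem contMDiffAt_symm (hz : z ∈ P.target) : ContMDiffAt 𝓘(ℝ, E) I ∞ P.symm z :=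
  hP.contMDiffOn_symm.contMDiffAt (P.open_target.mem_nhds hz)

theorem mfderiv_mfderiv_symm (hz : z ∈ P.target) (y : E) :
    mfderiv I 𝓘(ℝ, E) P (P.symm z) (mfderiv 𝓘(ℝ, E) I P.symm z y) = y :=
  congrArg (fun L : E →L[ℝ] E => L y) (hP.mdifferentiable.comp_symm_deriv hz)

theorem mfderiv_symm_mfderiv (hp : p ∈ P.source) (ξ : TangentSpace I p) :
    mfderiv 𝓘(ℝ, E) I P.symm (P p) (mfderiv I 𝓘(ℝ, E) P p ξ) = ξ :=
  congrArg (fun L : TangentSpace I p →L[ℝ] TangentSpace I p => L ξ)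
    (hP.mdifferentiable.symm_comp_deriv hp)

theorem mfderiv_symm_mfderiv' (hz : z ∈ P.target) (ξ : TangentSpace I (P.symm z)) :
    mfderiv 𝓘(ℝ, E) I P.symm z (mfderiv I 𝓘(ℝ, E) P (P.symm z) ξ) = ξ := by
  have := hP.mfderiv_symm_mfderiv (P.map_target hz) ξ
  rwa [P.right_inv hz] at this

theorem isInvertible_mfderiv_symm (hz : z ∈ P.target) :
    (mfderiv 𝓘(ℝ, E) I P.symm z).IsInvertible :=
  .of_inverse (g := mfderiv I 𝓘(ℝ, E) P (P.symm z))
    (by ext ξ; exact hP.mfderiv_symm_mfderiv' hz ξ) (by ext y; exact hP.mfderiv_mfderiv_symm hz y)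

theorem isInvertible_mfderiv (hp : p ∈ P.source) : (mfderiv I 𝓘(ℝ, E) P p).IsInvertible :=
  .of_inverse (g := mfderiv 𝓘(ℝ, E) I P.symm (P p))
    (by
      ext y
      have := hP.mfderiv_mfderiv_symm (P.map_source hp) y
      rw [P.left_inv hp] at this
      exact this)
    (by ext ξ; exact hP.mfderiv_symm_mfderiv hp ξ)

variable {W : Type*} [NormedAddCommGroup W] [NormedSpace ℝ W]

/-- The derivative of a function is computed in charts. -/
theorem mfderiv_apply (k : N → W) (hz : z ∈ P.target) (ξ : TangentSpace I (P.symm z)) :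
    mfderiv I 𝓘(ℝ, W) k (P.symm z) ξ =
      fderiv ℝ (fun y => k (P.symm y)) z (mfderiv I 𝓘(ℝ, E) P (P.symm z) ξ) := by
  have hp := P.map_target hz
  have hsymm := (hP.contMDiffAt_symm hz).mdifferentiableAt (by simp)
  have hP' := (hP.contMDiffAt hp).mdifferentiableAt (by simp)
  by_cases h : MDifferentiableAt I 𝓘(ℝ, W) k (P.symm z)
  · have h1 := mfderiv_comp z h hsymm
    rw [mfderiv_eq_fderiv] at h1
    have h2 : fderiv ℝ (fun y => k (P.symm y)) z = _ := h1
    rw [h2]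
    exact congrArg _ (hP.mfderiv_symm_mfderiv' hz ξ).symm
  · have h1 : ¬ DifferentiableAt ℝ (fun y => k (P.symm y)) z := by
      intro hd
      refine h ?_
      have h2 : MDifferentiableAt 𝓘(ℝ, E) 𝓘(ℝ, W) (fun y => k (P.symm y)) (P (P.symm z)) := by
        rw [P.right_inv hz]; exact hd.mdifferentiableAt
      have h3 := h2.comp (P.symm z) hP'
      refine h3.congr_of_eventuallyEq ?_
      exact Filter.eventuallyEq_of_mem (P.open_source.mem_nhds hp) fun y hy => by
        simp [P.left_inv hy]
    rw [mfderiv_zero_of_not_mdifferentiableAt h, fderiv_zero_of_not_differentiableAt h1]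
    rfl

theorem coordField_eq_mpullback (hz : z ∈ P.target) (X : (p : N) → TangentSpace I p) :
    mpullback 𝓘(ℝ, E) I P.symm X z = coordField I P X z := by
  rw [mpullback_apply]
  exact (hP.isInvertible_mfderiv_symm hz).inverse_apply_eq.2
    (hP.mfderiv_symm_mfderiv' hz _).symm

theorem mpullback_coordField (hp : p ∈ P.source) (X : (p : N) → TangentSpace I p) :
    mpullback I 𝓘(ℝ, E) P (coordField I P X) p = X p := by
  refine (hP.isInvertible_mfderiv hp).inverse_apply_eq.2 ?_
  rw [coordField, P.left_inv hp]

theorem eventuallyEq_mpullback_coordField (hp : p ∈ P.source) (X : (p : N) → TangentSpace I p) :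
    (fun p => (⟨p, X p⟩ : TangentBundle I N)) =ᶠ[nhds p]
      fun p => ⟨p, mpullback I 𝓘(ℝ, E) P (coordField I P X) p⟩ :=
  Filter.eventuallyEq_of_mem (P.open_source.mem_nhds hp) fun y hy => by
    simp only [hP.mpullback_coordField hy X]

variable [FiniteDimensional ℝ E] [IsManifold I ∞ N]

/-- A smooth field has a smooth representation. -/
theorem contDiffAt_coordField {X : (p : N) → TangentSpace I p} (hz : z ∈ P.target)
    (hX : ContMDiffAt I I.tangent ∞ (fun p => (⟨p, X p⟩ : TangentBundle I N)) (P.symm z)) :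
    ContDiffAt ℝ ∞ (coordField I P X) z := by
  have : IsManifold I 1 N := .of_le (n := ∞) (by simp)
  have h := hX.mpullback_vectorField_preimage (hP.contMDiffAt_symm hz)
    (hP.isInvertible_mfderiv_symm hz) (by simp)
  have h2 := contMDiffWithinAt_vectorSpace_iff_contDiffWithinAt.1 (contMDiffWithinAt_univ.2 h)
  refine (contDiffWithinAt_univ.1 h2).congr_of_eventuallyEq ?_
  exact Filter.eventuallyEq_of_mem (P.open_target.mem_nhds hz) fun y hy =>
    (hP.coordField_eq_mpullback hy X).symm

/-- A field with a smooth representation is smooth. -/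
theorem contMDiffAt_of_coordField {X : (p : N) → TangentSpace I p} (hp : p ∈ P.source)
    (hX : ContDiffAt ℝ ∞ (coordField I P X) (P p)) :
    ContMDiffAt I I.tangent ∞ (fun p => (⟨p, X p⟩ : TangentBundle I N)) p := by
  have : IsManifold I 1 N := .of_le (n := ∞) (by simp)
  have h2 := (contMDiffAt_vectorSpace_iff_contDiffAt (V := coordField I P X)).2 hX
  have h := h2.mpullback_vectorField_preimage (hP.contMDiffAt hp) (hP.isInvertible_mfderiv hp)
    (by simp)
  exact h.congr_of_eventuallyEq (hP.eventuallyEq_mpullback_coordField hp X)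

/-- The Lie bracket of vector fields is computed in charts. -/
theorem coordField_mlieBracket {X Y : (p : N) → TangentSpace I p} (hz : z ∈ P.target)
    (hX : ContDiffAt ℝ ∞ (coordField I P X) z) (hY : ContDiffAt ℝ ∞ (coordField I P Y) z) :
    coordField I P (mlieBracket I X Y) z =
      lieBracket ℝ (coordField I P X) (coordField I P Y) z := by
  have : IsManifold I (minSmoothness ℝ 3) N := .of_le (n := ∞)
    (by rw [minSmoothness_of_isRCLikeNormedField]; exact ENat.LEInfty.out)
  have hp := P.map_target hz
  have hX' := (hP.contMDiffAt_of_coordField (X := X) hp (by rwa [P.right_inv hz])).mdifferentiableAt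
    (by simp)
  have hY' := (hP.contMDiffAt_of_coordField (X := Y) hp (by rwa [P.right_inv hz])).mdifferentiableAt
    (by simp)
  have h1 := mpullback_mlieBracket hX' hY' (hP.contMDiffAt_symm hz) two_le_infty
  refine (hP.coordField_eq_mpullback hz _).symm.trans (h1.trans ?_)
  rw [← mlieBracketWithin_univ, mlieBracketWithin_eq_lieBracketWithin]
  refine (congrFun lieBracketWithin_univ z).trans ?_
  exact Filter.EventuallyEq.lieBracket_vectorField_eq
    (Filter.eventuallyEq_of_mem (P.open_target.mem_nhds hz) fun y hy =>
      hP.coordField_eq_mpullback hy X)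
    (Filter.eventuallyEq_of_mem (P.open_target.mem_nhds hz) fun y hy =>
      hP.coordField_eq_mpullback hy Y)

end IsSmoothChart

end Charts

section ProductCharts

variable {M : Type*} [TopologicalSpace M] [ChartedSpace Plane M]
  {U : Type*} [TopologicalSpace U] [ChartedSpace ℝ U]
  {φ : OpenPartialHomeomorph M Plane} {χ : OpenPartialHomeomorph U ℝ}

theorem isSmoothChart_of_mem_maximalAtlas (hφ : φ ∈ IsManifold.maximalAtlas surfaceModel ∞ M) :
    IsSmoothChart surfaceModel φ :=
  ⟨contMDiffOn_of_mem_maximalAtlas hφ, contMDiffOn_symm_of_mem_maximalAtlas hφ⟩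

theorem isSmoothChart_chartAt_plane [IsManifold surfaceModel ∞ M] (q : M) :
    IsSmoothChart surfaceModel (chartAt Plane q) :=
  isSmoothChart_of_mem_maximalAtlas (IsManifold.chart_mem_maximalAtlas q)

theorem isSmoothChart_chartAt [IsManifold curveModel ∞ U] (u : U) :
    IsSmoothChart curveModel (chartAt ℝ u) :=
  ⟨contMDiffOn_of_mem_maximalAtlas (IsManifold.chart_mem_maximalAtlas u),
    contMDiffOn_symm_of_mem_maximalAtlas (IsManifold.chart_mem_maximalAtlas u)⟩

theorem IsSmoothChart.prod (hφ : IsSmoothChart surfaceModel φ) (hχ : IsSmoothChart curveModel χ) :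
    IsSmoothChart prodModel (φ.prod χ) := by
  refine ⟨?_, ?_⟩
  · exact (hφ.contMDiffOn.comp contMDiffOn_fst fun p hp => hp.1).prodMk_space
      (hχ.contMDiffOn.comp contMDiffOn_snd fun p hp => hp.2)
  · exact (hφ.contMDiffOn_symm.comp contDiff_fst.contMDiff.contMDiffOn fun p hp => hp.1).prodMk
      (hχ.contMDiffOn_symm.comp contDiff_snd.contMDiff.contMDiffOn fun p hp => hp.2)

theorem mfderiv_prodChart (hφ : IsSmoothChart surfaceModel φ) (hχ : IsSmoothChart curveModel χ)
    {p : M × U} (h1 : p.1 ∈ φ.source) (h2 : p.2 ∈ χ.source) (ξ : TangentSpace prodModel p) :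
    mfderiv prodModel 𝓘(ℝ, Plane × ℝ) (φ.prod χ) p ξ =
      (mfderiv surfaceModel 𝓘(ℝ, Plane) φ p.1 ξ.1, mfderiv curveModel 𝓘(ℝ, ℝ) χ p.2 ξ.2) := by
  have d1 := ((hφ.contMDiffAt h1).mdifferentiableAt (by simp)).hasMFDerivAt.comp p
    (hasMFDerivAt_fst (I := surfaceModel) (I' := curveModel) p)
  have d2 := ((hχ.contMDiffAt h2).mdifferentiableAt (by simp)).hasMFDerivAt.comp p
    (hasMFDerivAt_snd (I := surfaceModel) (I' := curveModel) p)
  have h3 : HasMFDerivAt prodModel 𝓘(ℝ, Plane × ℝ) (φ.prod χ) p _ :=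
    ⟨d1.1.prodMk d2.1, HasFDerivWithinAt.prodMk d1.2 d2.2⟩
  rw [h3.mfderiv]
  rfl

end ProductCharts

/-! ### The control system in local coordinates -/

section Transfer

variable {M : Type*} [TopologicalSpace M] [ChartedSpace Plane M]
  {U : Type*} [TopologicalSpace U]

/-- The curve of admissible velocities at `q`. -/
def velocity (f : (q : M) → U → TangentSpace surfaceModel q) (q : M) : U → Plane := fun w => f q w

/-- The control system `f` in the coordinates `φ` of `M` and `χ` of `U`. -/
noncomputable def coordSystem (φ : OpenPartialHomeomorph M Plane) (χ : OpenPartialHomeomorph U ℝ)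
    (f : (q : M) → U → TangentSpace surfaceModel q) : Plane × ℝ → Plane :=
  fun z => mfderiv surfaceModel 𝓘(ℝ, Plane) φ (φ.symm z.1) (f (φ.symm z.1) (χ.symm z.2))

/-- A family of covectors on `M` in the coordinates `φ` of `M` and `χ` of `U`. -/
noncomputable def coordCovector (φ : OpenPartialHomeomorph M Plane)
    (χ : OpenPartialHomeomorph U ℝ) (η : M × U → (Plane →L[ℝ] ℝ)) :
    Plane × ℝ → (Plane →L[ℝ] ℝ) :=
  fun z => (η (φ.symm z.1, χ.symm z.2)).comp
    (mfderiv 𝓘(ℝ, Plane) surfaceModel φ.symm z.1 : Plane →L[ℝ] Plane)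

variable {φ : OpenPartialHomeomorph M Plane} {χ : OpenPartialHomeomorph U ℝ}
  {f : (q : M) → U → TangentSpace surfaceModel q} {z : Plane × ℝ}

theorem velocity_eq (hφ : IsSmoothChart surfaceModel φ) {x : Plane} (hx : x ∈ φ.target)
    (s : ℝ) : velocity f (φ.symm x) (χ.symm s) =
      mfderiv 𝓘(ℝ, Plane) surfaceModel φ.symm x (coordSystem φ χ f (x, s)) :=
  (hφ.mfderiv_symm_mfderiv' hx _).symm

theorem coordCovector_coordSystem (hφ : IsSmoothChart surfaceModel φ) (hz : z.1 ∈ φ.target)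
    (η : M × U → (Plane →L[ℝ] ℝ)) : coordCovector φ χ η z (coordSystem φ χ f z) =
      η (φ.symm z.1, χ.symm z.2) (f (φ.symm z.1) (χ.symm z.2)) :=
  congrArg (η (φ.symm z.1, χ.symm z.2)) (hφ.mfderiv_symm_mfderiv' hz _)

variable [ChartedSpace ℝ U]

/-- The `U`-component of a vector field on `M × U` in the coordinates `φ` of `M` and `χ` of `U`. -/
noncomputable def coordSnd (φ : OpenPartialHomeomorph M Plane) (χ : OpenPartialHomeomorph U ℝ)
    (X : (p : M × U) → TangentSpace prodModel p) : Plane × ℝ → ℝ :=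
  fun z => (coordField prodModel (φ.prod χ) X z).2

theorem IsSmoothChart.coordField_prod (hφ : IsSmoothChart surfaceModel φ)
    (hχ : IsSmoothChart curveModel χ) (hz : z ∈ (φ.prod χ).target)
    (X : (p : M × U) → TangentSpace prodModel p) :
    coordField prodModel (φ.prod χ) X z =
      (mfderiv surfaceModel 𝓘(ℝ, Plane) φ (φ.symm z.1) (X (φ.symm z.1, χ.symm z.2)).1,
        mfderiv curveModel 𝓘(ℝ, ℝ) χ (χ.symm z.2) (X (φ.symm z.1, χ.symm z.2)).2) :=
  mfderiv_prodChart hφ hχ (φ.map_target hz.1) (χ.map_target hz.2) _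

theorem fderiv_partial_snd {W : Type*} [NormedAddCommGroup W] [NormedSpace ℝ W]
    {g : Plane × ℝ → W} (hg : DifferentiableAt ℝ g z) (τ : ℝ) :
    fderiv ℝ (fun s => g (z.1, s)) z.2 τ = fderiv ℝ g z (0, τ) := by
  have h := (hg.hasFDerivAt (x := (z.1, z.2))).comp z.2 (hasFDerivAt_prodMk_right z.1 z.2)
  have h' : HasFDerivAt (fun s => g (z.1, s)) _ z.2 := h
  rw [h'.fderiv]
  simp

theorem fderiv_partial_fst {W : Type*} [NormedAddCommGroup W] [NormedSpace ℝ W]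
    {g : Plane × ℝ → W} (hg : DifferentiableAt ℝ g z) (y : Plane) :
    fderiv ℝ (fun x => g (x, z.2)) z.1 y = fderiv ℝ g z (y, 0) := by
  have h := (hg.hasFDerivAt (x := (z.1, z.2))).comp z.1 (hasFDerivAt_prodMk_left (𝕜 := ℝ) z.1 z.2)
  have h' : HasFDerivAt (fun x => g (x, z.2)) _ z.1 := h
  rw [h'.fderiv]
  simp

section Smooth

variable [IsManifold surfaceModel ∞ M]

/-- In a chart of `M`, a smooth control system is a smooth family of curves in the plane. -/
theorem IsSmoothSystem.contMDiffOn_mfderiv (hf : IsSmoothSystem f)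
    (hφ : IsSmoothChart surfaceModel φ) :
    ContMDiffOn prodModel 𝓘(ℝ, Plane) ∞
      (fun p : M × U => mfderiv surfaceModel 𝓘(ℝ, Plane) φ p.1 (f p.1 p.2))
      (φ.source ×ˢ Set.univ) := by
  have : IsManifold surfaceModel 1 M := .of_le (n := ∞) (by simp)
  have h1 := hφ.contMDiffOn.contMDiffOn_tangentMapWithin (m := ∞) (by simp)
    φ.open_source.uniqueMDiffOn
  have h2 := h1.comp (s := φ.source ×ˢ (Set.univ : Set U)) hf.contMDiffOn (fun p hp => hp.1)
  have h3 := (contMDiff_snd_tangentBundle_modelSpace Plane 𝓘(ℝ, Plane) (n := ∞)).contMDiffOn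
    (s := Set.univ) |>.comp h2 (fun _ _ => trivial)
  refine h3.congr fun p hp => ?_
  have h4 := mfderivWithin_of_isOpen (I := surfaceModel) (I' := 𝓘(ℝ, Plane)) (f := φ)
    φ.open_source hp.1
  exact (congrArg (fun L : Plane →L[ℝ] Plane => L (f p.1 p.2)) h4).symm

theorem IsSmoothSystem.contDiffOn_coordSystem (hf : IsSmoothSystem f)
    (hφ : IsSmoothChart surfaceModel φ) (hχ : IsSmoothChart curveModel χ) :
    ContDiffOn ℝ ∞ (coordSystem φ χ f) (φ.prod χ).target := by
  have h := (hf.contMDiffOn_mfderiv hφ).comp (hφ.prod hχ).contMDiffOn_symm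
    (fun z hz => ⟨φ.map_target hz.1, trivial⟩)
  exact contMDiffOn_iff_contDiffOn.1 h

end Smooth

/-- The derivative with respect to the control is computed in charts. -/
theorem mfderiv_coordSystem (hφ : IsSmoothChart surfaceModel φ) (hχ : IsSmoothChart curveModel χ)
    (hF : DifferentiableAt ℝ (coordSystem φ χ f) z) (hz : z ∈ (φ.prod χ).target)
    (τ : TangentSpace curveModel (χ.symm z.2)) :
    mfderiv curveModel 𝓘(ℝ, Plane) (velocity f (φ.symm z.1)) (χ.symm z.2) τ =
      (mfderiv 𝓘(ℝ, Plane) surfaceModel φ.symm z.1 : Plane →L[ℝ] Plane)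
        (fderiv ℝ (coordSystem φ χ f) z (0, mfderiv curveModel 𝓘(ℝ, ℝ) χ (χ.symm z.2) τ)) := by
  rw [hχ.mfderiv_apply _ hz.2]
  have h1 : (fun s => velocity f (φ.symm z.1) (χ.symm s)) = fun s =>
      (mfderiv 𝓘(ℝ, Plane) surfaceModel φ.symm z.1 : Plane →L[ℝ] Plane)
        (coordSystem φ χ f (z.1, s)) := by
    funext s
    exact velocity_eq hφ hz.1 s
  have h2 : DifferentiableAt ℝ (fun s => coordSystem φ χ f (z.1, s)) z.2 :=
    DifferentiableAt.comp z.2 (f := fun s => (z.1, s)) hF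
      ((differentiableAt_const _).prodMk differentiableAt_id)
  rw [h1]
  have h3 : ∀ L : Plane →L[ℝ] Plane, fderiv ℝ (fun s => L (coordSystem φ χ f (z.1, s))) z.2 =
      L.comp (fderiv ℝ (fun s => coordSystem φ χ f (z.1, s)) z.2) := fun L =>
    (L.hasFDerivAt.comp z.2 h2.hasFDerivAt).fderiv
  refine (congrArg (fun L : ℝ →L[ℝ] Plane => L _) (h3 _)).trans ?_
  exact congrArg (mfderiv 𝓘(ℝ, Plane) surfaceModel φ.symm z.1 : Plane →L[ℝ] Plane)
    (fderiv_partial_snd hF _)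

theorem coordCovector_lieDerivForm (hφ : IsSmoothChart surfaceModel φ)
    (hχ : IsSmoothChart curveModel χ) {η : M × U → (Plane →L[ℝ] ℝ)}
    (hη : DifferentiableAt ℝ (coordCovector φ χ η) z) (hz : z ∈ (φ.prod χ).target)
    (v : (p : M × U) → TangentSpace prodModel p) :
    coordCovector φ χ (lieDerivForm v η) z =
      lieD (vertField (coordSnd φ χ v))
        (coordCovector φ χ η) z := by
  set L : Plane →L[ℝ] Plane := mfderiv 𝓘(ℝ, Plane) surfaceModel φ.symm z.1 with hL
  set L' : Plane →L[ℝ] Plane := mfderiv surfaceModel 𝓘(ℝ, Plane) φ (φ.symm z.1) with hL'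
  have hLL : L.comp L' = .id ℝ Plane := by
    ext1 y; exact hφ.mfderiv_symm_mfderiv' hz.1 y
  have h1 : (fun s => η (φ.symm z.1, χ.symm s)) =
      fun s => (coordCovector φ χ η (z.1, s)).comp L' := by
    funext s
    ext1 y
    exact congrArg (η (φ.symm z.1, χ.symm s)) (congrArg (fun A : Plane →L[ℝ] Plane => A y) hLL).symm
  have h2 : DifferentiableAt ℝ (fun s => coordCovector φ χ η (z.1, s)) z.2 :=
    DifferentiableAt.comp z.2 (f := fun s => (z.1, s)) hη
      ((differentiableAt_const _).prodMk differentiableAt_id)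
  have h3 : lieDerivForm v η (φ.symm z.1, χ.symm z.2) =
      (fderiv ℝ (coordCovector φ χ η) z
        (0, coordSnd φ χ v z)).comp L' := by
    refine (hχ.mfderiv_apply _ hz.2 _).trans ?_
    rw [h1, coordSnd, hφ.coordField_prod hχ hz, ← fderiv_partial_snd hη]
    have h4 := ((((ContinuousLinearMap.compL ℝ Plane Plane ℝ).flip L').hasFDerivAt).comp
      z.2 h2.hasFDerivAt).fderiv
    exact congrArg (fun L : ℝ →L[ℝ] (Plane →L[ℝ] ℝ) => L _) h4
  have hLL' : L'.comp L = .id ℝ Plane := by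
    ext1 y; exact hφ.mfderiv_mfderiv_symm hz.1 y
  rw [coordCovector, h3, ← hL, ContinuousLinearMap.comp_assoc, hLL', ContinuousLinearMap.comp_id]
  rfl

end Transfer

/-! ### The feedback invariants and their local representatives -/

section Transfer

variable {M : Type*} [TopologicalSpace M] [ChartedSpace Plane M] [IsManifold surfaceModel ∞ M]
  {U : Type*} [TopologicalSpace U] [ChartedSpace ℝ U] [IsManifold curveModel ∞ U]
  {φ : OpenPartialHomeomorph M Plane} {χ : OpenPartialHomeomorph U ℝ}
  {f : (q : M) → U → TangentSpace surfaceModel q} {z : Plane × ℝ}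

/-- The coordinate of a tangent vector of `U` in the chart `χ`. -/
noncomputable def coordRate (χ : OpenPartialHomeomorph U ℝ) (u : U)
    (τ : TangentSpace curveModel u) : ℝ := mfderiv curveModel 𝓘(ℝ, ℝ) χ u τ

omit [IsManifold surfaceModel ∞ M] in
/-- The derivative of the velocity curve in terms of the preferred coordinate of `U`. -/
theorem mfderiv_velocity (q : M) (u : U) (τ : TangentSpace curveModel u) :
    mfderiv curveModel 𝓘(ℝ, Plane) (velocity f q) u τ =
      coordRate (chartAt ℝ u) u τ • deriv (indicatrix f q u) 0 := by
  have hχ := isSmoothChart_chartAt u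
  have h := hχ.mfderiv_apply (velocity f q) (mem_chart_target ℝ u)
  rw [(chartAt ℝ u).left_inv (mem_chart_source ℝ u)] at h
  refine (h τ).trans ?_
  have h1 : indicatrix f q u =
      fun s => (fun s => velocity f q ((chartAt ℝ u).symm s)) (chartAt ℝ u u + s) := by
    funext s
    simp [indicatrix, velocity]
    rfl
  rw [h1, deriv_comp_const_add (f := fun s => velocity f q ((chartAt ℝ u).symm s)), add_zero,
    ← fderiv_apply_one_eq_deriv]
  have := map_smul (fderiv ℝ (fun s => velocity f q ((chartAt ℝ u).symm s)) (chartAt ℝ u u))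
    (coordRate (chartAt ℝ u) u τ) 1
  rw [← this, smul_eq_mul, mul_one]
  rfl

omit [IsManifold surfaceModel ∞ M] [IsManifold curveModel ∞ U] in
theorem indicatrix_zero (q : M) (u : U) : indicatrix f q u 0 = f q u := by
  simp [indicatrix]
  rfl

omit [IsManifold surfaceModel ∞ M] in
/-- The first convexity condition in arbitrary coordinates. -/
theorem IsStronglyConvex.regular (hconv : IsStronglyConvex f) (hφ : IsSmoothChart surfaceModel φ)
    (hχ : IsSmoothChart curveModel χ) (hF : DifferentiableAt ℝ (coordSystem φ χ f) z)
    (hz : z ∈ (φ.prod χ).target) :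
    detForm (fderiv ℝ (coordSystem φ χ f) z (0, 1)) (coordSystem φ χ f z) ≠ 0 := by
  rw [← linearIndependent_pair_iff_detForm]
  obtain ⟨L, hL⟩ : ∃ L : Plane →L[ℝ] Plane, L = mfderiv 𝓘(ℝ, Plane) surfaceModel φ.symm z.1 :=
    ⟨_, rfl⟩
  obtain ⟨u, hu⟩ : ∃ u, u = χ.symm z.2 := ⟨_, rfl⟩
  obtain ⟨τ, hτ⟩ : ∃ τ : TangentSpace curveModel u,
      τ = mfderiv 𝓘(ℝ, ℝ) curveModel χ.symm z.2 1 := ⟨_, rfl⟩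
  have h1 : L (coordSystem φ χ f z) = indicatrix f (φ.symm z.1) u 0 := by
    rw [indicatrix_zero, hL, hu]
    exact (velocity_eq hφ hz.1 z.2).symm
  have h2 : L (fderiv ℝ (coordSystem φ χ f) z (0, 1)) =
      coordRate (chartAt ℝ u) u τ •
        deriv (indicatrix f (φ.symm z.1) u) 0 := by
    rw [← mfderiv_velocity]
    subst hu hL hτ
    refine .symm ((mfderiv_coordSystem hφ hχ hF hz _).trans ?_)
    exact congrArg (fun t : ℝ => (mfderiv 𝓘(ℝ, Plane) surfaceModel φ.symm z.1 : Plane →L[ℝ] Plane)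
      (fderiv ℝ (coordSystem φ χ f) z (0, t))) (hχ.mfderiv_mfderiv_symm hz.2 1)
  have hk : coordRate (chartAt ℝ u) u τ ≠ 0 := by
    intro h0
    have h3 := (isSmoothChart_chartAt u).mfderiv_symm_mfderiv (mem_chart_source ℝ u) τ
    have h4 : τ = 0 := by
      rw [← h3]
      exact (congrArg (mfderiv 𝓘(ℝ, ℝ) curveModel (chartAt ℝ u).symm (chartAt ℝ u u)) h0).trans
        (map_zero _)
    have h5 := hχ.mfderiv_mfderiv_symm hz.2 1
    subst hu
    refine zero_ne_one (α := ℝ) ((map_zero _).symm.trans ((congrArg (mfderiv curveModel 𝓘(ℝ, ℝ) χ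
      (χ.symm z.2)) (h4.symm.trans hτ)).trans h5))
  have h3 : LinearIndependent ℝ (L ∘ ![coordSystem φ χ f z,
      fderiv ℝ (coordSystem φ χ f) z (0, 1)]) := by
    have h4 : L ∘ ![coordSystem φ χ f z, fderiv ℝ (coordSystem φ χ f) z (0, 1)] =
        ![L (coordSystem φ χ f z), L (fderiv ℝ (coordSystem φ χ f) z (0, 1))] := by
      funext i; fin_cases i <;> rfl
    rw [h4, h1, h2, linearIndependent_pair_iff_detForm, detForm_smul_left]
    exact mul_ne_zero hk ((linearIndependent_pair_iff_detForm _ _).1 (hconv _ u).1)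
  exact LinearIndependent.of_comp L.toLinearMap h3

/-- The laws of `FeedbackInvariants`, except the one that defines the control curvature. -/
structure Invariants (f : (q : M) → U → TangentSpace surfaceModel q) (ε : ℝ)
    (cov : M × U → (Plane →L[ℝ] ℝ)) (ham v : (p : M × U) → TangentSpace prodModel p)
    (b : M × U → ℝ) : Prop where
  ε_eq : ε = 1 ∨ ε = -1
  cov_apply : ∀ p : M × U, cov p (f p.1 p.2) = ε
  cov_max : ∀ p : M × U, IsLocalMax (fun w : U => cov p (f p.1 w)) p.2
  ham_fst : ∀ p : M × U, (ham p).1 = f p.1 p.2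
  ham_adjoint : ∀ (p : M × U) (Y : (q : M) → TangentSpace surfaceModel q),
    ContMDiffAt surfaceModel surfaceModel.tangent ∞
      (fun q => (⟨q, Y q⟩ : TangentBundle surfaceModel M)) p.1 →
    lieDerivFun ham (fun p' => cov p' (Y p'.1)) p =
      cov p (mlieBracket surfaceModel (fun q => f q p.2) Y p.1)
  v_smooth : ContMDiff prodModel prodModel.tangent ∞
    (fun p : M × U => (⟨p, v p⟩ : TangentBundle prodModel (M × U)))
  v_vertical : ∀ p : M × U, (v p).1 = 0
  v_natural : ∀ p : M × U,
    lieDerivForm v (lieDerivForm v cov) p = -ε • cov p + b p • lieDerivForm v cov p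

theorem FeedbackInvariants.invariants (D : FeedbackInvariants f) :
    Invariants f D.ε D.cov D.ham D.v D.b :=
  ⟨D.ε_eq, D.cov_apply, D.cov_max, D.ham_fst, D.ham_adjoint, D.v_smooth, D.v_vertical,
    D.v_natural⟩

omit [IsManifold surfaceModel ∞ M] [IsManifold curveModel ∞ U] in
/-- A covector that is maximal at a control annihilates the derivative of the velocity. -/
theorem coordCovector_deriv {cov : M × U → (Plane →L[ℝ] ℝ)}
    (hφ : IsSmoothChart surfaceModel φ) (hχ : IsSmoothChart curveModel χ)
    (hF : DifferentiableAt ℝ (coordSystem φ χ f) z) (hz : z ∈ (φ.prod χ).target)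
    (hmax : IsLocalMax (fun w : U => cov (φ.symm z.1, χ.symm z.2) (f (φ.symm z.1) w))
      (χ.symm z.2)) :
    coordCovector φ χ cov z (fderiv ℝ (coordSystem φ χ f) z (0, 1)) = 0 := by
  have h1 : IsLocalMax (fun s => coordCovector φ χ cov z (coordSystem φ χ f (z.1, s))) z.2 := by
    have h2 := hmax.comp_continuous ((hχ.contMDiffAt_symm hz.2).continuousAt)
    refine h2.congr (Filter.Eventually.of_forall fun s => ?_)
    exact congrArg (cov (φ.symm z.1, χ.symm z.2)) (velocity_eq hφ hz.1 s)
  have h2 : DifferentiableAt ℝ (fun s => coordSystem φ χ f (z.1, s)) z.2 :=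
    DifferentiableAt.comp z.2 (f := fun s => (z.1, s)) hF
      ((differentiableAt_const _).prodMk differentiableAt_id)
  have h3 := ((coordCovector φ χ cov z).hasFDerivAt.comp z.2 h2.hasFDerivAt).fderiv
  have h4 := h1.fderiv_eq_zero
  rw [← fderiv_partial_snd hF]
  have h5 := congrArg (fun L : ℝ →L[ℝ] ℝ => L 1) (h3.symm.trans h4)
  exact h5

/-- The field on `M` that is constant in the coordinates `φ`. -/
noncomputable def constField (φ : OpenPartialHomeomorph M Plane) (y : Plane) (q : M) :
    TangentSpace surfaceModel q :=
  mfderiv surfaceModel 𝓘(ℝ, Plane) φ.symm (φ q) y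

omit [IsManifold surfaceModel ∞ M] in
theorem coordField_constField (hφ : IsSmoothChart surfaceModel φ) {x : Plane} (hx : x ∈ φ.target)
    (y : Plane) : coordField surfaceModel φ (constField φ y) x = y := by
  have h := hφ.mfderiv_mfderiv_symm hx y
  rw [← φ.right_inv hx] at h ⊢
  rw [φ.left_inv (φ.map_target hx)] at h
  rw [coordField, φ.left_inv (φ.map_target hx)]
  exact h

theorem contMDiffAt_constField (hφ : IsSmoothChart surfaceModel φ) {q : M} (hq : q ∈ φ.source)
    (y : Plane) : ContMDiffAt surfaceModel surfaceModel.tangent ∞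
      (fun q => (⟨q, constField φ y q⟩ : TangentBundle surfaceModel M)) q :=
  hφ.contMDiffAt_of_coordField hq <| contDiffAt_const.congr_of_eventuallyEq <|
    Filter.eventuallyEq_of_mem (φ.open_target.mem_nhds (φ.map_source hq)) fun _ hx =>
      coordField_constField hφ hx y

namespace Invariants

variable {ε : ℝ} {cov : M × U → (Plane →L[ℝ] ℝ)} {ham v : (p : M × U) → TangentSpace prodModel p}
  {b : M × U → ℝ} (D : Invariants f ε cov ham v b)

include D

theorem coordField_ham (hφ : IsSmoothChart surfaceModel φ) (hχ : IsSmoothChart curveModel χ)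
    (hz : z ∈ (φ.prod χ).target) : coordField prodModel (φ.prod χ) ham z =
      hamField (coordSystem φ χ f) (coordSnd φ χ ham) z := by
  refine Prod.ext ?_ rfl
  rw [hφ.coordField_prod hχ hz]
  exact congrArg (mfderiv surfaceModel 𝓘(ℝ, Plane) φ (φ.symm z.1))
    (D.ham_fst (φ.symm z.1, χ.symm z.2))

theorem coordField_v (hφ : IsSmoothChart surfaceModel φ) (hχ : IsSmoothChart curveModel χ)
    (hz : z ∈ (φ.prod χ).target) : coordField prodModel (φ.prod χ) v z =
      vertField (coordSnd φ χ v) z := by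
  refine Prod.ext ?_ rfl
  rw [hφ.coordField_prod hχ hz]
  exact (congrArg (mfderiv surfaceModel 𝓘(ℝ, Plane) φ (φ.symm z.1))
    (D.v_vertical (φ.symm z.1, χ.symm z.2))).trans (map_zero _)

/-- In charts of `M` and `U` the feedback invariants satisfy the local laws. Hamilton's equations
are tested on the fields with constant coordinates. -/
theorem local_invariants (hf : IsSmoothSystem f) (hconv : IsStronglyConvex f)
    (hφ : IsSmoothChart surfaceModel φ) (hχ : IsSmoothChart curveModel χ) :
    LocalInvariants (φ.prod χ).target ε (coordSystem φ χ f) (coordCovector φ χ cov)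
      (coordSnd φ χ v)
      (coordSnd φ χ ham)
      (fun z => b ((φ.prod χ).symm z)) := by
  have hΩ := (φ.prod χ).open_target
  have hP := hφ.prod hχ
  have hF := hf.contDiffOn_coordSystem hφ hχ
  have hFd : ∀ z ∈ (φ.prod χ).target, DifferentiableAt ℝ (coordSystem φ χ f) z := fun z hz =>
    hF.differentiableAt_of_isOpen hΩ hz
  have hreg : ∀ z ∈ (φ.prod χ).target,
      detForm (fderiv ℝ (coordSystem φ χ f) z (0, 1)) (coordSystem φ χ f z) ≠ 0 := fun z hz =>
    hconv.regular hφ hχ (hFd z hz) hz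
  have hηF : ∀ z ∈ (φ.prod χ).target, coordCovector φ χ cov z (coordSystem φ χ f z) = ε :=
    fun z hz => (coordCovector_coordSystem hφ hz.1 cov).trans (D.cov_apply _)
  have hηd : ∀ z ∈ (φ.prod χ).target,
      coordCovector φ χ cov z (fderiv ℝ (coordSystem φ χ f) z (0, 1)) = 0 := fun z hz =>
    coordCovector_deriv hφ hχ (hFd z hz) hz (D.cov_max _)
  have hη := contDiffOn_covector hΩ hF hreg hηF hηd
  have ha : ContDiffOn ℝ ∞ (coordSnd φ χ v)
      (φ.prod χ).target := fun z hz =>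
    (hP.contDiffAt_coordField hz (D.v_smooth _)).snd.contDiffWithinAt
  have hηa := hη.lieD hΩ (contDiffOn_const (c := (0 : Plane)).prodMk ha)
  refine ⟨hΩ, hF, ha, hreg, by rcases D.ε_eq with h | h <;> simp [h], hηF, hηd, ?_, ?_⟩
  · intro z hz
    have h1 := coordCovector_lieDerivForm hφ hχ (hη.differentiableAt_of_isOpen hΩ hz) hz v
    have h2 : ContDiffOn ℝ ∞ (coordCovector φ χ (lieDerivForm v cov)) (φ.prod χ).target :=
      hηa.congr fun y hy => coordCovector_lieDerivForm hφ hχ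
        (hη.differentiableAt_of_isOpen hΩ hy) hy v
    have h3 := coordCovector_lieDerivForm hφ hχ (h2.differentiableAt_of_isOpen hΩ hz) hz v
    rw [lieD_congr hΩ (g' := lieD (vertField (coordSnd φ χ v))
        (coordCovector φ χ cov)) (fun y hy => coordCovector_lieDerivForm hφ hχ
        (hη.differentiableAt_of_isOpen hΩ hy) hy v) hz] at h3
    rw [← h3, ← h1]
    ext1 y
    have h4 := congrArg (fun A : Plane →L[ℝ] ℝ => A
      ((mfderiv 𝓘(ℝ, Plane) surfaceModel φ.symm z.1 : Plane →L[ℝ] Plane) y))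
      (D.v_natural (φ.symm z.1, χ.symm z.2))
    exact h4
  · intro z hz y
    have h1 := D.ham_adjoint (φ.symm z.1, χ.symm z.2) (constField φ y)
      (contMDiffAt_constField hφ (φ.map_target hz.1) y)
    have h2 := hP.mfderiv_apply (fun p' => cov p' (constField φ y p'.1)) hz
      (ham (φ.symm z.1, χ.symm z.2))
    have h3 : (fun z' => cov ((φ.prod χ).symm z') (constField φ y ((φ.prod χ).symm z').1))
        =ᶠ[nhds z] fun z' => coordCovector φ χ cov z' y := by
      refine Filter.eventuallyEq_of_mem (hΩ.mem_nhds hz) fun x hx => ?_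
      change cov (φ.symm x.1, χ.symm x.2)
        ((mfderiv 𝓘(ℝ, Plane) surfaceModel φ.symm (φ (φ.symm x.1)) : Plane →L[ℝ] Plane) y) = _
      rw [φ.right_inv hx.1]
      rfl
    rw [h3.fderiv_eq] at h2
    have h4 : coordField surfaceModel φ (mlieBracket surfaceModel (fun q => f q (χ.symm z.2))
        (constField φ y)) z.1 = -fderiv ℝ (coordSystem φ χ f) z (y, 0) := by
      have h5 : ContDiffAt ℝ ∞ (coordField surfaceModel φ fun q => f q (χ.symm z.2)) z.1 :=
        ContDiffAt.comp z.1 (f := fun x => (x, z.2)) (hF.contDiffAt (hΩ.mem_nhds hz))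
          (contDiffAt_id.prodMk contDiffAt_const)
      have h6 : coordField surfaceModel φ (constField φ y) =ᶠ[nhds z.1] fun _ => y :=
        Filter.eventuallyEq_of_mem (φ.open_target.mem_nhds hz.1) fun _ hx =>
          coordField_constField hφ hx y
      rw [hφ.coordField_mlieBracket hz.1 h5 (contDiffAt_const.congr_of_eventuallyEq h6),
        lieBracket, h6.fderiv_eq, h6.eq_of_nhds, ← fderiv_partial_fst (hFd z hz)]
      simp
      rfl
    rw [← map_neg, ← h4, ← lieD_clm_apply_const (hη.differentiableAt_of_isOpen hΩ hz), lieD,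
      ← D.coordField_ham hφ hχ hz]
    refine h2.symm.trans (h1.trans ?_)
    exact congrArg (cov (φ.symm z.1, χ.symm z.2)) (hφ.mfderiv_symm_mfderiv' hz.1 _).symm

end Invariants
end Transfer

/-! ### The curvature conditions in local coordinates -/

section Transfer

variable {M : Type*} [TopologicalSpace M] [ChartedSpace Plane M] [IsManifold surfaceModel ∞ M]
  {U : Type*} [TopologicalSpace U] [ChartedSpace ℝ U] [IsManifold curveModel ∞ U]
  {φ : OpenPartialHomeomorph M Plane} {χ : OpenPartialHomeomorph U ℝ}
  {f : (q : M) → U → TangentSpace surfaceModel q} {z : Plane × ℝ}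

theorem LocalInvariants.mono {Ω Ω' : Set (Plane × ℝ)} {ε : ℝ} {F : Plane × ℝ → Plane}
    {η : Plane × ℝ → Plane →L[ℝ] ℝ} {a c b : Plane × ℝ → ℝ}
    (D : LocalInvariants Ω ε F η a c b) (hΩ' : IsOpen Ω') (h : Ω' ⊆ Ω) :
    LocalInvariants Ω' ε F η a c b :=
  ⟨hΩ', D.contDiffOn_F.mono h, D.contDiffOn_a.mono h, fun z hz => D.regular z (h hz),
    D.ε_mul_self, fun z hz => D.η_F z (h hz), fun z hz => D.η_deriv z (h hz),
    fun z hz => D.natural z (h hz), fun z hz => D.hamilton z (h hz)⟩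

omit [IsManifold surfaceModel ∞ M] [IsManifold curveModel ∞ U] in
theorem lieDerivFun_eq_lieD (hP : IsSmoothChart prodModel (φ.prod χ))
    (hz : z ∈ (φ.prod χ).target) (X : (p : M × U) → TangentSpace prodModel p) (b : M × U → ℝ) :
    lieDerivFun X b ((φ.prod χ).symm z) =
      lieD (coordField prodModel (φ.prod χ) X) (fun z => b ((φ.prod χ).symm z)) z :=
  hP.mfderiv_apply b hz _

namespace Invariants

variable {ε : ℝ} {cov : M × U → (Plane →L[ℝ] ℝ)} {ham v : (p : M × U) → TangentSpace prodModel p}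
  {b : M × U → ℝ} (D : Invariants f ε cov ham v b)
  (hf : IsSmoothSystem f) (hconv : IsStronglyConvex f)
  (hφ : IsSmoothChart surfaceModel φ) (hχ : IsSmoothChart curveModel χ)

include D hf hconv hφ hχ

theorem coordField_bracket (hz : z ∈ (φ.prod χ).target) :
    coordField prodModel (φ.prod χ) (mlieBracket prodModel v ham) z =
      lieBracket ℝ (vertField (coordSnd φ χ v))
        (hamField (coordSystem φ χ f) (coordSnd φ χ ham)) z := by
  have L := D.local_invariants hf hconv hφ hχ
  have hn := L.isOpen.mem_nhds hz
  have h1 : coordField prodModel (φ.prod χ) v =ᶠ[nhds z] (vertField (coordSnd φ χ v)) :=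
    Filter.eventuallyEq_of_mem hn fun y hy => D.coordField_v hφ hχ hy
  have h2 : coordField prodModel (φ.prod χ) ham =ᶠ[nhds z]
      hamField (coordSystem φ χ f) (coordSnd φ χ ham) :=
    Filter.eventuallyEq_of_mem hn fun y hy => D.coordField_ham hφ hχ hy
  rw [(hφ.prod hχ).coordField_mlieBracket hz
    ((L.contDiffOn_vert.contDiffAt hn).congr_of_eventuallyEq h1)
    ((L.contDiffOn_ham.contDiffAt hn).congr_of_eventuallyEq h2)]
  exact h1.lieBracket_vectorField_eq h2

theorem coordField_bracket_bracket (hz : z ∈ (φ.prod χ).target) :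
    coordField prodModel (φ.prod χ) (mlieBracket prodModel ham (mlieBracket prodModel v ham)) z =
      lieBracket ℝ (hamField (coordSystem φ χ f) (coordSnd φ χ ham))
        (lieBracket ℝ (vertField (coordSnd φ χ v))
          (hamField (coordSystem φ χ f) (coordSnd φ χ ham))) z := by
  have L := D.local_invariants hf hconv hφ hχ
  have hn := L.isOpen.mem_nhds hz
  have h1 : coordField prodModel (φ.prod χ) (mlieBracket prodModel v ham) =ᶠ[nhds z]
      lieBracket ℝ (vertField (coordSnd φ χ v)) (hamField (coordSystem φ χ f) (coordSnd φ χ ham)) :=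
    Filter.eventuallyEq_of_mem hn fun y hy => D.coordField_bracket hf hconv hφ hχ hy
  have h2 : coordField prodModel (φ.prod χ) ham =ᶠ[nhds z]
      hamField (coordSystem φ χ f) (coordSnd φ χ ham) :=
    Filter.eventuallyEq_of_mem hn fun y hy => D.coordField_ham hφ hχ hy
  rw [(hφ.prod hχ).coordField_mlieBracket hz
    ((L.contDiffOn_ham.contDiffAt hn).congr_of_eventuallyEq h2)
    ((L.contDiffOn_bracket.contDiffAt hn).congr_of_eventuallyEq h1)]
  exact h2.lieBracket_vectorField_eq h1

end Invariants

namespace FeedbackInvariants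

variable (D : FeedbackInvariants f)

/-- The conditions of trivializability at a point of `M × U`. -/
def IsFlatAt (p : M × U) : Prop :=
  D.κ p = 0 ∧ lieDerivFun D.ham D.b p = 0 ∧
    lieDerivFun (mlieBracket prodModel D.v D.ham) D.b p = 0

variable (hf : IsSmoothSystem f) (hconv : IsStronglyConvex f)
  (hφ : IsSmoothChart surfaceModel φ) (hχ : IsSmoothChart curveModel χ)

include hf hconv hφ hχ

theorem isFlatAt_iff (hz : z ∈ (φ.prod χ).target) :
    D.IsFlatAt ((φ.prod χ).symm z) ↔
      lieBracket ℝ (hamField (coordSystem φ χ f) (coordSnd φ χ D.ham))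
        (lieBracket ℝ (vertField (coordSnd φ χ D.v))
          (hamField (coordSystem φ χ f) (coordSnd φ χ D.ham))) z = 0 ∧
      lieD (hamField (coordSystem φ χ f) (coordSnd φ χ D.ham))
        (fun z => D.b ((φ.prod χ).symm z)) z = 0 ∧
      lieD (lieBracket ℝ (vertField (coordSnd φ χ D.v))
          (hamField (coordSystem φ χ f) (coordSnd φ χ D.ham)))
        (fun z => D.b ((φ.prod χ).symm z)) z = 0 := by
  have hP := hφ.prod hχ
  have L := D.invariants.local_invariants hf hconv hφ hχ
  rw [IsFlatAt, lieDerivFun_eq_lieD hP hz, lieDerivFun_eq_lieD hP hz, lieD, lieD, lieD, lieD,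
    D.invariants.coordField_ham hφ hχ hz, D.invariants.coordField_bracket hf hconv hφ hχ hz]
  have h1 : coordField prodModel (φ.prod χ)
      (mlieBracket prodModel D.ham (mlieBracket prodModel D.v D.ham)) z =
      D.κ ((φ.prod χ).symm z) • coordField prodModel (φ.prod χ) D.v z := by
    have h2 := congrArg (mfderiv prodModel 𝓘(ℝ, Plane × ℝ) (φ.prod χ) ((φ.prod χ).symm z))
      (D.curvature ((φ.prod χ).symm z))
    rw [map_smul] at h2
    exact h2
  have h3 : coordField prodModel (φ.prod χ) D.v z ≠ 0 := fun h =>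
    L.a_ne_zero hz (congrArg Prod.snd h)
  rw [← D.invariants.coordField_bracket_bracket hf hconv hφ hχ hz, h1, smul_eq_zero,
    or_iff_left h3]

theorem flatInvariants (h : ∀ p, D.IsFlatAt p) :
    FlatInvariants (φ.prod χ).target D.ε (coordSystem φ χ f) (coordCovector φ χ D.cov)
      (coordSnd φ χ D.v)
      (coordSnd φ χ D.ham)
      (fun z => D.b ((φ.prod χ).symm z)) :=
  ⟨D.invariants.local_invariants hf hconv hφ hχ,
    fun _ hz => ((D.isFlatAt_iff hf hconv hφ hχ hz).1 (h _)).1,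
    fun _ hz => ((D.isFlatAt_iff hf hconv hφ hχ hz).1 (h _)).2.1,
    fun _ hz => ((D.isFlatAt_iff hf hconv hφ hχ hz).1 (h _)).2.2⟩

theorem isFlatAt_of_flatInvariants {Ω : Set (Plane × ℝ)} (hΩ : Ω ⊆ (φ.prod χ).target)
    (hD : FlatInvariants Ω D.ε (coordSystem φ χ f) (coordCovector φ χ D.cov)
      (coordSnd φ χ D.v)
      (coordSnd φ χ D.ham)
      (fun z => D.b ((φ.prod χ).symm z))) (hz : z ∈ Ω) : D.IsFlatAt ((φ.prod χ).symm z) :=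
  (D.isFlatAt_iff hf hconv hφ hχ (hΩ hz)).2
    ⟨hD.bracket_eq_zero z hz, hD.ham_b z hz, hD.bracket_b z hz⟩

end FeedbackInvariants

end Transfer

/-! ### Trivializable systems are flat -/

section Necessity

variable {M : Type*} [TopologicalSpace M] [ChartedSpace Plane M] [IsManifold surfaceModel ∞ M]
  {U : Type*} [TopologicalSpace U] [ChartedSpace ℝ U] [IsManifold curveModel ∞ U]
  {f : (q : M) → U → TangentSpace surfaceModel q}

omit [IsManifold curveModel ∞ U] in
/-- A map of curves with nonzero derivative has nonzero derivative in coordinates. -/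
theorem fderiv_coord_ne_zero {χ χ' : OpenPartialHomeomorph U ℝ} (hχ : IsSmoothChart curveModel χ)
    (hχ' : IsSmoothChart curveModel χ') {k : U → U} {u : U} (hu : u ∈ χ.source)
    (hk : k u ∈ χ'.source) (h : mfderiv curveModel curveModel k u ≠ 0) :
    fderiv ℝ (fun s => χ' (k (χ.symm s))) (χ u) 1 ≠ 0 := by
  intro h0
  refine h ?_
  have hd : MDifferentiableAt curveModel curveModel k u := by
    by_contra hd
    exact h (mfderiv_zero_of_not_mdifferentiableAt hd)
  have h1 := mfderiv_comp u ((hχ'.contMDiffAt hk).mdifferentiableAt (by simp)) hd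
  have h2 : fderiv ℝ (fun s => χ' (k (χ.symm s))) (χ u) = 0 := by
    ext
    exact h0
  refine ContinuousLinearMap.ext fun ξ => ?_
  have h3 := hχ.mfderiv_apply (fun w => χ' (k w)) (χ.map_source hu)
  rw [χ.left_inv hu] at h3
  have h4 := h3 ξ
  rw [h2] at h4
  have h5 : mfderiv curveModel 𝓘(ℝ, ℝ) χ' (k u) (mfderiv curveModel curveModel k u ξ) = 0 :=
    (congrArg (fun L : TangentSpace curveModel u →L[ℝ] ℝ => L ξ) h1).symm.trans h4
  rw [← hχ'.mfderiv_symm_mfderiv hk (mfderiv curveModel curveModel k u ξ), h5]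
  exact map_zero _

/-- A trivializable system is flat. The inclusion `K ⊆ V` is used for one-point sets `K` only. -/
theorem FeedbackInvariants.isFlatAt_of_isTrivializable (D : FeedbackInvariants f)
    (hf : IsSmoothSystem f) (hconv : IsStronglyConvex f) (h : IsTrivializable f) (p : M × U) :
    D.IsFlatAt p := by
  obtain ⟨q₀, u₀⟩ := p
  obtain ⟨φ, hφ, hq₀, V, hV, hu₀, ψ, g, hψ, hψ', hg, hfg⟩ := h q₀ {u₀} isCompact_singleton
  replace hφ := isSmoothChart_of_mem_maximalAtlas hφ
  replace hu₀ : u₀ ∈ V := hu₀ rfl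
  set χ := chartAt ℝ u₀ with hχdef
  have hχ : IsSmoothChart curveModel χ := isSmoothChart_chartAt u₀
  set χ' := chartAt ℝ (ψ q₀ u₀) with hχ'def
  have hχ' : IsSmoothChart curveModel χ' := isSmoothChart_chartAt (ψ q₀ u₀)
  have hP := hφ.prod hχ
  have hu₀χ : u₀ ∈ χ.source := mem_chart_source ℝ u₀
  have hwχ' : ψ q₀ u₀ ∈ χ'.source := mem_chart_source ℝ (ψ q₀ u₀)
  set Ψ : M × U → U := fun p => ψ p.1 p.2 with hΨ
  -- The part of the domain on which the feedback stays in the chart `χ'`.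
  obtain ⟨S, hSo, hS⟩ := (continuousOn_iff'.1 hψ.continuousOn) χ'.source χ'.open_source
  have hSV : IsOpen (S ∩ φ.source ×ˢ V) := hSo.inter (φ.open_source.prod hV)
  have hSmem : ∀ p ∈ S ∩ φ.source ×ˢ V, Ψ p ∈ χ'.source ∧ p ∈ φ.source ×ˢ V := fun p hp =>
    ⟨(hS.symm.subset hp).1, hp.2⟩
  set Ω₁ : Set (Plane × ℝ) := (φ.prod χ).target ∩ (φ.prod χ).symm ⁻¹' (S ∩ φ.source ×ˢ V) with hΩ₁
  have hΩ₁o : IsOpen Ω₁ := (φ.prod χ).isOpen_inter_preimage_symm hSV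
  set ψ' : Plane × ℝ → ℝ := fun z => χ' (Ψ ((φ.prod χ).symm z)) with hψ'def
  have sψ' : ContDiffOn ℝ ∞ ψ' Ω₁ := by
    have h1 : ContMDiffOn 𝓘(ℝ, Plane × ℝ) curveModel ∞ (fun z => Ψ ((φ.prod χ).symm z)) Ω₁ :=
      hψ.comp (hP.contMDiffOn_symm.mono fun z hz => hz.1) fun z hz => (hSmem _ hz.2).2
    exact contMDiffOn_iff_contDiffOn.1 (hχ'.contMDiffOn.comp h1 fun z hz => (hSmem _ hz.2).1)
  set z₀ : Plane × ℝ := φ.prod χ (q₀, u₀) with hz₀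
  have hz₀P : (φ.prod χ).symm z₀ = (q₀, u₀) := (φ.prod χ).left_inv ⟨hq₀, hu₀χ⟩
  have hz₀Ω₁ : z₀ ∈ Ω₁ := by
    refine ⟨(φ.prod χ).map_source ⟨hq₀, hu₀χ⟩, ?_⟩
    rw [Set.mem_preimage, hz₀P]
    exact ⟨(hS.subset ⟨hwχ', hq₀, hu₀⟩).1, hq₀, hu₀⟩
  -- The values of the feedback cover a neighbourhood of `ψ q₀ u₀`.
  have hcover : {t | t ∈ χ'.target ∧ χ'.symm t ∈ Ψ '' (φ.source ×ˢ V)} ∈ nhds (ψ' z₀) := by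
    have h1 : ContDiffAt ℝ ∞ (fun s => ψ' (z₀.1, s)) z₀.2 :=
      ContDiffAt.comp z₀.2 (f := fun s => (z₀.1, s)) (sψ'.contDiffAt (hΩ₁o.mem_nhds hz₀Ω₁))
        (contDiffAt_const.prodMk contDiffAt_id)
    have h2 : (fun s => ψ' (z₀.1, s)) = fun s => χ' (ψ q₀ (χ.symm s)) := by
      funext s
      have : φ.symm z₀.1 = q₀ := congrArg Prod.fst hz₀P
      change χ' (ψ (φ.symm z₀.1) (χ.symm s)) = _
      rw [this]
    have h3 := fderiv_coord_ne_zero hχ hχ' hu₀χ hwχ' ((hψ' q₀ hq₀).2 u₀ hu₀)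
    rw [← h2] at h3
    have h4 := ((h1.hasStrictDerivAt (by simp)).map_nhds_eq h3)
    have h5 : {s | (z₀.1, s) ∈ Ω₁} ∈ nhds z₀.2 :=
      (continuous_const.prodMk continuous_id).continuousAt.preimage_mem_nhds
        (hΩ₁o.mem_nhds (show (z₀.1, z₀.2) ∈ Ω₁ from hz₀Ω₁))
    have h6 := Filter.image_mem_map (m := fun s => ψ' (z₀.1, s)) h5
    rw [h4] at h6
    refine Filter.mem_of_superset h6 ?_
    rintro _ ⟨s, hs, rfl⟩
    have h7 := hSmem _ hs.2
    refine ⟨χ'.map_source h7.1, ?_⟩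
    change χ'.symm (χ' (Ψ ((φ.prod χ).symm (z₀.1, s)))) ∈ _
    rw [χ'.left_inv h7.1]
    exact ⟨_, h7.2, rfl⟩
  obtain ⟨I, hIsub, hI, hz₀I⟩ := mem_nhds_iff.1 hcover
  have sg : ContDiffOn ℝ ∞ (fun t => g (χ'.symm t)) I :=
    contMDiffOn_iff_contDiffOn.1 (hg.comp (hχ'.contMDiffOn_symm.mono fun t ht => (hIsub ht).1)
      fun t ht => (hIsub ht).2)
  set Ω : Set (Plane × ℝ) := Ω₁ ∩ ψ' ⁻¹' I with hΩ
  have hΩo : IsOpen Ω := sψ'.continuousOn.isOpen_inter_preimage hΩ₁o hI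
  have hΩP : Ω ⊆ (φ.prod χ).target := fun z hz => hz.1.1
  have L := (D.invariants.local_invariants hf hconv hφ hχ).mono hΩo hΩP
  have hflat := L.flat_of_trivial hI sg (sψ'.mono fun z hz => hz.1) (fun z hz => hz.2)
    fun z hz => by
      have h7 := hSmem _ hz.1.2
      refine (hfg _ h7.2.1 _ h7.2.2).trans ?_
      exact congrArg g (χ'.left_inv h7.1).symm
  have := D.isFlatAt_of_flatInvariants hf hconv hφ hχ hΩP hflat ⟨hz₀Ω₁, hz₀I⟩
  rwa [hz₀P] at this

end Necessity

/-! ### Adapted coordinates of the surface -/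

section Adapted

variable {M : Type*} [TopologicalSpace M] [ChartedSpace Plane M] [IsManifold surfaceModel ∞ M]
  {U : Type*} [TopologicalSpace U] [ChartedSpace ℝ U] [IsManifold curveModel ∞ U]
  {φ : OpenPartialHomeomorph M Plane} {χ : OpenPartialHomeomorph U ℝ}
  {f : (q : M) → U → TangentSpace surfaceModel q} {z : Plane × ℝ}

omit [IsManifold surfaceModel ∞ M] [IsManifold curveModel ∞ U] [TopologicalSpace U]
  [ChartedSpace ℝ U] in
/-- The velocities of the control system in the coordinates `φ`. -/
noncomputable def chartVelocity (φ : OpenPartialHomeomorph M Plane)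
    (f : (q : M) → U → TangentSpace surfaceModel q) : M × U → Plane :=
  fun p => mfderiv surfaceModel 𝓘(ℝ, Plane) φ p.1 (f p.1 p.2)

omit [IsManifold surfaceModel ∞ M] [IsManifold curveModel ∞ U] in
/-- The derivative `L_X g` of a plane-valued function `g` on `M × U` along a vector field `X`. -/
noncomputable def lieDerivMap (X : (p : M × U) → TangentSpace prodModel p) (g : M × U → Plane)
    (p : M × U) : Plane :=
  mfderiv prodModel 𝓘(ℝ, Plane) g p (X p)

omit [IsManifold surfaceModel ∞ M] [IsManifold curveModel ∞ U] in
theorem lieDerivMap_eq_lieD (hP : IsSmoothChart prodModel (φ.prod χ)) {Ω : Set (Plane × ℝ)}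
    (hΩ : IsOpen Ω) (hΩP : Ω ⊆ (φ.prod χ).target) {g : M × U → Plane} {g' : Plane × ℝ → Plane}
    (hg : ∀ y ∈ Ω, g ((φ.prod χ).symm y) = g' y) (hz : z ∈ Ω)
    (X : (p : M × U) → TangentSpace prodModel p) :
    lieDerivMap X g ((φ.prod χ).symm z) = fderiv ℝ g' z (coordField prodModel (φ.prod χ) X z) := by
  rw [← (Filter.eventuallyEq_of_mem (hΩ.mem_nhds hz) hg).fderiv_eq]
  exact hP.mfderiv_apply g (hΩP hz) _

namespace FeedbackInvariants

/-- Adapted coordinates at a point of `M × U`: the system and its derivative along `v`, written in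
these coordinates, are constant to first order in the directions of `h` and `[v, h]`. -/
def IsAdaptedAt (D : FeedbackInvariants f) (φ : OpenPartialHomeomorph M Plane) (p : M × U) : Prop :=
  ∀ X, (X = D.ham ∨ X = mlieBracket prodModel D.v D.ham) →
    lieDerivMap X (chartVelocity φ f) p = 0 ∧
    lieDerivMap X (lieDerivMap D.v (chartVelocity φ f)) p = 0

variable (D : FeedbackInvariants f) (hf : IsSmoothSystem f) (hconv : IsStronglyConvex f)

include hf hconv

/-- Being adapted is tested in arbitrary coordinates `φ₀`, possibly different from `φ`. -/
theorem isAdaptedAt_iff {φ₀ : OpenPartialHomeomorph M Plane} (hφ₀ : IsSmoothChart surfaceModel φ₀)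
    (hχ : IsSmoothChart curveModel χ) {Ω : Set (Plane × ℝ)} (hΩ : IsOpen Ω)
    (hΩP : Ω ⊆ (φ₀.prod χ).target) {g : Plane × ℝ → Plane}
    (hg : ∀ y ∈ Ω, chartVelocity φ f ((φ₀.prod χ).symm y) = g y) (hz : z ∈ Ω) :
    D.IsAdaptedAt φ ((φ₀.prod χ).symm z) ↔ ∀ X : Plane × ℝ → Plane × ℝ,
      (X = hamField (coordSystem φ₀ χ f) (coordSnd φ₀ χ D.ham) ∨
        X = lieBracket ℝ (vertField (coordSnd φ₀ χ D.v))
          (hamField (coordSystem φ₀ χ f) (coordSnd φ₀ χ D.ham))) →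
      lieD X g z = 0 ∧ lieD X (lieD (vertField (coordSnd φ₀ χ D.v)) g) z = 0 := by
  have hP := hφ₀.prod hχ
  have h1 : ∀ y ∈ Ω, lieDerivMap D.v (chartVelocity φ f) ((φ₀.prod χ).symm y) =
      lieD (vertField (coordSnd φ₀ χ D.v)) g y := fun y hy => by
    rw [lieDerivMap_eq_lieD hP hΩ hΩP hg hy, D.invariants.coordField_v hφ₀ hχ (hΩP hy)]
    rfl
  have hham := D.invariants.coordField_ham hφ₀ hχ (hΩP hz)
  have hbr := D.invariants.coordField_bracket hf hconv hφ₀ hχ (hΩP hz)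
  rw [IsAdaptedAt, forall_eq_or_imp, forall_eq_or_imp, forall_eq, forall_eq,
    lieDerivMap_eq_lieD hP hΩ hΩP hg hz, lieDerivMap_eq_lieD hP hΩ hΩP hg hz,
    lieDerivMap_eq_lieD hP hΩ hΩP h1 hz, lieDerivMap_eq_lieD hP hΩ hΩP h1 hz, hham, hbr]
  rfl

/-- Being adapted in terms of the coordinates themselves. -/
theorem isAdaptedAt_iff_self (hφ : IsSmoothChart surfaceModel φ) (hχ : IsSmoothChart curveModel χ)
    (hz : z ∈ (φ.prod χ).target) :
    D.IsAdaptedAt φ ((φ.prod χ).symm z) ↔ ∀ X : Plane × ℝ → Plane × ℝ,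
      (X = hamField (coordSystem φ χ f) (coordSnd φ χ D.ham) ∨
        X = lieBracket ℝ (vertField (coordSnd φ χ D.v))
          (hamField (coordSystem φ χ f) (coordSnd φ χ D.ham))) →
      lieD X (coordSystem φ χ f) z = 0 ∧
      lieD X (lieD (vertField (coordSnd φ χ D.v)) (coordSystem φ χ f)) z = 0 :=
  D.isAdaptedAt_iff hf hconv hφ hχ (φ.prod χ).open_target subset_rfl (fun _ _ => rfl) hz

variable (hflat : ∀ p, D.IsFlatAt p)
include hflat

/-- In a flat system the set of controls at which given coordinates are adapted over a point `q` is
open, by uniqueness for linear differential equations along the fibre, and closed, by continuity. -/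
theorem eventually_isAdaptedAt (hφ : IsSmoothChart surfaceModel φ) {q : M} (hq : q ∈ φ.source)
    (u : U) : (D.IsAdaptedAt φ (q, u) → ∀ᶠ w in nhds u, D.IsAdaptedAt φ (q, w)) ∧
      (¬ D.IsAdaptedAt φ (q, u) → ∀ᶠ w in nhds u, ¬ D.IsAdaptedAt φ (q, w)) := by
  have hχ := isSmoothChart_chartAt u
  set χ := chartAt ℝ u
  have hu : u ∈ χ.source := mem_chart_source ℝ u
  have L := D.flatInvariants hf hconv hφ hχ hflat
  set Ω := (φ.prod χ).target with hΩdef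
  have hΩ : IsOpen Ω := L.isOpen
  set x := φ q with hx
  have hxt : x ∈ φ.target := φ.map_source hq
  let C : ℝ → Prop := fun s => ∀ X : Plane × ℝ → Plane × ℝ,
      (X = hamField (coordSystem φ χ f) (coordSnd φ χ D.ham) ∨
        X = lieBracket ℝ (vertField (coordSnd φ χ D.v))
          (hamField (coordSystem φ χ f) (coordSnd φ χ D.ham))) →
      lieD X (coordSystem φ χ f) (x, s) = 0 ∧
      lieD X (lieD (vertField (coordSnd φ χ D.v)) (coordSystem φ χ f)) (x, s) = 0
  have hC : ∀ w ∈ χ.source, D.IsAdaptedAt φ (q, w) ↔ C (χ w) := by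
    intro w hw
    have h := D.isAdaptedAt_iff_self hf hconv hφ hχ (z := (x, χ w)) ⟨hxt, χ.map_source hw⟩
    have h1 : (φ.prod χ).symm (x, χ w) = (q, w) := (φ.prod χ).left_inv (x := (q, w)) ⟨hq, hw⟩
    rwa [h1] at h
  have hsrc : ∀ᶠ w in nhds u, w ∈ χ.source := χ.open_source.mem_nhds hu
  have hcont := χ.continuousAt hu
  have hz : (x, χ u) ∈ Ω := ⟨hxt, χ.map_source hu⟩
  constructor
  · intro h
    have h1 := L.eventually_annihilated L.contDiffOn_F (fun y hy => L.vvF_eq hy) hz ((hC u hu).1 h)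
    filter_upwards [hsrc, hcont.eventually h1] with w hw hw1
    exact (hC w hw).2 hw1
  · intro h
    rw [hC u hu] at h
    have hclosed : ∀ k : Plane × ℝ → Plane, ContDiffOn ℝ ∞ k Ω → k (x, χ u) ≠ 0 →
        ∀ᶠ w in nhds u, k (x, χ w) ≠ 0 := by
      intro k hk hne
      have h1 : ContinuousAt (fun w => k (x, χ w)) u :=
        ContinuousAt.comp (f := fun w => (x, χ w)) (hk.continuousOn.continuousAt (hΩ.mem_nhds hz))
          (continuousAt_const.prodMk hcont)
      exact h1.eventually_ne hne
    have hX : ∀ X : Plane × ℝ → Plane × ℝ,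
        (X = hamField (coordSystem φ χ f) (coordSnd φ χ D.ham) ∨
        X = lieBracket ℝ (vertField (coordSnd φ χ D.v))
          (hamField (coordSystem φ χ f) (coordSnd φ χ D.ham))) → ContDiffOn ℝ ∞ X Ω := by
      rintro X (rfl | rfl)
      exacts [L.contDiffOn_ham, L.contDiffOn_bracket]
    simp only [C, not_forall] at h
    obtain ⟨X, hX1, h2⟩ := h
    have h3 : lieD X (coordSystem φ χ f) (x, χ u) ≠ 0 ∨
        lieD X (lieD (vertField (coordSnd φ χ D.v)) (coordSystem φ χ f)) (x, χ u) ≠ 0 := by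
      by_contra! hcon
      exact h2 hcon
    rcases h3 with h3 | h3
    · filter_upwards [hsrc, hclosed _ (L.contDiffOn_F.lieD hΩ (hX X hX1)) h3] with w hw hw1 hw2
      exact hw1 ((hC w hw).1 hw2 X hX1).1
    · filter_upwards [hsrc, hclosed _ (L.contDiffOn_vF.lieD hΩ (hX X hX1)) h3] with w hw hw1 hw2
      exact hw1 ((hC w hw).1 hw2 X hX1).2

/-- Near every point of the surface there are coordinates that are adapted for all controls: those
given by a leaf are adapted for one control over each point, and `U` is connected. -/
theorem exists_adapted_chart [ConnectedSpace U] (q₀ : M) :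
    ∃ φ ∈ IsManifold.maximalAtlas surfaceModel ∞ M, q₀ ∈ φ.source ∧
      ∀ q ∈ φ.source, ∀ u, D.IsAdaptedAt φ (q, u) := by
  obtain ⟨u₀⟩ : Nonempty U := inferInstance
  set φ₀ := chartAt Plane q₀
  have hφ₀ : IsSmoothChart surfaceModel φ₀ :=
      isSmoothChart_chartAt_plane q₀
  have hq₀ : q₀ ∈ φ₀.source := mem_chart_source Plane q₀
  have hχ := isSmoothChart_chartAt u₀
  set χ := chartAt ℝ u₀
  have hu₀ : u₀ ∈ χ.source := mem_chart_source ℝ u₀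
  have L := D.flatInvariants hf hconv hφ₀ hχ hflat
  obtain ⟨φ₁, O, hO, hzO, sφ₁, hinv, hleaf⟩ :=
    L.exists_adapted_map (z := φ₀.prod χ (q₀, u₀)) ((φ₀.prod χ).map_source ⟨hq₀, hu₀⟩)
  obtain ⟨Φ, hΦ, hzΦ, hΦO, sΦ⟩ := sφ₁.exists_openPartialHomeomorph hO hinv hzO
  have hsrc : ∀ q ∈ (φ₀.trans Φ).source, q ∈ φ₀.source ∧ φ₀ q ∈ Φ.source := fun q hq => by
    simpa using hq
  have hφ : IsSmoothChart surfaceModel (φ₀.trans Φ) := by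
    constructor
    · have h1 : ContMDiffOn 𝓘(ℝ, Plane) 𝓘(ℝ, Plane) ∞ Φ Φ.source := by
        rw [hΦ]
        exact (sφ₁.mono hΦO).contMDiffOn
      exact h1.comp (hφ₀.contMDiffOn.mono fun q hq => (hsrc q hq).1) fun q hq => (hsrc q hq).2
    · have h1 : ∀ y ∈ (φ₀.trans Φ).target, y ∈ Φ.target ∧ Φ.symm y ∈ φ₀.target := fun y hy => by
        simpa using hy
      exact hφ₀.contMDiffOn_symm.comp (sΦ.contMDiffOn.mono fun y hy => (h1 y hy).1)
        fun y hy => (h1 y hy).2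
  refine ⟨φ₀.trans Φ, OpenPartialHomeomorph.mem_maximalAtlas_of_contMDiffOn _ hφ.contMDiffOn
    hφ.contMDiffOn_symm, by simpa using ⟨hq₀, hzΦ⟩, fun q hq => ?_⟩
  have hclopen : IsClopen {u : U | D.IsAdaptedAt (φ₀.trans Φ) (q, u)} := by
    have h1 := D.eventually_isAdaptedAt hf hconv hflat hφ hq
    refine ⟨⟨isOpen_iff_eventually.2 fun u hu => (h1 u).2 hu⟩,
      isOpen_iff_eventually.2 fun u hu => (h1 u).1 hu⟩
  have hne : {u : U | D.IsAdaptedAt (φ₀.trans Φ) (q, u)}.Nonempty := by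
    obtain ⟨s, hs, hs1⟩ := hleaf (φ₀ q) (hΦO (hsrc q hq).2)
    refine ⟨χ.symm s, ?_⟩
    have h2 : (φ₀.prod χ).symm (φ₀ q, s) = (q, χ.symm s) :=
      Prod.ext (φ₀.left_inv (hsrc q hq).1) rfl
    change D.IsAdaptedAt (φ₀.trans Φ) (q, χ.symm s)
    rw [← h2]
    refine (D.isAdaptedAt_iff hf hconv hφ₀ hχ
      (Ω := (φ₀.prod χ).target ∩ Prod.fst ⁻¹' Φ.source)
      ((φ₀.prod χ).open_target.inter (Φ.open_source.preimage continuous_fst))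
      Set.inter_subset_left (fun y hy => ?_) ⟨hs, (hsrc q hq).2⟩).2 hs1
    have h3 : φ₀ (φ₀.symm y.1) = y.1 := φ₀.right_inv hy.1.1
    have h4 : MDifferentiableAt 𝓘(ℝ, Plane) 𝓘(ℝ, Plane) φ₁ (φ₀ (φ₀.symm y.1)) := by
      rw [h3]
      exact (sφ₁.differentiableAt_of_isOpen hO (hΦO hy.2)).mdifferentiableAt
    have h5 := mfderiv_comp (φ₀.symm y.1) h4
      ((hφ₀.contMDiffAt (φ₀.map_target hy.1.1)).mdifferentiableAt (by simp))
    rw [mfderiv_eq_fderiv, h3] at h5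
    have h6 : (⇑(φ₀.trans Φ) : M → Plane) = φ₁ ∘ φ₀ := by rw [← hΦ]; rfl
    change mfderiv surfaceModel 𝓘(ℝ, Plane) (φ₀.trans Φ) (φ₀.symm y.1) _ = _
    rw [h6]
    exact congrArg (fun L : TangentSpace surfaceModel (φ₀.symm y.1) →L[ℝ] Plane =>
      L (f (φ₀.symm y.1) (χ.symm y.2))) h5
  intro u
  have := hclopen.eq_univ hne
  exact this.symm.subset (Set.mem_univ u)

omit hflat in
/-- In adapted coordinates the system, as a map from the product of the plane and the control line
to the plane, has rank one. -/
theorem rank_coordSystem (hφ : IsSmoothChart surfaceModel φ) (hχ : IsSmoothChart curveModel χ)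
    (h : D.IsAdaptedAt φ ((φ.prod χ).symm z)) (hz : z ∈ (φ.prod χ).target) (y : Plane) :
    ∃ r : ℝ, fderiv ℝ (coordSystem φ χ f) z (y, r) = 0 := by
  have L := D.invariants.local_invariants hf hconv hφ hχ
  rw [D.isAdaptedAt_iff_self hf hconv hφ hχ hz] at h
  have h1 := (h _ (.inl rfl)).1
  have h2 := (h _ (.inr rfl)).1
  rw [lieD] at h1 h2
  set X := hamField (coordSystem φ χ f) (coordSnd φ χ D.ham) with hX
  set Y := lieBracket ℝ (vertField (coordSnd φ χ D.v)) X with hY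
  set α := D.ε * coordCovector φ χ D.cov z y
  set β := lieD (vertField (coordSnd φ χ D.v)) (coordCovector φ χ D.cov) z y
  refine ⟨α * (X z).2 + β * (Y z).2, ?_⟩
  have h3 : ((y, α * (X z).2 + β * (Y z).2) : Plane × ℝ) = α • X z + β • Y z := by
    refine Prod.ext ?_ rfl
    rw [Prod.fst_add, Prod.smul_fst, Prod.smul_fst, L.bracket_fst hz]
    exact L.frame hz y
  rw [h3, map_add, map_smul, map_smul, h1, h2, smul_zero, smul_zero, add_zero]

end FeedbackInvariants

end Adapted

/-! ### Gluing of local feedbacks along a compact set of controls -/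

section Gluing

/-- Local injectivity in the control is uniform along a compact set of controls. -/
theorem exists_uniform_injectivity {M U : Type*} [TopologicalSpace M] [MetricSpace U]
    {Y : Type*} {G : M × U → Y} {q₀ : M} {K : Set U}
    (hK : IsCompact K)
    (hinj : ∀ u₀, ∃ N ∈ nhds q₀, ∃ W ∈ nhds u₀, ∀ q ∈ N, Set.InjOn (fun w => G (q, w)) W) :
    ∃ N ∈ nhds q₀, ∃ δ > 0, ∀ q ∈ N, ∀ u ∈ K, ∀ w w', dist u w < δ → dist u w' < δ →
      G (q, w) = G (q, w') → w = w' := by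
  refine hK.induction_on (p := fun S => ∃ N ∈ nhds q₀, ∃ δ > 0, ∀ q ∈ N, ∀ u ∈ S, ∀ w w',
    dist u w < δ → dist u w' < δ → G (q, w) = G (q, w') → w = w') ?_ ?_ ?_ ?_
  · exact ⟨Set.univ, Filter.univ_mem, 1, one_pos, fun _ _ _ h => absurd h (Set.notMem_empty _)⟩
  · rintro S T hST ⟨N, hN, δ, hδ, h⟩
    exact ⟨N, hN, δ, hδ, fun q hq u hu => h q hq u (hST hu)⟩
  · rintro S T ⟨N, hN, δ, hδ, h⟩ ⟨N', hN', δ', hδ', h'⟩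
    refine ⟨N ∩ N', Filter.inter_mem hN hN', min δ δ', lt_min hδ hδ', ?_⟩
    rintro q hq u (hu | hu) w w' hw hw'
    · exact h q hq.1 u hu w w' (hw.trans_le (min_le_left _ _)) (hw'.trans_le (min_le_left _ _))
    · exact h' q hq.2 u hu w w' (hw.trans_le (min_le_right _ _)) (hw'.trans_le (min_le_right _ _))
  · intro u₀ _
    obtain ⟨N, hN, W, hW, h⟩ := hinj u₀
    obtain ⟨δ, hδ, hball⟩ := Metric.mem_nhds_iff.1 hW
    refine ⟨Metric.ball u₀ (δ / 2),
      mem_nhdsWithin_of_mem_nhds (Metric.ball_mem_nhds _ (half_pos hδ)),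
      N, hN, δ / 2, half_pos hδ, fun q hq u hu w w' hw hw' hG => ?_⟩
    rw [Metric.mem_ball] at hu
    have h1 : ∀ w, dist u w < δ / 2 → w ∈ W := fun w hw => hball <| by
      rw [Metric.mem_ball]
      linarith [dist_triangle w u u₀, dist_comm u w]
    exact h q hq (h1 w hw) (h1 w' hw') hG

variable {M : Type*} [TopologicalSpace M] [ChartedSpace Plane M]
  {U : Type*} [TopologicalSpace U] [T2Space U] [SecondCountableTopology U] [ChartedSpace ℝ U]

/-- Local feedbacks that transform `G` into a map that does not depend on `q`, and that are the
identity at `q₀`, define a feedback near a compact set of controls: the new control is the unique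
one close to the old one. -/
theorem exists_feedback_near_compact {Y : Type*} {G : M × U → Y} {q₀ : M} {K : Set U}
    (hK : IsCompact K)
    (hinj : ∀ u₀, ∃ N ∈ nhds q₀, ∃ W ∈ nhds u₀, ∀ q ∈ N, Set.InjOn (fun w => G (q, w)) W)
    (hloc : ∀ u₀, ∃ (ψ : M × U → U) (B : Set (M × U)), IsOpen B ∧ (q₀, u₀) ∈ B ∧
      ContMDiffOn prodModel curveModel ∞ ψ B ∧ (∀ p ∈ B, G p = G (q₀, ψ p)) ∧ ψ (q₀, u₀) = u₀) :
    ∃ (O : Set M) (V : Set U) (ψ : M → U → U), IsOpen O ∧ q₀ ∈ O ∧ IsOpen V ∧ K ⊆ V ∧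
      ContMDiffOn prodModel curveModel ∞ (fun p : M × U => ψ p.1 p.2) (O ×ˢ V) ∧
      (∀ q ∈ O, Set.InjOn (ψ q) V) ∧ ∀ q ∈ O, ∀ u ∈ V, G (q, u) = G (q₀, ψ q u) := by
  have : LocallyCompactSpace U := ChartedSpace.locallyCompactSpace ℝ U
  let : MetricSpace U := TopologicalSpace.metrizableSpaceMetric U
  obtain ⟨K', hK', hKK'⟩ := exists_compact_superset hK
  obtain ⟨N, hN, δ, hδ, huniq⟩ := exists_uniform_injectivity hK' hinj
  -- The points near which a local feedback moves the controls by less than `δ / 2`.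
  let T : Set (M × U) := {p | ∃ (ψ : M × U → U) (B : Set (M × U)), IsOpen B ∧ p ∈ B ∧
    ContMDiffOn prodModel curveModel ∞ ψ B ∧
    ∀ p' ∈ B, G p' = G (q₀, ψ p') ∧ dist p'.2 (ψ p') < δ / 2}
  have hT : IsOpen T := isOpen_iff_mem_nhds.2 fun p ⟨ψ, B, hB, hp, h1, h2⟩ =>
    Filter.mem_of_superset (hB.mem_nhds hp) fun p' hp' => ⟨ψ, B, hB, hp', h1, h2⟩
  have hTK : ({q₀} : Set M) ×ˢ K' ⊆ T := by
    rintro ⟨q, u₀⟩ ⟨rfl, -⟩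
    obtain ⟨ψ, B, hB, hp, h1, h2, h3⟩ := hloc u₀
    have hc : ContinuousOn (fun p : M × U => dist p.2 (ψ p)) B :=
      continuous_dist.comp_continuousOn (continuousOn_snd.prodMk h1.continuousOn)
    refine ⟨ψ, B ∩ (fun p : M × U => dist p.2 (ψ p)) ⁻¹' Set.Iio (δ / 2),
      hc.isOpen_inter_preimage hB isOpen_Iio, ⟨hp, ?_⟩, h1.mono Set.inter_subset_left,
      fun p' hp' => ⟨h2 p' hp'.1, hp'.2⟩⟩
    change dist u₀ (ψ (q, u₀)) < δ / 2
    rw [h3, dist_self]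
    exact half_pos hδ
  obtain ⟨O, V, hO, hV, hqO, hKV, hOV⟩ := generalized_tube_lemma isCompact_singleton hK' hT hTK
  have hex : ∀ q ∈ O, ∀ u ∈ V, ∃ w, G (q, u) = G (q₀, w) ∧ dist u w < δ / 2 := by
    intro q hq u hu
    obtain ⟨ψ, B, hB, hp, h1, h2⟩ := hOV (show (q, u) ∈ O ×ˢ V from ⟨hq, hu⟩)
    exact ⟨ψ (q, u), h2 _ hp⟩
  choose! ψ hψ using hex
  refine ⟨O ∩ interior N, interior K' ∩ V, ψ, hO.inter isOpen_interior,
    ⟨hqO rfl, mem_interior_iff_mem_nhds.2 hN⟩, isOpen_interior.inter hV,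
    fun u hu => ⟨hKK' hu, hKV (interior_subset (hKK' hu))⟩, ?_, ?_,
    fun q hq u hu => (hψ q hq.1 u hu.2).1⟩
  · rintro ⟨q, u⟩ ⟨hq, hu⟩
    obtain ⟨ψ', B, hB, hp, h1, h2⟩ := hOV (show (q, u) ∈ O ×ˢ V from ⟨hq.1, hu.2⟩)
    have h3 : (fun p : M × U => ψ p.1 p.2) =ᶠ[nhds (q, u)] ψ' := by
      have h4 : (O ∩ interior N) ×ˢ (interior K' ∩ V) ∈ nhds (q, u) :=
        ((hO.inter isOpen_interior).prod (isOpen_interior.inter hV)).mem_nhds ⟨hq, hu⟩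
      filter_upwards [hB.mem_nhds hp, h4] with p hpB hp4
      have h5 := hψ p.1 hp4.1.1 p.2 hp4.2.2
      have h6 := h2 p hpB
      exact huniq q₀ (mem_of_mem_nhds hN) p.2 (interior_subset hp4.2.1) _ _
        (h5.2.trans (half_lt_self hδ)) (h6.2.trans (half_lt_self hδ)) (h5.1.symm.trans h6.1)
    exact ((h1.contMDiffAt (hB.mem_nhds hp)).congr_of_eventuallyEq h3).contMDiffWithinAt
  · intro q hq u hu u' hu' h
    have h1 := hψ q hq.1 u hu.2
    have h2 := hψ q hq.1 u' hu'.2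
    refine huniq q (interior_subset hq.2) u (interior_subset hu.1) u u' (by rwa [dist_self]) ?_ ?_
    · have h3 := h2.2
      rw [← h, dist_comm] at h3
      linarith [dist_triangle u (ψ q u) u', h1.2]
    · rw [h1.1, h2.1, h]

end Gluing

/-! ### Flat systems are trivializable -/

section Sufficiency

variable {M : Type*} [TopologicalSpace M] [ChartedSpace Plane M] [IsManifold surfaceModel ∞ M]
  {U : Type*} [TopologicalSpace U] [ChartedSpace ℝ U] [IsManifold curveModel ∞ U]
  {φ : OpenPartialHomeomorph M Plane} {χ : OpenPartialHomeomorph U ℝ}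
  {f : (q : M) → U → TangentSpace surfaceModel q} {z : Plane × ℝ}

/-- In coordinates, a curve of velocities is locally injective, uniformly in the base point. -/
theorem exists_injOn_of_fderiv_ne_zero {Ω : Set (Plane × ℝ)} {F : Plane × ℝ → Plane}
    (hΩ : IsOpen Ω) (hF : ContDiffOn ℝ ∞ F Ω) (hz : z ∈ Ω) (hne : fderiv ℝ F z (0, 1) ≠ 0) :
    ∃ O, IsOpen O ∧ z ∈ O ∧ O ⊆ Ω ∧ ∀ x s s', (x, s) ∈ O → (x, s') ∈ O → F (x, s) = F (x, s') →
      s = s' := by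
  let l : Plane →L[ℝ] ℝ := innerSL ℝ (fderiv ℝ F z (0, 1))
  have sF : ContDiffOn ℝ ∞ (fun y => fderiv ℝ F y (0, 1)) Ω :=
    hF.lieD hΩ (X := fun _ => (0, 1)) contDiffOn_const
  have hlz : l (fderiv ℝ F z (0, 1)) ≠ 0 := by
    simpa [l] using hne
  have hder : ∀ y ∈ Ω, fderiv ℝ (fun y => l (F y)) y (0, 1) = l (fderiv ℝ F y (0, 1)) :=
    fun y hy => by
      have := (l.hasFDerivAt.comp y (hF.differentiableAt_of_isOpen hΩ hy).hasFDerivAt).fderiv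
      exact congrArg (fun L : Plane × ℝ →L[ℝ] ℝ => L (0, 1)) this
  have hΩ' : IsOpen (Ω ∩ (fun y => l (fderiv ℝ F y (0, 1))) ⁻¹' {0}ᶜ) :=
    (l.continuous.comp_continuousOn sF.continuousOn).isOpen_inter_preimage hΩ isOpen_compl_singleton
  obtain ⟨ρ, W, O, -, -, -, hO, hzO, hOΩ, hρ⟩ := exists_solution (g := fun y => l (F y)) hΩ'
    ((l.contDiff.comp_contDiffOn hF).mono Set.inter_subset_left)
    (fun y hy => by rw [hder y hy.1]; exact hy.2) ⟨hz, hlz⟩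
  refine ⟨O, hO, hzO, fun y hy => (hOΩ hy).1, fun x s s' hs hs' h => ?_⟩
  have h1 := (hρ _ hs).2
  have h2 := (hρ _ hs').2
  simp only at h1 h2
  rw [← h1, ← h2, h]

variable (hf : IsSmoothSystem f) (hconv : IsStronglyConvex f)

omit [IsManifold curveModel ∞ U] in
include hf in
theorem contMDiff_chartVelocity_right (hφ : IsSmoothChart surfaceModel φ) {q : M}
    (hq : q ∈ φ.source) :
    ContMDiff curveModel 𝓘(ℝ, Plane) ∞ (fun u : U => chartVelocity φ f (q, u)) :=
  contMDiffOn_univ.1 ((hf.contMDiffOn_mfderiv hφ).comp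
    (contMDiff_const.prodMk contMDiff_id).contMDiffOn fun _ _ => ⟨hq, trivial⟩)

include hf hconv in
theorem mfderiv_chartVelocity_ne_zero (hφ : IsSmoothChart surfaceModel φ) {q : M}
    (hq : q ∈ φ.source) (u : U) :
    mfderiv curveModel 𝓘(ℝ, Plane) (fun u : U => chartVelocity φ f (q, u)) u ≠ 0 := by
  intro h0
  have hχ := isSmoothChart_chartAt u
  set χ := chartAt ℝ u
  have hu : u ∈ χ.source := mem_chart_source ℝ u
  have hz : φ.prod χ (q, u) ∈ (φ.prod χ).target := (φ.prod χ).map_source ⟨hq, hu⟩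
  have hF := (hf.contDiffOn_coordSystem hφ hχ).differentiableAt_of_isOpen
    (φ.prod χ).open_target hz
  have hreg := hconv.regular hφ hχ hF hz
  have h1 := hχ.mfderiv_apply (fun u : U => chartVelocity φ f (q, u)) (χ.map_source hu)
  rw [χ.left_inv hu, h0] at h1
  have h2 := h1 (mfderiv 𝓘(ℝ, ℝ) curveModel χ.symm (χ u) (1 : ℝ))
  have h3 := hχ.mfderiv_mfderiv_symm (χ.map_source hu) 1
  rw [χ.left_inv hu] at h3
  have h4 : (fun s => chartVelocity φ f (q, χ.symm s)) = fun s => coordSystem φ χ f (φ q, s) := by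
    funext s
    rw [coordSystem, φ.left_inv hq]
    rfl
  have h5 : fderiv ℝ (coordSystem φ χ f) (φ.prod χ (q, u)) (0, 1) = 0 := by
    rw [← fderiv_partial_snd hF]
    change fderiv ℝ (fun s => coordSystem φ χ f (φ q, s)) (χ u) 1 = 0
    rw [← h4]
    exact (congrArg _ h3).symm.trans h2.symm
  rw [h5] at hreg
  simp [detForm_apply] at hreg

include hf hconv in
theorem exists_injOn_chartVelocity (hφ : IsSmoothChart surfaceModel φ) {q₀ : M}
    (hq₀ : q₀ ∈ φ.source) (u₀ : U) : ∃ N ∈ nhds q₀, ∃ W ∈ nhds u₀, ∀ q ∈ N,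
      Set.InjOn (fun w => chartVelocity φ f (q, w)) W := by
  have hχ := isSmoothChart_chartAt u₀
  set χ := chartAt ℝ u₀
  have hu₀ : u₀ ∈ χ.source := mem_chart_source ℝ u₀
  have hz : φ.prod χ (q₀, u₀) ∈ (φ.prod χ).target := (φ.prod χ).map_source ⟨hq₀, hu₀⟩
  have sF := hf.contDiffOn_coordSystem hφ hχ
  have hF := sF.differentiableAt_of_isOpen (φ.prod χ).open_target hz
  have hne : fderiv ℝ (coordSystem φ χ f) (φ.prod χ (q₀, u₀)) (0, 1) ≠ 0 := fun h => by
    have hreg := hconv.regular hφ hχ hF hz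
    rw [h] at hreg
    simp [detForm_apply] at hreg
  obtain ⟨O, hO, hzO, hOΩ, hinj⟩ :=
    exists_injOn_of_fderiv_ne_zero (φ.prod χ).open_target sF hz hne
  have h1 : (φ.prod χ).source ∩ φ.prod χ ⁻¹' O ∈ nhds (q₀, u₀) :=
    ((φ.prod χ).isOpen_inter_preimage hO).mem_nhds ⟨⟨hq₀, hu₀⟩, hzO⟩
  obtain ⟨N, hN, W, hW, hNW⟩ := mem_nhds_prod_iff.1 h1
  refine ⟨N, hN, W, hW, fun q hq w hw w' hw' h => ?_⟩
  have h2 := hNW (show (q, w) ∈ N ×ˢ W from ⟨hq, hw⟩)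
  have h3 := hNW (show (q, w') ∈ N ×ˢ W from ⟨hq, hw'⟩)
  have h4 : ∀ w, (q, w) ∈ (φ.prod χ).source → coordSystem φ χ f (φ q, χ w) =
      chartVelocity φ f (q, w) := fun w hw => by
    rw [coordSystem, φ.left_inv hw.1, χ.left_inv hw.2]
    rfl
  refine χ.injOn h2.1.2 h3.1.2 (hinj (φ q) _ _ h2.2 h3.2 ?_)
  exact (h4 w h2.1).trans (h.trans (h4 w' h3.1).symm)

namespace FeedbackInvariants

variable (D : FeedbackInvariants f)

include hf hconv in
/-- In adapted coordinates there are local feedbacks that make the system independent of the point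
of the surface. -/
theorem exists_local_feedback (hφ : IsSmoothChart surfaceModel φ)
    (had : ∀ q ∈ φ.source, ∀ u, D.IsAdaptedAt φ (q, u)) {q₀ : M} (hq₀ : q₀ ∈ φ.source) (u₀ : U) :
    ∃ (ψ : M × U → U) (B : Set (M × U)), IsOpen B ∧ (q₀, u₀) ∈ B ∧
      ContMDiffOn prodModel curveModel ∞ ψ B ∧
      (∀ p ∈ B, chartVelocity φ f p = chartVelocity φ f (q₀, ψ p)) ∧ ψ (q₀, u₀) = u₀ := by
  have hχ := isSmoothChart_chartAt u₀
  set χ := chartAt ℝ u₀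
  have hu₀ : u₀ ∈ χ.source := mem_chart_source ℝ u₀
  have hP := hφ.prod hχ
  have hz : φ.prod χ (q₀, u₀) ∈ (φ.prod χ).target := (φ.prod χ).map_source ⟨hq₀, hu₀⟩
  have sF := hf.contDiffOn_coordSystem hφ hχ
  have hF := sF.differentiableAt_of_isOpen (φ.prod χ).open_target hz
  have hne : fderiv ℝ (coordSystem φ χ f) (φ.prod χ (q₀, u₀)) (0, 1) ≠ 0 := fun h => by
    have hreg := hconv.regular hφ hχ hF hz
    rw [h] at hreg
    simp [detForm_apply] at hreg
  obtain ⟨ψ, O, hO, hzO, hOΩ, sψ, hψ, hψ₀⟩ := exists_reparametrization (φ.prod χ).open_target sF hz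
    (fun z hz y => D.rank_coordSystem hf hconv hφ hχ (had _ (φ.map_target hz.1) _) hz y) hne
  have hB : ∀ p ∈ (φ.prod χ).source ∩ φ.prod χ ⁻¹' O, ψ (φ.prod χ p) ∈ χ.target := fun p hp =>
    (hψ _ hp.2).1.2
  refine ⟨fun p => χ.symm (ψ (φ.prod χ p)), (φ.prod χ).source ∩ φ.prod χ ⁻¹' O,
    (φ.prod χ).isOpen_inter_preimage hO, ⟨⟨hq₀, hu₀⟩, hzO⟩, ?_, ?_, ?_⟩
  · exact hχ.contMDiffOn_symm.comp (sψ.contMDiffOn.comp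
      (hP.contMDiffOn.mono Set.inter_subset_left) fun p hp => hp.2) hB
  · intro p hp
    have h1 := (hψ _ hp.2).2
    have h2 : coordSystem φ χ f (φ.prod χ p) = chartVelocity φ f p := by
      change mfderiv surfaceModel 𝓘(ℝ, Plane) φ (φ.symm (φ p.1))
        (f (φ.symm (φ p.1)) (χ.symm (χ p.2))) = _
      rw [φ.left_inv hp.1.1, χ.left_inv hp.1.2]
      rfl
    rw [h2] at h1
    rw [h1]
    change mfderiv surfaceModel 𝓘(ℝ, Plane) φ (φ.symm (φ q₀))
        (f (φ.symm (φ q₀)) (χ.symm (ψ (φ.prod χ p)))) = _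
    rw [φ.left_inv hq₀]
    rfl
  · change χ.symm (ψ (φ q₀, χ u₀)) = u₀
    have h1 : ψ (φ q₀, χ u₀) = χ u₀ := hψ₀ _ hzO
    rw [h1, χ.left_inv hu₀]

include hf hconv in
/-- A flat system is trivializable: `φ` is an adapted chart, and `g` is the system at the base point
`q₀`, read in this chart. -/
theorem isTrivializable_of_isFlatAt [T2Space U] [SecondCountableTopology U] [ConnectedSpace U]
    (hflat : ∀ p, D.IsFlatAt p) : IsTrivializable f := by
  intro q₀ K hK
  obtain ⟨φ, hφA, hq₀, had⟩ := D.exists_adapted_chart hf hconv hflat q₀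
  have hφ := isSmoothChart_of_mem_maximalAtlas hφA
  obtain ⟨O, V, ψ, hO, hq₀O, hV, hKV, sψ, hψinj, hψ⟩ :=
    exists_feedback_near_compact (G := chartVelocity φ f) hK
      (exists_injOn_chartVelocity hf hconv hφ hq₀)
      (D.exists_local_feedback hf hconv hφ had hq₀)
  have hsrc : ∀ q ∈ (φ.restr O).source, q ∈ φ.source ∧ q ∈ O := fun q hq => by
    rw [φ.restr_source, hO.interior_eq] at hq
    exact hq
  refine ⟨φ.restr O, restr_mem_maximalAtlas _ hφA hO, ?_, V, hV, hKV, ψ,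
    fun u => chartVelocity φ f (q₀, u), sψ.mono fun p hp => ⟨(hsrc _ hp.1).2, hp.2⟩,
    fun q hq => ⟨hψinj q (hsrc q hq).2, fun u hu h0 => ?_⟩,
    (contMDiff_chartVelocity_right hf hφ hq₀).contMDiffOn, fun q hq u hu => ?_⟩
  · rw [φ.restr_source, hO.interior_eq]
    exact ⟨hq₀, hq₀O⟩
  · refine mfderiv_chartVelocity_ne_zero hf hconv hφ (hsrc q hq).1 u ?_
    have h1 : (fun u : U => chartVelocity φ f (q, u)) =ᶠ[nhds u]
        (fun u => chartVelocity φ f (q₀, u)) ∘ ψ q :=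
      Filter.eventuallyEq_of_mem (hV.mem_nhds hu) fun w hw => hψ q (hsrc q hq).2 w hw
    have h2 : MDifferentiableAt curveModel curveModel (ψ q) u := by
      have h3 := (sψ (q, u) ⟨(hsrc q hq).2, hu⟩).contMDiffAt
        ((hO.prod hV).mem_nhds ⟨(hsrc q hq).2, hu⟩)
      have h4 : ContMDiffAt curveModel prodModel ∞ (fun w : U => (q, w)) u :=
        contMDiffAt_const.prodMk contMDiffAt_id
      exact (ContMDiffAt.comp u (f := fun w : U => (q, w)) h3 h4).mdifferentiableAt (by simp)
    rw [h1.mfderiv_eq, mfderiv_comp u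
      ((contMDiff_chartVelocity_right hf hφ hq₀).mdifferentiableAt (by simp)) h2, h0]
    exact ContinuousLinearMap.comp_zero _
  · exact hψ q (hsrc q hq).2 u hu

end FeedbackInvariants

end Sufficiency

/-! ### The value of the maximized Hamiltonian -/

section Existence

variable {M : Type*} [TopologicalSpace M] [ChartedSpace Plane M] [IsManifold surfaceModel ∞ M]
  {U : Type*} [TopologicalSpace U] [ChartedSpace ℝ U] [IsManifold curveModel ∞ U]
  {φ : OpenPartialHomeomorph M Plane} {χ : OpenPartialHomeomorph U ℝ}
  {f : (q : M) → U → TangentSpace surfaceModel q} {z : Plane × ℝ}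

theorem deriv_partial_snd {Ω : Set (Plane × ℝ)} {W : Type*} [NormedAddCommGroup W]
    [NormedSpace ℝ W] {F : Plane × ℝ → W} (hΩ : IsOpen Ω) (hF : ContDiffOn ℝ ∞ F Ω) (hz : z ∈ Ω) :
    deriv (fun s => F (z.1, s)) z.2 = fderiv ℝ F z (0, 1) := by
  rw [← fderiv_apply_one_eq_deriv, fderiv_partial_snd (hF.differentiableAt_of_isOpen hΩ hz)]

theorem eventually_deriv_partial_snd {Ω : Set (Plane × ℝ)} {W : Type*} [NormedAddCommGroup W]
    [NormedSpace ℝ W] {F : Plane × ℝ → W} (hΩ : IsOpen Ω) (hF : ContDiffOn ℝ ∞ F Ω) (hz : z ∈ Ω) :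
    deriv (fun s => F (z.1, s)) =ᶠ[nhds z.2] fun s => fderiv ℝ F (z.1, s) (0, 1) := by
  have h : {s | (z.1, s) ∈ Ω} ∈ nhds z.2 :=
    (continuous_const.prodMk continuous_id).continuousAt.preimage_mem_nhds
      (hΩ.mem_nhds (show (z.1, z.2) ∈ Ω from hz))
  exact Filter.eventuallyEq_of_mem h fun s hs => deriv_partial_snd (z := (z.1, s)) hΩ hF hs

theorem deriv_deriv_partial_snd {Ω : Set (Plane × ℝ)} {W : Type*} [NormedAddCommGroup W]
    [NormedSpace ℝ W] {F : Plane × ℝ → W} (hΩ : IsOpen Ω) (hF : ContDiffOn ℝ ∞ F Ω) (hz : z ∈ Ω) :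
    deriv (deriv (fun s => F (z.1, s))) z.2 =
      fderiv ℝ (fun z => fderiv ℝ F z (0, 1)) z (0, 1) := by
  rw [(eventually_deriv_partial_snd hΩ hF hz).deriv_eq]
  exact deriv_partial_snd (F := fun z => fderiv ℝ F z (0, 1)) hΩ
    (hF.lieD hΩ (X := fun _ => (0, 1)) contDiffOn_const) hz

theorem fderiv_velocity_clm_vert {Ω : Set (Plane × ℝ)} {W : Type*} [NormedAddCommGroup W]
    [NormedSpace ℝ W] {G : Plane × ℝ → Plane} (hΩ : IsOpen Ω) (hG : ContDiffOn ℝ ∞ G Ω) (hz : z ∈ Ω)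
    (L : Plane →L[ℝ] W) : fderiv ℝ (fun z => L (G z)) z (0, 1) = L (fderiv ℝ G z (0, 1)) :=
  congrArg (fun L : Plane × ℝ →L[ℝ] W => L (0, 1))
    (L.hasFDerivAt.comp z (hG.differentiableAt_of_isOpen hΩ hz).hasFDerivAt).fderiv

/-- The second derivative of a control system with respect to the control. -/
noncomputable def secondDeriv (F : Plane × ℝ → Plane) : Plane × ℝ → Plane :=
  fun z => fderiv ℝ (fun z => fderiv ℝ F z (0, 1)) z (0, 1)

theorem deriv_velocity_clm {Ω : Set (Plane × ℝ)} {W : Type*} [NormedAddCommGroup W]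
    [NormedSpace ℝ W] {F : Plane × ℝ → Plane} (hΩ : IsOpen Ω) (hF : ContDiffOn ℝ ∞ F Ω)
    (hz : z ∈ Ω) (L : Plane →L[ℝ] W) :
    deriv (fun s => L (F (z.1, s))) z.2 = L (fderiv ℝ F z (0, 1)) := by
  rw [deriv_partial_snd (F := fun z => L (F z)) hΩ (L.contDiff.comp_contDiffOn hF) hz,
    fderiv_velocity_clm_vert hΩ hF hz]

theorem deriv_deriv_velocity_clm {Ω : Set (Plane × ℝ)} {W : Type*} [NormedAddCommGroup W]
    [NormedSpace ℝ W] {F : Plane × ℝ → Plane} (hΩ : IsOpen Ω) (hF : ContDiffOn ℝ ∞ F Ω)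
    (hz : z ∈ Ω) (L : Plane →L[ℝ] W) :
    deriv (deriv (fun s => L (F (z.1, s)))) z.2 = L (secondDeriv F z) := by
  rw [deriv_deriv_partial_snd (F := fun z => L (F z)) hΩ (L.contDiff.comp_contDiffOn hF) hz,
    (Filter.eventuallyEq_of_mem (hΩ.mem_nhds hz) fun y hy =>
      fderiv_velocity_clm_vert hΩ hF hy L).fderiv_eq]
  exact fderiv_velocity_clm_vert hΩ (hF.lieD hΩ (X := fun _ => (0, 1)) contDiffOn_const) hz L

theorem deriv_deriv_nonpos_of_isLocalMax {μ : ℝ → ℝ} {s : ℝ} (hc : ContinuousAt μ s)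
    (h : IsLocalMax μ s) : deriv (deriv μ) s ≤ 0 := by
  by_contra! hpos
  have hmin := isLocalMin_of_deriv_deriv_pos hpos h.deriv_eq_zero hc
  have hconst : μ =ᶠ[nhds s] fun _ => μ s := by
    filter_upwards [h, hmin] with t h1 h2 using le_antisymm h1 h2
  have h1 : deriv μ =ᶠ[nhds s] fun _ => 0 := by
    filter_upwards [hconst.eventually_nhds] with t ht
    have : μ =ᶠ[nhds t] fun _ => μ s := ht
    rw [this.deriv_eq, deriv_const]
  rw [h1.deriv_eq, deriv_const] at hpos
  exact lt_irrefl _ hpos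

/-- The function whose sign is that of the second derivative of the velocity curve, relative to the
side of its tangent line on which the origin lies. -/
noncomputable def convexitySign (F : Plane × ℝ → Plane) (z : Plane × ℝ) : ℝ :=
  (detForm (fderiv ℝ F z (0, 1)) (F z))⁻¹ * detForm (fderiv ℝ F z (0, 1)) (secondDeriv F z)

/-- The points of `M × U` where the Hamiltonian of some covector has the local maximum `ε`. -/
def extremalSet (f : (q : M) → U → TangentSpace surfaceModel q) (ε : ℝ) : Set (M × U) :=
  {p | ∃ l : Plane →L[ℝ] ℝ, l (f p.1 p.2) = ε ∧ IsLocalMax (fun w => l (f p.1 w)) p.2}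

omit [IsManifold surfaceModel ∞ M] [IsManifold curveModel ∞ U] in
theorem isLocalMax_coord_iff (hφ : IsSmoothChart surfaceModel φ) (hχ : IsSmoothChart curveModel χ)
    (hz : z ∈ (φ.prod χ).target) (l : Plane →L[ℝ] ℝ) :
    IsLocalMax (fun w : U => l (f (φ.symm z.1) w)) (χ.symm z.2) ↔
      IsLocalMax (fun s => l ((mfderiv 𝓘(ℝ, Plane) surfaceModel φ.symm z.1 : Plane →L[ℝ] Plane)
        (coordSystem φ χ f (z.1, s)))) z.2 := by
  have h1 : ∀ s, l ((mfderiv 𝓘(ℝ, Plane) surfaceModel φ.symm z.1 : Plane →L[ℝ] Plane)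
      (coordSystem φ χ f (z.1, s))) = l (f (φ.symm z.1) (χ.symm s)) := fun s =>
    congrArg l (velocity_eq hφ hz.1 s).symm
  simp only [h1]
  constructor
  · intro h
    exact h.comp_continuous (hχ.contMDiffAt_symm hz.2).continuousAt
  · intro h
    have hs := χ.map_target hz.2
    rw [← χ.right_inv hz.2] at h
    have h2 := h.comp_continuous (hχ.contMDiffAt hs).continuousAt
    refine h2.congr ?_
    filter_upwards [χ.open_source.mem_nhds hs] with w hw
    simp [χ.left_inv hw]

omit [IsManifold surfaceModel ∞ M] [IsManifold curveModel ∞ U] in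
/-- The second convexity condition in terms of the preferred coordinate of `U`. -/
theorem regular_secondDeriv (hconv : IsStronglyConvex f) (hφ : IsSmoothChart surfaceModel φ)
    {q : M} {u : U} (hF : ContDiffOn ℝ ∞ (coordSystem φ (chartAt ℝ u) f)
      (φ.prod (chartAt ℝ u)).target) (hq : q ∈ φ.source) :
    detForm (fderiv ℝ (coordSystem φ (chartAt ℝ u) f) (φ.prod (chartAt ℝ u) (q, u)) (0, 1))
      (secondDeriv (coordSystem φ (chartAt ℝ u) f) (φ.prod (chartAt ℝ u) (q, u))) ≠ 0 := by
  set χ := chartAt ℝ u with hχ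
  have hu : u ∈ χ.source := mem_chart_source ℝ u
  have hΩ := (φ.prod χ).open_target
  have hz : φ.prod χ (q, u) ∈ (φ.prod χ).target := (φ.prod χ).map_source ⟨hq, hu⟩
  set F := coordSystem φ χ f with hFdef
  obtain ⟨L, hL⟩ : ∃ L : Plane →L[ℝ] Plane, L = mfderiv 𝓘(ℝ, Plane) surfaceModel φ.symm (φ q) :=
    ⟨_, rfl⟩
  have hind : indicatrix f q u = fun t => (fun s => L (F (φ q, s))) (χ u + t) := by
    funext t
    have h1 := velocity_eq (f := f) (χ := χ) hφ (φ.map_source hq) (χ u + t)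
    rw [φ.left_inv hq] at h1
    have h2 : indicatrix f q u t = velocity f q (χ.symm (χ u + t)) := by
      simp [indicatrix, velocity, hχ]
      rfl
    rw [h2, h1, hL]
    rfl
  have hd1 : deriv (indicatrix f q u) 0 = L (fderiv ℝ F (φ.prod χ (q, u)) (0, 1)) := by
    rw [hind, deriv_comp_const_add (f := fun s => L (F (φ q, s))), add_zero]
    exact deriv_velocity_clm hΩ hF hz L
  have hd2 : iteratedDeriv 2 (indicatrix f q u) 0 = L (secondDeriv F (φ.prod χ (q, u))) := by
    have h2 : deriv (indicatrix f q u) = fun t => deriv (fun s => L (F (φ q, s))) (χ u + t) := by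
      funext t
      rw [hind, deriv_comp_const_add (f := fun s => L (F (φ q, s)))]
    rw [iteratedDeriv_succ, iteratedDeriv_one, h2,
      deriv_comp_const_add (f := deriv fun s => L (F (φ q, s))), add_zero]
    exact deriv_deriv_velocity_clm hΩ hF hz L
  have h3 := (hconv q u).2
  rw [hd1, hd2] at h3
  have h4 : LinearIndependent ℝ (L ∘ ![fderiv ℝ F (φ.prod χ (q, u)) (0, 1),
      secondDeriv F (φ.prod χ (q, u))]) := by
    convert h3 using 1
    funext i; fin_cases i <;> rfl
  have h5 := (linearIndependent_pair_iff_detForm _ _).1 (LinearIndependent.of_comp L.toLinearMap h4)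
  intro h6
  apply h5
  rw [detForm_apply] at h6 ⊢
  linarith

section Sign

variable (hf : IsSmoothSystem f) (hconv : IsStronglyConvex f)
  (hφ : IsSmoothChart surfaceModel φ) (hχ : IsSmoothChart curveModel χ)

include hf hconv hφ hχ

/-- The second derivative test: the covector that has the value `ε` on the velocity and annihilates
its derivative is a local maximum. -/
theorem mem_extremalSet {ε : ℝ} (hz : z ∈ (φ.prod χ).target)
    (h : ε * convexitySign (coordSystem φ χ f) z < 0) :
    (φ.prod χ).symm z ∈ extremalSet f ε := by
  have hΩ := (φ.prod χ).open_target
  set F := coordSystem φ χ f with hFdef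
  have hF : ContDiffOn ℝ ∞ F (φ.prod χ).target := hf.contDiffOn_coordSystem hφ hχ
  have hreg := hconv.regular hφ hχ (hF.differentiableAt_of_isOpen hΩ hz) hz
  obtain ⟨L, hL⟩ : ∃ L : Plane →L[ℝ] Plane, L = mfderiv 𝓘(ℝ, Plane) surfaceModel φ.symm z.1 :=
    ⟨_, rfl⟩
  obtain ⟨L', hL'⟩ : ∃ L' : Plane →L[ℝ] Plane,
      L' = mfderiv surfaceModel 𝓘(ℝ, Plane) φ (φ.symm z.1) := ⟨_, rfl⟩
  have hLL : L'.comp L = .id ℝ Plane := by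
    ext1 y; rw [hL, hL']; exact hφ.mfderiv_mfderiv_symm hz.1 y
  set l : Plane →L[ℝ] ℝ := (ε * (detForm (fderiv ℝ F z (0, 1)) (F z))⁻¹) •
    detForm (fderiv ℝ F z (0, 1)) with hl
  refine ⟨l.comp L', ?_, ?_⟩
  · have h1 : l (F z) = ε := by
      rw [← hFdef] at hreg
      simp [hl, mul_assoc, inv_mul_cancel₀ hreg]
    rw [← h1, hL']
    rfl
  · refine (isLocalMax_coord_iff hφ hχ hz (l.comp L')).2 ?_
    have h1 : (fun s => (l.comp L')
        ((mfderiv 𝓘(ℝ, Plane) surfaceModel φ.symm z.1 : Plane →L[ℝ] Plane) (F (z.1, s)))) =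
        fun s => l (F (z.1, s)) := by
      funext s
      rw [← hL]
      exact congrArg l (congrArg (fun A : Plane →L[ℝ] Plane => A (F (z.1, s))) hLL)
    rw [h1]
    refine isLocalMax_of_deriv_deriv_neg ?_ ?_ ?_
    · rw [deriv_deriv_velocity_clm hΩ hF hz]
      convert h using 1
      simp [hl, convexitySign]
      ring
    · rw [deriv_velocity_clm hΩ hF hz]
      simp [hl, detForm_self]
    · exact ContinuousAt.comp (f := fun s => (z.1, s)) (g := fun z => l (F z))
        (l.continuous.continuousAt.comp (hF.continuousOn.continuousAt (hΩ.mem_nhds hz)))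
        (continuousAt_const.prodMk continuousAt_id)

omit [IsManifold curveModel ∞ U] hconv in
theorem extremal_deriv {l : Plane →L[ℝ] ℝ} (hz : z ∈ (φ.prod χ).target)
    (h : IsLocalMax (fun w : U => l (f (φ.symm z.1) w)) (χ.symm z.2)) :
    l ((mfderiv 𝓘(ℝ, Plane) surfaceModel φ.symm z.1 : Plane →L[ℝ] Plane)
      (fderiv ℝ (coordSystem φ χ f) z (0, 1))) = 0 ∧
    l ((mfderiv 𝓘(ℝ, Plane) surfaceModel φ.symm z.1 : Plane →L[ℝ] Plane)
      (secondDeriv (coordSystem φ χ f) z)) ≤ 0 := by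
  have hΩ := (φ.prod χ).open_target
  set F := coordSystem φ χ f with hFdef
  have hF : ContDiffOn ℝ ∞ F (φ.prod χ).target := hf.contDiffOn_coordSystem hφ hχ
  obtain ⟨L, hL⟩ : ∃ L : Plane →L[ℝ] Plane, L = mfderiv 𝓘(ℝ, Plane) surfaceModel φ.symm z.1 :=
    ⟨_, rfl⟩
  have h1 := (isLocalMax_coord_iff hφ hχ hz l).1 h
  rw [← hL] at h1 ⊢
  constructor
  · exact (deriv_velocity_clm hΩ hF hz (l.comp L)).symm.trans h1.deriv_eq_zero
  · refine (deriv_deriv_velocity_clm hΩ hF hz (l.comp L)).symm.le.trans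
      (deriv_deriv_nonpos_of_isLocalMax ?_ h1)
    exact ContinuousAt.comp (f := fun s => (z.1, s)) (g := fun z => l (L (F z)))
      ((l.comp L).continuous.continuousAt.comp (hF.continuousOn.continuousAt (hΩ.mem_nhds hz)))
      (continuousAt_const.prodMk continuousAt_id)

theorem convexitySign_nonpos {ε : ℝ} (hz : z ∈ (φ.prod χ).target)
    (h : (φ.prod χ).symm z ∈ extremalSet f ε) :
    ε * convexitySign (coordSystem φ χ f) z ≤ 0 := by
  have hΩ := (φ.prod χ).open_target
  have hF := hf.contDiffOn_coordSystem hφ hχ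
  obtain ⟨l, hl, hmax⟩ := h
  obtain ⟨h1, h2⟩ := extremal_deriv hf hφ hχ hz hmax
  obtain ⟨L, hL⟩ : ∃ L : Plane →L[ℝ] Plane, L = mfderiv 𝓘(ℝ, Plane) surfaceModel φ.symm z.1 :=
    ⟨_, rfl⟩
  rw [← hL] at h1 h2
  have h3 : (l.comp L) (coordSystem φ χ f z) = ε := by
    rw [← hl, hL]
    exact congrArg l (velocity_eq hφ hz.1 z.2).symm
  have h4 := eq_smul_detForm (η := fun _ => l.comp L)
    (hconv.regular hφ hχ (hF.differentiableAt_of_isOpen hΩ hz) hz) h3 h1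
  have h5 : (l.comp L) (secondDeriv (coordSystem φ χ f) z) ≤ 0 := h2
  simp only [h4] at h5
  convert h5 using 1
  simp [convexitySign]
  ring

end Sign

/-- The local maximum can be normalized to the same value `ε = ± 1` everywhere: the points where the
value `1` can be attained and those where the value `-1` can be attained form two disjoint open sets
that cover the connected manifold `M × U`. -/
theorem exists_extremalSet_eq_univ [ConnectedSpace M] [ConnectedSpace U] (hf : IsSmoothSystem f)
    (hconv : IsStronglyConvex f) :
    ∃ ε : ℝ, (ε = 1 ∨ ε = -1) ∧ ∀ p, p ∈ extremalSet f ε := by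
  have hch : ∀ p : M × U, ∃ (φ : OpenPartialHomeomorph M Plane) (χ : OpenPartialHomeomorph U ℝ),
      IsSmoothChart surfaceModel φ ∧ IsSmoothChart curveModel χ ∧ p ∈ (φ.prod χ).source ∧
      convexitySign (coordSystem φ χ f) (φ.prod χ p) ≠ 0 := by
    rintro ⟨q, u⟩
    have hφ : IsSmoothChart surfaceModel (chartAt Plane q) :=
      isSmoothChart_chartAt_plane q
    have hχ := isSmoothChart_chartAt u
    have hp : (q, u) ∈ ((chartAt Plane q).prod (chartAt ℝ u)).source :=
      ⟨mem_chart_source Plane q, mem_chart_source ℝ u⟩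
    have hF := hf.contDiffOn_coordSystem hφ hχ
    have hz := ((chartAt Plane q).prod (chartAt ℝ u)).map_source hp
    refine ⟨_, _, hφ, hχ, hp, mul_ne_zero (inv_ne_zero (hconv.regular hφ hχ
      (hF.differentiableAt_of_isOpen (OpenPartialHomeomorph.open_target _) hz) hz)) ?_⟩
    exact regular_secondDeriv hconv hφ hF hp.1
  have hopen : ∀ ε : ℝ, ε ≠ 0 → IsOpen (extremalSet f ε) := by
    refine fun ε hε => isOpen_iff_eventually.2 fun p hp => ?_
    obtain ⟨φ, χ, hφ, hχ, hps, hne⟩ := hch p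
    have hz := (φ.prod χ).map_source hps
    have hΩ := (φ.prod χ).open_target
    have hF := hf.contDiffOn_coordSystem hφ hχ
    have h1 := convexitySign_nonpos hf hconv hφ hχ hz (by rwa [(φ.prod χ).left_inv hps])
    have h2 := h1.lt_of_ne (mul_ne_zero hε hne)
    have sF : ContDiffOn ℝ ∞ (fun z => fderiv ℝ (coordSystem φ χ f) z (0, 1))
      (φ.prod χ).target := hF.lieD hΩ (X := fun _ => (0, 1)) contDiffOn_const
    have sF2 : ContDiffOn ℝ ∞ (secondDeriv (coordSystem φ χ f)) (φ.prod χ).target :=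
      sF.lieD hΩ (X := fun _ => (0, 1)) contDiffOn_const
    have sd := contDiff_detForm.comp_contDiffOn sF
    have h3 : ContDiffOn ℝ ∞ (convexitySign (coordSystem φ χ f)) (φ.prod χ).target :=
      ((sd.clm_apply hF).inv fun z hz => hconv.regular hφ hχ
        (hF.differentiableAt_of_isOpen hΩ hz) hz).mul (sd.clm_apply sF2)
    have h4 : ContinuousAt (fun p => ε * convexitySign (coordSystem φ χ f) (φ.prod χ p)) p :=
      continuousAt_const.mul (ContinuousAt.comp (h3.continuousOn.continuousAt (hΩ.mem_nhds hz))
        ((φ.prod χ).continuousAt hps))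
    filter_upwards [h4.eventually_lt_const h2, (φ.prod χ).open_source.mem_nhds hps] with p' hp' hs'
    have h5 := mem_extremalSet hf hconv hφ hχ ((φ.prod χ).map_source hs') hp'
    rwa [(φ.prod χ).left_inv hs'] at h5
  have hcover : ∀ p, p ∈ extremalSet f 1 ∨ p ∈ extremalSet f (-1) := by
    intro p
    obtain ⟨φ, χ, hφ, hχ, hps, hne⟩ := hch p
    have hz := (φ.prod χ).map_source hps
    rcases hne.lt_or_gt with h | h
    · left
      have := mem_extremalSet hf hconv hφ hχ (ε := 1) hz (by linarith)
      rwa [(φ.prod χ).left_inv hps] at this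
    · right
      have := mem_extremalSet hf hconv hφ hχ (ε := -1) hz (by linarith)
      rwa [(φ.prod χ).left_inv hps] at this
  have hdisj : ∀ p, ¬ (p ∈ extremalSet f 1 ∧ p ∈ extremalSet f (-1)) := by
    rintro p ⟨h1, h2⟩
    obtain ⟨φ, χ, hφ, hχ, hps, hne⟩ := hch p
    have hz := (φ.prod χ).map_source hps
    have h3 := convexitySign_nonpos hf hconv hφ hχ hz
      (show _ ∈ extremalSet f 1 by rwa [(φ.prod χ).left_inv hps])
    have h4 := convexitySign_nonpos hf hconv hφ hχ hz
      (show _ ∈ extremalSet f (-1) by rwa [(φ.prod χ).left_inv hps])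
    exact hne (by linarith)
  have hclopen : IsClopen (extremalSet f 1) := by
    refine ⟨⟨?_⟩, hopen 1 one_ne_zero⟩
    have : (extremalSet f 1)ᶜ = extremalSet f (-1) := by
      ext p
      exact ⟨fun h => (hcover p).resolve_left h, fun h h' => hdisj p ⟨h', h⟩⟩
    rw [this]
    exact hopen (-1) (by norm_num)
  rcases isClopen_iff.1 hclopen with h | h
  · refine ⟨-1, .inr rfl, fun p => (hcover p).resolve_left ?_⟩
    rw [h]
    exact Set.notMem_empty p
  · exact ⟨1, .inl rfl, fun p => by rw [h]; trivial⟩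

end Existence

/-! ### Solving the laws of the feedback invariants in local coordinates -/

section LocalExistence

/-- A family `η` of covectors with `η(F) = ε` and `η(∂F/∂s) = 0`, on an open set `Ω` of the
coordinate space `ℝ² × ℝ`, such that `⟨∂η/∂s, ∂F/∂s⟩` is positive. -/
structure LocalCovector (Ω : Set (Plane × ℝ)) (ε : ℝ) (F : Plane × ℝ → Plane)
    (η : Plane × ℝ → Plane →L[ℝ] ℝ) : Prop where
  isOpen : IsOpen Ω
  contDiffOn_F : ContDiffOn ℝ ∞ F Ω
  regular : ∀ z ∈ Ω, detForm (fderiv ℝ F z (0, 1)) (F z) ≠ 0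
  ε_mul_self : ε * ε = 1
  η_F : ∀ z ∈ Ω, η z (F z) = ε
  η_deriv : ∀ z ∈ Ω, η z (fderiv ℝ F z (0, 1)) = 0
  pos : ∀ z ∈ Ω, 0 < fderiv ℝ η z (0, 1) (fderiv ℝ F z (0, 1))

namespace LocalCovector

variable {Ω : Set (Plane × ℝ)} {ε : ℝ} {F : Plane × ℝ → Plane}
  {η : Plane × ℝ → Plane →L[ℝ] ℝ} (D : LocalCovector Ω ε F η) {z : Plane × ℝ}

include D

theorem contDiffOn_η : ContDiffOn ℝ ∞ η Ω :=
  contDiffOn_covector D.isOpen D.contDiffOn_F D.regular D.η_F D.η_deriv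

theorem fderiv_η_F (hz : z ∈ Ω) (w : Plane × ℝ) :
    fderiv ℝ η z w (F z) = -η z (fderiv ℝ F z w) := by
  have h := lieD_clm_apply (X := fun _ => w) (D.contDiffOn_η.differentiableAt_of_isOpen D.isOpen hz)
    (D.contDiffOn_F.differentiableAt_of_isOpen D.isOpen hz)
  rw [lieD_const D.isOpen D.η_F hz, lieD, lieD] at h
  linarith

/-- Hamilton's equations determine the vertical component of the Hamiltonian field. -/
theorem exists_hamilton (hz : z ∈ Ω) :
    ∃ c : ℝ, ∀ y, fderiv ℝ η z (F z, c) y = -η z (fderiv ℝ F z (y, 0)) := by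
  set N := fderiv ℝ F z (0, 1) with hN
  have hpos := (D.pos z hz).ne'
  refine ⟨(-η z (fderiv ℝ F z (N, 0)) - fderiv ℝ η z (F z, 0) N) / fderiv ℝ η z (0, 1) N, ?_⟩
  set c := (-η z (fderiv ℝ F z (N, 0)) - fderiv ℝ η z (F z, 0) N) / fderiv ℝ η z (0, 1) N with hc
  have hinl : ∀ y : Plane, -η z (fderiv ℝ F z (y, 0)) =
      (-(η z).comp ((fderiv ℝ F z).comp (ContinuousLinearMap.inl ℝ Plane ℝ))) y := fun y => by
    simp
  have key : fderiv ℝ η z (F z, c) =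
      -(η z).comp ((fderiv ℝ F z).comp (ContinuousLinearMap.inl ℝ Plane ℝ)) := by
    refine clm_ext_of_detForm_ne_zero (D.regular z hz) ?_ ?_
    · rw [← hinl, D.fderiv_η_F hz, fderiv_split, map_add, map_smul, D.η_deriv z hz]
      simp
    · rw [← hinl, fderiv_split]
      simp only [add_apply, smul_apply, smul_eq_mul]
      rw [← hN, hc, div_mul_cancel₀ _ hpos]
      ring
  intro y
  rw [key, hinl]

/-- The equation of the centro-affine curvature, for a vertical field with the natural
normalization. -/
theorem exists_natural {a : Plane × ℝ → ℝ} (ha : ContDiffOn ℝ ∞ a Ω)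
    (hnorm : ∀ z ∈ Ω, a z * a z * fderiv ℝ η z (0, 1) (fderiv ℝ F z (0, 1)) = 1) (hz : z ∈ Ω) :
    ∃ b : ℝ, lieD (vertField a) (lieD (vertField a) η) z =
      -ε • η z + b • lieD (vertField a) η z := by
  have hΩ := D.isOpen
  have sV : ContDiffOn ℝ ∞ (vertField a) Ω := contDiffOn_const.prodMk ha
  have sη := D.contDiffOn_η
  have sVη : ContDiffOn ℝ ∞ (lieD (vertField a) η) Ω := sη.lieD hΩ sV
  have hVηF : ∀ y ∈ Ω, lieD (vertField a) η y (F y) = 0 := fun y hy => by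
    rw [lieD, D.fderiv_η_F hy, vertField, fderiv_vert, map_smul, D.η_deriv y hy, smul_zero,
      neg_zero]
  have hVηN : ∀ y ∈ Ω, lieD (vertField a) η y (lieD (vertField a) F y) = 1 := fun y hy => by
    rw [lieD_vertField, lieD_vertField, smul_apply, map_smul, smul_eq_mul, smul_eq_mul, ← mul_assoc,
      hnorm y hy]
  have hη : η z (lieD (vertField a) F z) = 0 := by
    rw [lieD_vertField, map_smul, D.η_deriv z hz, smul_zero]
  have hreg : detForm (lieD (vertField a) F z) (F z) ≠ 0 := by
    rw [lieD_vertField, detForm_smul_left]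
    refine mul_ne_zero (fun h => ?_) (D.regular z hz)
    have := hnorm z hz
    simp [h] at this
  refine ⟨lieD (vertField a) (lieD (vertField a) η) z (lieD (vertField a) F z),
    clm_ext_of_detForm_ne_zero hreg ?_ ?_⟩
  · have h := lieD_clm_apply (X := vertField a) (sVη.differentiableAt_of_isOpen hΩ hz)
      (D.contDiffOn_F.differentiableAt_of_isOpen hΩ hz)
    rw [lieD_const hΩ hVηF hz, hVηN z hz] at h
    simp only [add_apply, smul_apply, smul_eq_mul, hVηF z hz, D.η_F z hz]
    have := D.ε_mul_self
    linarith
  · simp [hη, hVηN z hz]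

end LocalCovector

end LocalExistence

section Existence

variable {M : Type*} [TopologicalSpace M] [ChartedSpace Plane M] [IsManifold surfaceModel ∞ M]
  {U : Type*} [TopologicalSpace U] [ChartedSpace ℝ U] [IsManifold curveModel ∞ U]
  {φ : OpenPartialHomeomorph M Plane} {χ : OpenPartialHomeomorph U ℝ}
  {f : (q : M) → U → TangentSpace surfaceModel q} {z : Plane × ℝ}
  (hf : IsSmoothSystem f) (hconv : IsStronglyConvex f) {ε : ℝ} (hε : ε = 1 ∨ ε = -1)
  {cov : M × U → (Plane →L[ℝ] ℝ)} (hcov : ∀ p : M × U, cov p (f p.1 p.2) = ε)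
  (hmax : ∀ p : M × U, IsLocalMax (fun w : U => cov p (f p.1 w)) p.2)

/-- The vertical field on `M × U` with component `a p` in the preferred coordinate of `U` at `p`; as
that coordinate depends on `p`, the field need not be continuous when `a` is. -/
def vertLift (a : M × U → ℝ) (p : M × U) : TangentSpace prodModel p := ((0 : Plane), a p)

/-- The number `⟨∂cov/∂u, ∂f/∂u⟩` in the preferred coordinate of `U`. It is a quadratic form on the
fibres, and the natural vertical fields are its unit vectors. -/
noncomputable def fiberMetric (f : (q : M) → U → TangentSpace surfaceModel q)
    (cov : M × U → (Plane →L[ℝ] ℝ)) (p : M × U) : ℝ :=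
  lieDerivForm (vertLift fun _ => 1) cov p
    (mfderiv curveModel 𝓘(ℝ, Plane) (velocity f p.1) p.2 (1 : ℝ) : Plane)

omit [IsManifold surfaceModel ∞ M] [IsManifold curveModel ∞ U] in
theorem coordSnd_vertical (hφ : IsSmoothChart surfaceModel φ) (hχ : IsSmoothChart curveModel χ)
    (hz : z ∈ (φ.prod χ).target) (a : M × U → ℝ) :
    coordSnd φ χ (vertLift a) z =
      a (φ.symm z.1, χ.symm z.2) * coordRate χ (χ.symm z.2) (1 : ℝ) := by
  rw [coordSnd, hφ.coordField_prod hχ hz]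
  have h : ∀ (L : ℝ →L[ℝ] ℝ) (t : ℝ), L t = t * L 1 := fun L t => by
    rw [← smul_eq_mul, ← map_smul, smul_eq_mul, mul_one]
  exact h _ _

omit [IsManifold curveModel ∞ U] in
theorem coordRate_one_ne_zero (hχ : IsSmoothChart curveModel χ) {u : U} (hu : u ∈ χ.source) :
    coordRate χ u (1 : ℝ) ≠ 0 := fun h => by
  have h1 := hχ.mfderiv_symm_mfderiv hu (1 : ℝ)
  exact one_ne_zero (α := ℝ) (h1.symm.trans
    ((congrArg (mfderiv 𝓘(ℝ, ℝ) curveModel χ.symm (χ u)) h).trans (map_zero _)))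

include hf hconv hcov hmax in
omit [IsManifold curveModel ∞ U] in
theorem contDiffOn_coordCovector [IsManifold curveModel ∞ U] (hφ : IsSmoothChart surfaceModel φ)
    (hχ : IsSmoothChart curveModel χ) :
    ContDiffOn ℝ ∞ (coordCovector φ χ cov) (φ.prod χ).target := by
  have hΩ := (φ.prod χ).open_target
  have hF := hf.contDiffOn_coordSystem hφ hχ
  exact contDiffOn_covector hΩ hF
    (fun z hz => hconv.regular hφ hχ (hF.differentiableAt_of_isOpen hΩ hz) hz)
    (fun z hz => (coordCovector_coordSystem hφ hz.1 cov).trans (hcov _))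
    (fun z hz => coordCovector_deriv hφ hχ (hF.differentiableAt_of_isOpen hΩ hz) hz (hmax _))

include hf hconv hcov hmax in
theorem fiberMetric_eq (hφ : IsSmoothChart surfaceModel φ) (hχ : IsSmoothChart curveModel χ)
    (hz : z ∈ (φ.prod χ).target) : fiberMetric f cov ((φ.prod χ).symm z) =
      coordRate χ (χ.symm z.2) (1 : ℝ) * coordRate χ (χ.symm z.2) (1 : ℝ) *
      fderiv ℝ (coordCovector φ χ cov) z (0, 1) (fderiv ℝ (coordSystem φ χ f) z (0, 1)) := by
  have hΩ := (φ.prod χ).open_target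
  have hF := (hf.contDiffOn_coordSystem hφ hχ).differentiableAt_of_isOpen hΩ hz
  have hη := (contDiffOn_coordCovector hf hconv hcov hmax hφ hχ).differentiableAt_of_isOpen hΩ hz
  set k := coordRate χ (χ.symm z.2) (1 : ℝ) with hk
  have h1 : coordCovector φ χ (lieDerivForm (vertLift fun _ => 1) cov) z =
      k • fderiv ℝ (coordCovector φ χ cov) z (0, 1) := by
    rw [coordCovector_lieDerivForm hφ hχ hη hz, lieD_vertField]
    congr 1
    exact (coordSnd_vertical hφ hχ hz fun _ => 1).trans (one_mul _)
  have h2 := mfderiv_coordSystem hφ hχ hF hz (1 : ℝ)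
  have h3 : fderiv ℝ (coordSystem φ χ f) z (0, k) = k • fderiv ℝ (coordSystem φ χ f) z (0, 1) :=
    fderiv_vert _ _ _
  have h4 := congrArg (lieDerivForm (vertLift fun _ => 1) cov (φ.symm z.1, χ.symm z.2)) h2
  refine h4.trans ?_
  change coordCovector φ χ (lieDerivForm (vertLift fun _ => 1) cov) z
    (fderiv ℝ (coordSystem φ χ f) z (0, k)) = _
  rw [h1, h3, map_smul]
  simp
  ring

include hf hconv hε hcov hmax in
/-- The maximizing covectors in charts of `M` and `U`. Strong convexity makes the maxima
nondegenerate, which is the positivity in `LocalCovector`. -/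
theorem localCovector (hφ : IsSmoothChart surfaceModel φ) (hχ : IsSmoothChart curveModel χ) :
    LocalCovector (φ.prod χ).target ε (coordSystem φ χ f) (coordCovector φ χ cov) := by
  -- In any coordinates the derivative in question is nonnegative, because `cov` is maximal.
  have hnonneg : ∀ (φ : OpenPartialHomeomorph M Plane) (χ : OpenPartialHomeomorph U ℝ),
      IsSmoothChart surfaceModel φ → IsSmoothChart curveModel χ → ∀ z ∈ (φ.prod χ).target,
      fderiv ℝ (coordCovector φ χ cov) z (0, 1) (fderiv ℝ (coordSystem φ χ f) z (0, 1)) =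
        -coordCovector φ χ cov z (secondDeriv (coordSystem φ χ f) z) ∧
      0 ≤ fderiv ℝ (coordCovector φ χ cov) z (0, 1) (fderiv ℝ (coordSystem φ χ f) z (0, 1)) := by
    intro φ χ hφ hχ z hz
    have hΩ := (φ.prod χ).open_target
    have sF := hf.contDiffOn_coordSystem hφ hχ
    have sF' : ContDiffOn ℝ ∞ (fun z => fderiv ℝ (coordSystem φ χ f) z (0, 1))
      (φ.prod χ).target := sF.lieD hΩ (X := fun _ => (0, 1)) contDiffOn_const
    have sη := contDiffOn_coordCovector hf hconv hcov hmax hφ hχ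
    have h1 := lieD_clm_apply (X := fun _ => ((0 : Plane), (1 : ℝ)))
      (sη.differentiableAt_of_isOpen hΩ hz) (sF'.differentiableAt_of_isOpen hΩ hz)
    rw [lieD_const hΩ (k := 0) (fun y hy => coordCovector_deriv hφ hχ
      (sF.differentiableAt_of_isOpen hΩ hy) hy (hmax _)) hz, lieD, lieD] at h1
    have h2 : coordCovector φ χ cov z (secondDeriv (coordSystem φ χ f) z) ≤ 0 :=
      (extremal_deriv hf hφ hχ hz (hmax (φ.symm z.1, χ.symm z.2))).2
    have h3 : fderiv ℝ (coordCovector φ χ cov) z (0, 1)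
        (fderiv ℝ (coordSystem φ χ f) z (0, 1)) =
        -coordCovector φ χ cov z (secondDeriv (coordSystem φ χ f) z) := by
      rw [secondDeriv]
      linarith
    exact ⟨h3, by rw [h3]; linarith⟩
  -- It is nonzero in the preferred coordinates, and therefore in all coordinates.
  have hpos : ∀ p, 0 < fiberMetric f cov p := by
    rintro ⟨q, u⟩
    have hφ : IsSmoothChart surfaceModel (chartAt Plane q) :=
      isSmoothChart_chartAt_plane q
    have hχ := isSmoothChart_chartAt u
    set φ := chartAt Plane q
    set χ := chartAt ℝ u with hχdef
    have hp : (q, u) ∈ (φ.prod χ).source := ⟨mem_chart_source Plane q, mem_chart_source ℝ u⟩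
    have hz := (φ.prod χ).map_source hp
    have hΩ := (φ.prod χ).open_target
    have sF := hf.contDiffOn_coordSystem hφ hχ
    have h1 := hnonneg φ χ hφ hχ _ hz
    have h2 := fiberMetric_eq hf hconv hcov hmax hφ hχ hz
    rw [(φ.prod χ).left_inv hp] at h2
    have h3 := coordRate_one_ne_zero hχ (χ.map_target hz.2)
    have h4 := hconv.regular hφ hχ (sF.differentiableAt_of_isOpen hΩ hz) hz
    have h5 := eq_smul_detForm (η := coordCovector φ χ cov) h4
      ((coordCovector_coordSystem hφ hz.1 cov).trans (hcov _))
      (coordCovector_deriv hφ hχ (sF.differentiableAt_of_isOpen hΩ hz) hz (hmax _))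
    have h6 := regular_secondDeriv hconv hφ sF hp.1
    have h7 : coordCovector φ χ cov (φ.prod χ (q, u))
        (secondDeriv (coordSystem φ χ f) (φ.prod χ (q, u))) ≠ 0 := by
      rw [h5]
      refine mul_ne_zero (mul_ne_zero ?_ (inv_ne_zero h4)) h6
      rcases hε with h | h <;> simp [h]
    rw [h2]
    refine mul_pos (mul_self_pos.2 h3) (h1.2.lt_of_ne ?_)
    rw [h1.1]
    exact (neg_ne_zero.2 h7).symm
  have hΩ := (φ.prod χ).open_target
  have sF := hf.contDiffOn_coordSystem hφ hχ
  refine ⟨hΩ, sF, fun z hz => hconv.regular hφ hχ (sF.differentiableAt_of_isOpen hΩ hz) hz,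
    by rcases hε with h | h <;> simp [h],
    fun z hz => (coordCovector_coordSystem hφ hz.1 cov).trans (hcov _),
    fun z hz => coordCovector_deriv hφ hχ (sF.differentiableAt_of_isOpen hΩ hz) hz (hmax _),
    fun z hz => (hnonneg φ χ hφ hχ z hz).2.lt_of_ne fun h => ?_⟩
  have h1 := hpos ((φ.prod χ).symm z)
  rw [fiberMetric_eq hf hconv hcov hmax hφ hχ hz, ← h, mul_zero] at h1
  exact lt_irrefl _ h1

end Existence

/-! ### Existence of the feedback invariants -/

section Existence

variable {M : Type*} [TopologicalSpace M] [ChartedSpace Plane M] [IsManifold surfaceModel ∞ M]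
  {U : Type*} [TopologicalSpace U] [ChartedSpace ℝ U] [IsManifold curveModel ∞ U]
  {φ : OpenPartialHomeomorph M Plane} {χ : OpenPartialHomeomorph U ℝ}
  {f : (q : M) → U → TangentSpace surfaceModel q} {z : Plane × ℝ}

/-- For a fixed point `q` of the surface, the determinant of the velocity and of its derivative with
respect to the control. It is nowhere zero, so that its sign orients `U`. -/
noncomputable def orientation (f : (q : M) → U → TangentSpace surfaceModel q) (q : M) (u : U) : ℝ :=
  detForm (mfderiv curveModel 𝓘(ℝ, Plane) (fun u : U => chartVelocity (chartAt Plane q) f (q, u)) u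
    (1 : ℝ) : Plane) (chartVelocity (chartAt Plane q) f (q, u))

/-- The component of the natural vertical field in the preferred coordinates of `U`. Apart from the
orientation, which makes the field continuous, it is the inverse square root of `fiberMetric`. -/
noncomputable def naturalComponent (f : (q : M) → U → TangentSpace surfaceModel q)
    (cov : M × U → (Plane →L[ℝ] ℝ)) (q : M) (p : M × U) : ℝ :=
  orientation f q p.2 / √(orientation f q p.2 ^ 2 * fiberMetric f cov p)

omit [IsManifold curveModel ∞ U] in
theorem orientation_eq (hf : IsSmoothSystem f) (hχ : IsSmoothChart curveModel χ) (q : M) {s : ℝ}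
    (hs : s ∈ χ.target) : orientation f q (χ.symm s) = coordRate χ (χ.symm s) (1 : ℝ) *
      detForm (fderiv ℝ (coordSystem (chartAt Plane q) χ f) (chartAt Plane q q, s) (0, 1))
        (coordSystem (chartAt Plane q) χ f (chartAt Plane q q, s)) := by
  have hφ := isSmoothChart_chartAt_plane q
  set φ := chartAt Plane q
  have hq : q ∈ φ.source := mem_chart_source Plane q
  have hz : (φ q, s) ∈ (φ.prod χ).target := ⟨φ.map_source hq, hs⟩
  have hF := (hf.contDiffOn_coordSystem hφ hχ).differentiableAt_of_isOpen (φ.prod χ).open_target hz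
  have h1 : ∀ s, chartVelocity φ f (q, χ.symm s) = coordSystem φ χ f (φ q, s) := fun s => by
    rw [coordSystem, φ.left_inv hq]
    rfl
  have h2 := hχ.mfderiv_apply (fun u : U => chartVelocity φ f (q, u)) hs (1 : ℝ)
  simp only [h1] at h2
  have h3 : fderiv ℝ (fun s => coordSystem φ χ f (φ q, s)) s (coordRate χ (χ.symm s) (1 : ℝ)) =
      coordRate χ (χ.symm s) (1 : ℝ) • fderiv ℝ (coordSystem φ χ f) (φ q, s) (0, 1) := by
    rw [← fderiv_vert]
    exact fderiv_partial_snd hF _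
  have h4 : (mfderiv curveModel 𝓘(ℝ, Plane) (fun u : U => chartVelocity φ f (q, u)) (χ.symm s)
    (1 : ℝ) : Plane) = _ := h2.trans h3
  rw [orientation, h4, h1, detForm_smul_left]
  rfl

omit [IsManifold surfaceModel ∞ M] [IsManifold curveModel ∞ U] in
theorem coordField_natural (hφ : IsSmoothChart surfaceModel φ) (hχ : IsSmoothChart curveModel χ)
    {cov : M × U → (Plane →L[ℝ] ℝ)} (q : M)
    (hz : z ∈ (φ.prod χ).target) :
    coordField prodModel (φ.prod χ) (vertLift (naturalComponent f cov q)) z =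
      vertField (coordSnd φ χ (vertLift (naturalComponent f cov q))) z := by
  refine Prod.ext ?_ rfl
  rw [hφ.coordField_prod hχ hz]
  exact map_zero _

variable (hf : IsSmoothSystem f) (hconv : IsStronglyConvex f) {ε : ℝ} (hε : ε = 1 ∨ ε = -1)
  {cov : M × U → (Plane →L[ℝ] ℝ)} (hcov : ∀ p : M × U, cov p (f p.1 p.2) = ε)
  (hmax : ∀ p : M × U, IsLocalMax (fun w : U => cov p (f p.1 w)) p.2)

include hf hconv hε hcov hmax

/-- The natural vertical field is smooth and has the length one. The dependence of its definition on
the preferred coordinates of `U` cancels, because the orientation scales with the first power of a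
change of coordinates and the fibre metric with the second. -/
theorem coordSnd_natural (hφ : IsSmoothChart surfaceModel φ) (hχ : IsSmoothChart curveModel χ)
    (q : M) :
    ContDiffOn ℝ ∞ (coordSnd φ χ (vertLift (naturalComponent f cov q))) (φ.prod χ).target ∧
    ∀ z ∈ (φ.prod χ).target,
      coordSnd φ χ (vertLift (naturalComponent f cov q)) z *
        coordSnd φ χ (vertLift (naturalComponent f cov q)) z *
        fderiv ℝ (coordCovector φ χ cov) z (0, 1) (fderiv ℝ (coordSystem φ χ f) z (0, 1)) = 1 := by
  have L := localCovector hf hconv hε hcov hmax hφ hχ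
  have hΩ := L.isOpen
  have hφ₁ := isSmoothChart_chartAt_plane q
  set φ₁ := chartAt Plane q with hφ₁def
  have hq : q ∈ φ₁.source := mem_chart_source Plane q
  have L₁ := localCovector hf hconv hε hcov hmax hφ₁ hχ
  let δ : ℝ → ℝ := fun s => detForm (fderiv ℝ (coordSystem φ₁ χ f) (φ₁ q, s) (0, 1))
    (coordSystem φ₁ χ f (φ₁ q, s))
  let m : Plane × ℝ → ℝ := fun z =>
    fderiv ℝ (coordCovector φ χ cov) z (0, 1) (fderiv ℝ (coordSystem φ χ f) z (0, 1))
  have hδ : ∀ z ∈ (φ.prod χ).target, δ z.2 ≠ 0 := fun z hz =>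
    L₁.regular (φ₁ q, z.2) ⟨φ₁.map_source hq, hz.2⟩
  have hm : ∀ z ∈ (φ.prod χ).target, 0 < m z := L.pos
  have hpos : ∀ z ∈ (φ.prod χ).target, 0 < δ z.2 ^ 2 * m z := fun z hz =>
    mul_pos (sq_pos_of_ne_zero (hδ z hz)) (hm z hz)
  have heq : ∀ z ∈ (φ.prod χ).target, coordSnd φ χ (vertLift (naturalComponent f cov q)) z =
      δ z.2 / √(δ z.2 ^ 2 * m z) := by
    intro z hz
    set k := coordRate χ (χ.symm z.2) (1 : ℝ) with hk
    have hk0 : k ≠ 0 := coordRate_one_ne_zero hχ (χ.map_target hz.2)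
    have h1 : orientation f q (χ.symm z.2) = k * δ z.2 := orientation_eq hf hχ q hz.2
    have h2 : fiberMetric f cov (φ.symm z.1, χ.symm z.2) = k * k * m z :=
      fiberMetric_eq hf hconv hcov hmax hφ hχ hz
    rw [coordSnd_vertical hφ hχ hz, naturalComponent, h1, h2]
    have h3 : (k * δ z.2) ^ 2 * (k * k * m z) = (k * k) ^ 2 * (δ z.2 ^ 2 * m z) := by ring
    rw [h3, Real.sqrt_mul (sq_nonneg _), Real.sqrt_sq (mul_self_nonneg k)]
    have h4 : √(δ z.2 ^ 2 * m z) ≠ 0 := (Real.sqrt_pos.2 (hpos z hz)).ne'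
    rw [← hk]
    field_simp
  have sF₁ : ContDiffOn ℝ ∞ (fun z => fderiv ℝ (coordSystem φ₁ χ f) z (0, 1)) (φ₁.prod χ).target :=
    L₁.contDiffOn_F.lieD L₁.isOpen (X := fun _ => (0, 1)) contDiffOn_const
  have sδ₁ := (contDiff_detForm.comp_contDiffOn sF₁).clm_apply L₁.contDiffOn_F
  have sδ : ContDiffOn ℝ ∞ (fun z : Plane × ℝ => δ z.2) (φ.prod χ).target :=
    sδ₁.comp (contDiffOn_const.prodMk contDiffOn_snd) fun z hz => ⟨φ₁.map_source hq, hz.2⟩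
  have sF : ContDiffOn ℝ ∞ (fun z => fderiv ℝ (coordSystem φ χ f) z (0, 1)) (φ.prod χ).target :=
    L.contDiffOn_F.lieD hΩ (X := fun _ => (0, 1)) contDiffOn_const
  have sη : ContDiffOn ℝ ∞ (fun z => fderiv ℝ (coordCovector φ χ cov) z (0, 1)) (φ.prod χ).target :=
    L.contDiffOn_η.lieD hΩ (X := fun _ => (0, 1)) contDiffOn_const
  have sm : ContDiffOn ℝ ∞ m (φ.prod χ).target := sη.clm_apply sF
  refine ⟨ContDiffOn.congr ?_ heq, fun z hz => ?_⟩
  · exact sδ.div (((sδ.pow 2).mul sm).sqrt fun z hz => (hpos z hz).ne')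
      fun z hz => (Real.sqrt_pos.2 (hpos z hz)).ne'
  · rw [heq z hz]
    change δ z.2 / √(δ z.2 ^ 2 * m z) * (δ z.2 / √(δ z.2 ^ 2 * m z)) * m z = 1
    rw [div_mul_div_comm, Real.mul_self_sqrt (hpos z hz).le]
    have := hδ z hz
    have := (hm z hz).ne'
    field_simp

theorem contMDiff_natural (q : M) : ContMDiff prodModel prodModel.tangent ∞ (fun p : M × U =>
    (⟨p, vertLift (naturalComponent f cov q) p⟩ : TangentBundle prodModel (M × U))) := by
  intro p
  have hφ := isSmoothChart_chartAt_plane p.1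
  have hχ := isSmoothChart_chartAt p.2
  have hp : p ∈ ((chartAt Plane p.1).prod (chartAt ℝ p.2)).source :=
    ⟨mem_chart_source Plane p.1, mem_chart_source ℝ p.2⟩
  have hn := (((chartAt Plane p.1).prod (chartAt ℝ p.2)).open_target).mem_nhds
    (((chartAt Plane p.1).prod (chartAt ℝ p.2)).map_source hp)
  have h1 := ((coordSnd_natural hf hconv hε hcov hmax hφ hχ q).1.contDiffAt hn)
  exact (hφ.prod hχ).contMDiffAt_of_coordField hp
    ((contDiffAt_const.prodMk h1).congr_of_eventuallyEq (Filter.eventuallyEq_of_mem hn fun y hy =>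
      coordField_natural hφ hχ q hy))

/-- The equation of the centro-affine curvature, at a point of `M × U`. -/
theorem exists_centroaffine (q : M) (p : M × U) : ∃ b : ℝ,
    lieDerivForm (vertLift (naturalComponent f cov q))
      (lieDerivForm (vertLift (naturalComponent f cov q)) cov) p =
    -ε • cov p + b • lieDerivForm (vertLift (naturalComponent f cov q)) cov p := by
  have hφ := isSmoothChart_chartAt_plane p.1
  have hχ := isSmoothChart_chartAt p.2
  set φ := chartAt Plane p.1
  set χ := chartAt ℝ p.2
  have hp : p ∈ (φ.prod χ).source := ⟨mem_chart_source Plane p.1, mem_chart_source ℝ p.2⟩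
  have hz := (φ.prod χ).map_source hp
  set z := φ.prod χ p with hzdef
  have hzp : (φ.symm z.1, χ.symm z.2) = p := (φ.prod χ).left_inv hp
  have L := localCovector hf hconv hε hcov hmax hφ hχ
  have hΩ := L.isOpen
  obtain ⟨sa, hnorm⟩ := coordSnd_natural hf hconv hε hcov hmax hφ hχ q
  obtain ⟨b, hb⟩ := L.exists_natural sa hnorm hz
  refine ⟨b, ?_⟩
  set v : (p : M × U) → TangentSpace prodModel p := vertLift (naturalComponent f cov q)
  have sη := L.contDiffOn_η
  have h0 : ∀ y ∈ (φ.prod χ).target, coordCovector φ χ (lieDerivForm v cov) y =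
      lieD (vertField (coordSnd φ χ v)) (coordCovector φ χ cov) y := fun y hy =>
    coordCovector_lieDerivForm hφ hχ (sη.differentiableAt_of_isOpen hΩ hy) hy v
  have h2 : ContDiffOn ℝ ∞ (coordCovector φ χ (lieDerivForm v cov)) (φ.prod χ).target :=
    (sη.lieD hΩ (contDiffOn_const.prodMk sa)).congr h0
  have h3 := coordCovector_lieDerivForm hφ hχ (h2.differentiableAt_of_isOpen hΩ hz) hz v
  rw [lieD_congr hΩ h0 hz, hb, ← h0 z hz] at h3
  have h4 : ∀ A : M × U → (Plane →L[ℝ] ℝ), (coordCovector φ χ A z).comp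
      (mfderiv surfaceModel 𝓘(ℝ, Plane) φ (φ.symm z.1) : Plane →L[ℝ] Plane) = A p := fun A => by
    ext1 y
    rw [← hzp]
    exact congrArg (A (φ.symm z.1, χ.symm z.2)) (hφ.mfderiv_symm_mfderiv' hz.1 y)
  rw [← h4 (lieDerivForm v (lieDerivForm v cov)), h3, ← h4 cov, ← h4 (lieDerivForm v cov)]
  rfl

/-- Hamilton's equations can be solved at every point. -/
theorem exists_ham (p : M × U) : ∃ ξ : TangentSpace prodModel p, ξ.1 = f p.1 p.2 ∧
    ∀ Y : (q : M) → TangentSpace surfaceModel q,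
      ContMDiffAt surfaceModel surfaceModel.tangent ∞
        (fun q => (⟨q, Y q⟩ : TangentBundle surfaceModel M)) p.1 →
      mfderiv prodModel 𝓘(ℝ, ℝ) (fun p' : M × U => cov p' (Y p'.1)) p ξ =
        cov p (mlieBracket surfaceModel (fun q => f q p.2) Y p.1) := by
  obtain ⟨φ, χ, hφ, hχ, hp⟩ : ∃ (φ : OpenPartialHomeomorph M Plane)
    (χ : OpenPartialHomeomorph U ℝ), IsSmoothChart surfaceModel φ ∧ IsSmoothChart curveModel χ ∧
    p ∈ (φ.prod χ).source := ⟨_, _, isSmoothChart_chartAt_plane p.1, isSmoothChart_chartAt p.2,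
      mem_chart_source Plane p.1, mem_chart_source ℝ p.2⟩
  obtain ⟨z, hz, rfl⟩ : ∃ z ∈ (φ.prod χ).target, (φ.prod χ).symm z = p :=
    ⟨φ.prod χ p, (φ.prod χ).map_source hp, (φ.prod χ).left_inv hp⟩
  have L := localCovector hf hconv hε hcov hmax hφ hχ
  have hΩ := L.isOpen
  have hn := hΩ.mem_nhds hz
  obtain ⟨c, hc⟩ := L.exists_hamilton hz
  refine ⟨(f (φ.symm z.1) (χ.symm z.2), mfderiv 𝓘(ℝ, ℝ) curveModel χ.symm z.2 c), rfl,
    fun Y hY => ?_⟩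
  have hYs := hφ.contDiffAt_coordField (X := Y) hz.1 hY
  have hY1 : DifferentiableAt ℝ (fun z : Plane × ℝ => coordField surfaceModel φ Y z.1) z :=
    (ContDiffAt.differentiableAt hYs (by simp)).comp z differentiableAt_fst
  have hηd := L.contDiffOn_η.differentiableAt_of_isOpen hΩ hz
  have h1 := (hφ.prod hχ).mfderiv_apply (fun p' => cov p' (Y p'.1)) hz
    ((f (φ.symm z.1) (χ.symm z.2) : Plane), mfderiv 𝓘(ℝ, ℝ) curveModel χ.symm z.2 c)
  have h2 : mfderiv prodModel 𝓘(ℝ, Plane × ℝ) (φ.prod χ) ((φ.prod χ).symm z)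
      ((f (φ.symm z.1) (χ.symm z.2) : Plane), mfderiv 𝓘(ℝ, ℝ) curveModel χ.symm z.2 c) =
      (coordSystem φ χ f z, c) :=
    (mfderiv_prodChart hφ hχ (φ.map_target hz.1) (χ.map_target hz.2) _).trans
      (Prod.ext rfl (hχ.mfderiv_mfderiv_symm hz.2 c))
  have h3 : (fun z' => cov ((φ.prod χ).symm z') (Y ((φ.prod χ).symm z').1)) =ᶠ[nhds z]
      fun z' => coordCovector φ χ cov z' (coordField surfaceModel φ Y z'.1) :=
    Filter.eventuallyEq_of_mem hn fun x hx => congrArg (cov (φ.symm x.1, χ.symm x.2))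
      (hφ.mfderiv_symm_mfderiv' hx.1 _).symm
  have h4 := lieD_clm_apply (X := fun _ => (coordSystem φ χ f z, c)) hηd hY1
  refine h1.trans ?_
  rw [h2, h3.fderiv_eq]
  refine h4.trans ?_
  have h5 : ContDiffAt ℝ ∞ (coordField surfaceModel φ fun q => f q (χ.symm z.2)) z.1 :=
    ContDiffAt.comp z.1 (f := fun x => (x, z.2)) (g := coordSystem φ χ f)
      (L.contDiffOn_F.contDiffAt hn) (contDiffAt_id.prodMk contDiffAt_const)
  have h6 : cov ((φ.prod χ).symm z) (mlieBracket surfaceModel (fun q => f q (χ.symm z.2)) Y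
      (φ.symm z.1)) = coordCovector φ χ cov z (coordField surfaceModel φ
        (mlieBracket surfaceModel (fun q => f q (χ.symm z.2)) Y) z.1) :=
    congrArg (cov (φ.symm z.1, χ.symm z.2)) (hφ.mfderiv_symm_mfderiv' hz.1 _).symm
  refine Eq.trans ?_ h6.symm
  rw [hφ.coordField_mlieBracket hz.1 h5 hYs]
  have h7 : fderiv ℝ (coordField surfaceModel φ fun q => f q (χ.symm z.2)) z.1
      (coordField surfaceModel φ Y z.1) =
      fderiv ℝ (coordSystem φ χ f) z (coordField surfaceModel φ Y z.1, 0) :=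
    fderiv_partial_fst (L.contDiffOn_F.differentiableAt_of_isOpen hΩ hz) _
  have h8 : fderiv ℝ (fun z : Plane × ℝ => coordField surfaceModel φ Y z.1) z
      (coordSystem φ χ f z, c) = fderiv ℝ (coordField surfaceModel φ Y) z.1 (coordSystem φ χ f z) :=
    congrArg (fun A : Plane × ℝ →L[ℝ] Plane => A (coordSystem φ χ f z, c))
      ((ContDiffAt.differentiableAt hYs (by simp)).hasFDerivAt.comp z hasFDerivAt_fst).fderiv
  rw [lieBracket, h7, map_sub, lieD, lieD, h8, hc]
  have h9 : (coordField surfaceModel φ fun q => f q (χ.symm z.2)) z.1 = coordSystem φ χ f z := rfl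
  rw [h9]
  ring

end Existence

/-- The feedback invariants exist. -/
theorem nonempty_feedbackInvariants {M : Type*} [TopologicalSpace M] [ConnectedSpace M]
    [ChartedSpace Plane M] [IsManifold surfaceModel ∞ M]
    {U : Type*} [TopologicalSpace U] [ConnectedSpace U] [ChartedSpace ℝ U]
    [IsManifold curveModel ∞ U] {f : (q : M) → U → TangentSpace surfaceModel q}
    (hf : IsSmoothSystem f) (hconv : IsStronglyConvex f) : Nonempty (FeedbackInvariants f) := by
  obtain ⟨ε, hε, hext⟩ := exists_extremalSet_eq_univ hf hconv
  choose cov hcov hmax using hext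
  obtain ⟨q⟩ : Nonempty M := inferInstance
  choose b hb using exists_centroaffine hf hconv hε hcov hmax q
  choose ham hham1 hham2 using exists_ham hf hconv hε hcov hmax
  have D : Invariants f ε cov ham (vertLift (naturalComponent f cov q)) b :=
    ⟨hε, hcov, hmax, hham1, hham2, contMDiff_natural hf hconv hε hcov hmax q, fun _ => rfl, hb⟩
  -- The bracket `[h, [v, h]]` is vertical, hence a multiple of `v`.
  have hκ : ∀ p, ∃ κ : ℝ, mlieBracket prodModel ham
      (mlieBracket prodModel (vertLift (naturalComponent f cov q)) ham) p =
      κ • vertLift (naturalComponent f cov q) p := by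
    intro p
    obtain ⟨φ, χ, hφ, hχ, hp⟩ : ∃ (φ : OpenPartialHomeomorph M Plane)
      (χ : OpenPartialHomeomorph U ℝ), IsSmoothChart surfaceModel φ ∧ IsSmoothChart curveModel χ ∧
      p ∈ (φ.prod χ).source := ⟨_, _, isSmoothChart_chartAt_plane p.1, isSmoothChart_chartAt p.2,
        mem_chart_source Plane p.1, mem_chart_source ℝ p.2⟩
    obtain ⟨z, hz, rfl⟩ : ∃ z ∈ (φ.prod χ).target, (φ.prod χ).symm z = p :=
      ⟨φ.prod χ p, (φ.prod χ).map_source hp, (φ.prod χ).left_inv hp⟩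
    have L := D.local_invariants hf hconv hφ hχ
    have h1 := D.coordField_bracket_bracket hf hconv hφ hχ hz
    have h2 := L.bracket_bracket_fst hz
    have h3 := L.a_ne_zero hz
    refine ⟨(coordField prodModel (φ.prod χ) (mlieBracket prodModel ham (mlieBracket prodModel
      (vertLift (naturalComponent f cov q)) ham)) z).2 /
      coordSnd φ χ (vertLift (naturalComponent f cov q)) z, ?_⟩
    have h4 : coordField prodModel (φ.prod χ) (mlieBracket prodModel ham (mlieBracket prodModel
        (vertLift (naturalComponent f cov q)) ham)) z =
        ((coordField prodModel (φ.prod χ) (mlieBracket prodModel ham (mlieBracket prodModel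
          (vertLift (naturalComponent f cov q)) ham)) z).2 /
          coordSnd φ χ (vertLift (naturalComponent f cov q)) z) •
        coordField prodModel (φ.prod χ) (vertLift (naturalComponent f cov q)) z := by
      rw [D.coordField_v hφ hχ hz]
      refine Prod.ext ?_ ?_
      · rw [h1, h2]
        simp [vertField]
      · simp [vertField, h3]
    have hP := hφ.prod hχ
    rw [← hP.mfderiv_symm_mfderiv' hz (mlieBracket prodModel ham (mlieBracket prodModel
        (vertLift (naturalComponent f cov q)) ham) ((φ.prod χ).symm z)),
      ← hP.mfderiv_symm_mfderiv' hz (vertLift (naturalComponent f cov q) ((φ.prod χ).symm z))]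
    exact (congrArg (mfderiv 𝓘(ℝ, Plane × ℝ) prodModel (φ.prod χ).symm z) h4).trans
      (ContinuousLinearMap.map_smul (mfderiv 𝓘(ℝ, Plane × ℝ) prodModel (φ.prod χ).symm z) _ _)
  choose κ hκ using hκ
  exact ⟨⟨ε, cov, ham, vertLift (naturalComponent f cov q), b, κ, hε, hcov, hmax, hham1, hham2,
    contMDiff_natural hf hconv hε hcov hmax q, fun _ => rfl, hb, hκ⟩⟩

theorem mainTheorem2
    {M : Type*} [TopologicalSpace M] [T2Space M] [SecondCountableTopology M] [ConnectedSpace M]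
    [ChartedSpace Plane M] [IsManifold surfaceModel ∞ M]
    {U : Type*} [TopologicalSpace U] [T2Space U] [SecondCountableTopology U] [ConnectedSpace U]
    [ChartedSpace ℝ U] [IsManifold curveModel ∞ U]
    (f : (q : M) → U → TangentSpace surfaceModel q)
    (hf : IsSmoothSystem f) (hconv : IsStronglyConvex f) :
    Nonempty (FeedbackInvariants f) ∧
    ∀ D : FeedbackInvariants f,
      IsTrivializable f ↔
        (∀ p : M × U, D.κ p = 0) ∧
        (∀ p : M × U, lieDerivFun D.ham D.b p = 0) ∧
        (∀ p : M × U, lieDerivFun (mlieBracket prodModel D.v D.ham) D.b p = 0) := by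
  refine ⟨nonempty_feedbackInvariants hf hconv, fun D => ⟨fun h => ?_, fun h => ?_⟩⟩
  · have hflat := D.isFlatAt_of_isTrivializable hf hconv h
    exact ⟨fun p => (hflat p).1, fun p => (hflat p).2.1, fun p => (hflat p).2.2⟩
  · exact D.isTrivializable_of_isFlatAt hf hconv fun p => ⟨h.1 p, h.2.1 p, h.2.2 p⟩
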